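/- \textbf{Setting.} Let $S_T$ be a $[0,\infty)^m$-valued random vector, $w\in[0,\infty)^m$, and let $H(K)=\mathbb{E}[\max(K-w\cdot S_T,0)]$ be the price of the basket put with strike $K$. Let $M>0$ and $\nu>4$. For $n,N\ge 1$ let $A_1,\dots,A_N,B_1,\dots,B_N,X_1,\dots,X_n,\varepsilon_1,\dots,\varepsilon_n,\bar X$ be independent real random variables such that: each $A_j$ has Student's distribution $t_\nu(0,1)$; each $B_j$ has a density $\pi_{\mathrm b}$ for which there is a polynomial $p_{\mathrm b}:\mathbb{R}\to(0,\infty)$ with $1\le p_{\mathrm b}(z)\pi_{\mathrm b}(z)$ for all $z\in\mathbb{R}$; each $X_i$ and $\bar X$ are uniform on $[0,M]$; the $\varepsilon_i$ are identically distributed with $\mathbb{E}[\varepsilon_1]=0$ and $\mathbb{E}[\varepsilon_1^4]<\infty$. The observed quotes are $Y_i=H(X_i)+\varepsilon_i$, and $D_n=((X_1,Y_1),\dots,(X_n,Y_n))$. With $\varrho(z)=\max(z,0)$ put $H^{A,B}_W(x)=\sum_{j=1}^N W_j\,\varrho(A_jx+B_j)$, $\mathcal{R}_n(W)=\frac1n\sum_{i=1}^n(H^{A,B}_W(X_i)-Y_i)^2$,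 $\mathbf{X}^i=(\varrho(A_jX_i+B_j))_{j=1}^N$ and $T_M(u)=\max(\min(u,M),-M)$. Consider the following estimators. (a) $\widehat W$ minimizes $\mathcal{R}_n$ over all $\sigma(A,B,D_n)$-measurable $\mathbb{R}^N$-valued random vectors. (b) For $\lambda>0$, $\widehat W_\lambda$ minimizes $\mathcal{R}_n$ over all $\sigma(A,B,D_n)$-measurable random vectors $W$ with $\|W\|\le\lambda$ almost surely. (c) For $\lambda>0$, $\eta_0>0$, $\mathcal{T}\ge 2$ and a batch size $\mathfrak{B}\in\{1,\dots,n\}$, $W_{\mathcal{T}}$ is given by $W_1=0$ and $$W_{t+1}=\Pi\Big(W_t-\frac{2\eta_0t^{-1/2}}{\mathfrak{B}}\sum_{i=1}^{\mathfrak{B}}\mathbf{X}^{J_{i,t}}(W_t\cdot\mathbf{X}^{J_{i,t}}-Y_{J_{i,t}})\Big),\qquad t=1,\dots,\mathcal{T}-1,$$ where $\Pi$ is the orthogonal projection onto $\{v\in\mathbb{R}^N:\|v\|\le\lambda\}$ and $(J_{i,t})_{1\le i\le\mathfrak{B},\,1\le t\le\mathcal{T}}$ are i.i.d. uniform on $\{1,\dots,n\}$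 and independent of $(A,B,D_n,\bar X)$. \textbf{Statement.} There is $\beta_0$, depending only on $\nu$ and $\pi_{\mathrm b}$, such that the following holds whenever, for some $\beta\ge\beta_0$ and $C>0$, $$|\mathbb{E}[e^{-i\xi\, w\cdot S_T}]|\le C(1+|\xi|)^{-\beta}\qquad\text{for all }\xi\in\mathbb{R}$$ (for every $\beta$ this is implied, with a suitable $C$, by a bound $|\mathbb{E}[e^{-i\xi\, w\cdot S_T}]|\le C'\exp(-c|\xi|^\alpha)$ with $C',c,\alpha>0$). There exist $C_0,\underline{c}>0$ such that $$\mathbb{E}\big[|H(\bar X)-T_M(H^{A,B}_{\widehat W}(\bar X))|^2\big]^{1/2}\le C_0\left(\frac{(\log n+1)^{1/2}\sqrt N}{\sqrt n}+\frac1{\sqrt N}\right),$$ and for all $\bar c,\eta_0>0$ there exist $C_1,C_2>0$ such that for every $\lambda\in\frac1{\sqrt N}[\underline{c},\bar c]$ $$\mathbb{E}\big[|H(\bar X)-H^{A,B}_{\widehat W_\lambda}(\bar X)|^2\big]^{1/2}\le C_1\left(\frac1{\sqrt N}+\frac1{n^{1/4}}\right)$$ and, if moreover $\mathbb{E}[B_1^4]<\infty$,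 $$\mathbb{E}\big[|H(\bar X)-H^{A,B}_{W_{\mathcal{T}}}(\bar X)|^2\big]^{1/2}\le C_2\left(\frac1{\sqrt N}+\frac1{n^{1/4}}+\frac{N(2+\log\mathcal{T})^{1/2}}{\mathcal{T}^{1/4}}\right).$$ The constants $C_0,C_1,C_2,\underline{c}$ do not depend on $n$, $N$, $\mathcal{T}$, $\lambda$ or $\mathfrak{B}$, and $C_0,\underline{c}$ do not depend on $\bar c,\eta_0$. -/

import Mathlib

open MeasureTheory ProbabilityTheory

universe u v

/-- The ReLU activation function. -/
def relu (z : ℝ) : ℝ := max z 0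

/-- Truncation at level `L`: `T_L(u) = max(min(u, L), -L)`. -/
def truncate (L u : ℝ) : ℝ := max (min u L) (-L)

/-- The vector of hidden features `(ϱ(a_j x + b_j))_j` at a point `x` of the real line. -/
noncomputable def features {N : ℕ} (a b : Fin N → ℝ) (x : ℝ) : EuclideanSpace ℝ (Fin N) :=
  WithLp.toLp 2 fun j => relu (a j * x + b j)

/-- The network `H^{a,b}_w(x) = ∑ j, w_j ϱ(a_j x + b_j)`. -/
noncomputable def network {N : ℕ} (a b : Fin N → ℝ) (w : EuclideanSpace ℝ (Fin N)) (x : ℝ) : ℝ :=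
  ∑ j, w j * relu (a j * x + b j)

/-- The empirical risk `(1/n) ∑ i, (H^{a,b}_w(x_i) - y_i)²`. -/
noncomputable def empiricalRisk {N n : ℕ} (a b : Fin N → ℝ) (x y : Fin n → ℝ)
    (w : EuclideanSpace ℝ (Fin N)) : ℝ :=
  (1 / (n : ℝ)) * ∑ i, (network a b w (x i) - y i) ^ 2

/-- Student's `t`-distribution `t_ν(0,1)` on the real line. -/
noncomputable def studentT (ν : ℝ) : Measure ℝ :=
  volume.withDensity fun x => ENNReal.ofReal
    (Real.Gamma ((ν + 1) / 2) / (√(ν * Real.pi) * Real.Gamma (ν / 2))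
      * (1 + x ^ 2 / ν) ^ (-((ν + 1) / 2)))

/-- `π` has at most polynomial decay: `1 ≤ p(z) π(z)` for a positive polynomial `p`. -/
def AtMostPolynomialDecay (π : ℝ → ℝ) : Prop :=
  ∃ p : Polynomial ℝ, (∀ z, 0 < p.eval z) ∧ ∀ z, 1 ≤ p.eval z * π z

/-- The value `w · s` of a basket. -/
def basket {m : ℕ} (w s : Fin m → ℝ) : ℝ := ∑ i, w i * s i

/-- The basket put price `H(K) = E[(K - w · S)^+]`. -/
noncomputable def putPrice {Ω₀ : Type*} [MeasurableSpace Ω₀] (P₀ : Measure Ω₀) {m : ℕ}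
    (w : Fin m → ℝ) (S : Ω₀ → Fin m → ℝ) (K : ℝ) : ℝ :=
  ∫ ω, max (K - basket w (S ω)) 0 ∂P₀

/-- The quotes `Y_i = H(X_i) + ε_i`. -/
def quote {Ω : Type*} {n : ℕ} (H : ℝ → ℝ) (X ε : Fin n → Ω → ℝ) (i : Fin n) (ω : Ω) : ℝ :=
  H (X i ω) + ε i ω

/-- The hidden weights `A, B`, the strikes `X`, the noise `ε` and the test strike `Xbar`:
all these real random variables are mutually independent, `A_j ∼ t_ν(0,1)`, `B_j` has density
`πb`, `X_i` and `Xbar` are uniform on `[0,M]`, and `ε_i` has law `με`. -/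
structure IsSample {Ω : Type*} [MeasurableSpace Ω] (P : Measure Ω) (ν M : ℝ) (πb : ℝ → ℝ)
    (με : Measure ℝ) {N n : ℕ} (A B : Fin N → Ω → ℝ) (X ε : Fin n → Ω → ℝ) (Xbar : Ω → ℝ) :
    Prop where
  measurable_A : ∀ j, Measurable (A j)
  measurable_B : ∀ j, Measurable (B j)
  measurable_X : ∀ i, Measurable (X i)
  measurable_noise : ∀ i, Measurable (ε i)
  measurable_Xbar : Measurable Xbar
  law_A : ∀ j, P.map (A j) = studentT ν
  law_B : ∀ j, P.map (B j) = volume.withDensity fun z => ENNReal.ofReal (πb z)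
  law_X : ∀ i, pdf.IsUniform (X i) (Set.Icc 0 M) P volume
  law_noise : ∀ i, P.map (ε i) = με
  law_Xbar : pdf.IsUniform Xbar (Set.Icc 0 M) P volume
  indep : iIndepFun
    (Sum.elim A (Sum.elim B (Sum.elim X (Sum.elim ε fun _ : Unit => Xbar)))) P

/-- The random vectors `W` that are measurable with respect to `σ(A, B, D_n)`, where
`D_n = ((X_1,Y_1),…,(X_n,Y_n))` is the data. -/
def dataMeasurable {Ω : Type*} {N n : ℕ} (A B : Fin N → Ω → ℝ) (X Y : Fin n → Ω → ℝ) :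
    Set (Ω → EuclideanSpace ℝ (Fin N)) :=
  {W | Measurable[MeasurableSpace.comap
    (fun ω => ((fun j => A j ω, fun j => B j ω), (fun i => (X i ω, Y i ω)))) inferInstance] W}

/-- The members `W` of `dataMeasurable` with `‖W‖ ≤ lam` almost surely. -/
def constrainedWeights {Ω : Type*} [MeasurableSpace Ω] (P : Measure Ω) {N n : ℕ}
    (A B : Fin N → Ω → ℝ) (X Y : Fin n → Ω → ℝ) (lam : ℝ) :
    Set (Ω → EuclideanSpace ℝ (Fin N)) :=
  {W | W ∈ dataMeasurable A B X Y ∧ ∀ᵐ ω ∂P, ‖W ω‖ ≤ lam}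

/-- `What` is an empirical risk minimizer over the class `𝒲` of random weight vectors. -/
def IsERM {Ω : Type*} [MeasurableSpace Ω] (P : Measure Ω) {N n : ℕ}
    (A B : Fin N → Ω → ℝ) (X Y : Fin n → Ω → ℝ)
    (𝒲 : Set (Ω → EuclideanSpace ℝ (Fin N))) (What : Ω → EuclideanSpace ℝ (Fin N)) : Prop :=
  What ∈ 𝒲 ∧ ∀ W ∈ 𝒲, ∀ᵐ ω ∂P,
    empiricalRisk (fun j => A j ω) (fun j => B j ω) (fun i => X i ω) (fun i => Y i ω) (What ω) ≤
    empiricalRisk (fun j => A j ω) (fun j => B j ω) (fun i => X i ω) (fun i => Y i ω) (W ω)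

/-- The orthogonal projection onto the closed ball of radius `lam` around the origin. -/
noncomputable def ballProj {N : ℕ} (lam : ℝ) (v : EuclideanSpace ℝ (Fin N)) :
    EuclideanSpace ℝ (Fin N) :=
  if ‖v‖ ≤ lam then v else (lam / ‖v‖) • v

/-- `ballProj lam v` is the point of the ball that is closest to `v`. -/
theorem ballProj_nearest {N : ℕ} {lam : ℝ} (hlam : 0 ≤ lam) (v : EuclideanSpace ℝ (Fin N)) :
    ‖ballProj lam v‖ ≤ lam ∧ ∀ u, ‖u‖ ≤ lam → ‖v - ballProj lam v‖ ≤ ‖v - u‖ := by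
  unfold ballProj
  split_ifs with h
  · exact ⟨h, fun u _ => by simp⟩
  · have hv : 0 < ‖v‖ := lt_of_le_of_lt hlam (not_le.mp h)
    refine ⟨?_, fun u hu => ?_⟩
    · rw [norm_smul, Real.norm_of_nonneg (div_nonneg hlam hv.le), div_mul_cancel₀ _ hv.ne']
    · have h1 : v - (lam / ‖v‖) • v = (1 - lam / ‖v‖) • v := by rw [sub_smul, one_smul]
      have h2 : 0 ≤ 1 - lam / ‖v‖ := by
        rw [sub_nonneg, div_le_one hv]; exact (not_le.mp h).le
      rw [h1, norm_smul, Real.norm_of_nonneg h2, sub_mul, one_mul, div_mul_cancel₀ _ hv.ne']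
      have := norm_sub_norm_le v u
      linarith

/-- The projected stochastic gradient descent iterates for the data `x, y`, hidden weights `a, b`,
batch size `𝔅`, batch indices `J i t` and step sizes `η_t = η₀ t^{-1/2}`:
`W_1 = 0` and `W_{t+1} = Π(W_t - (2 η_t / 𝔅) ∑ i, 𝐱^{J i t} (W_t · 𝐱^{J i t} - y_{J i t}))`
for `t ≥ 1`, where `𝐱^k` is the feature vector of `x_k`. (The value at `0` plays no role.) -/
noncomputable def sgd {N n 𝔅 : ℕ} (a b : Fin N → ℝ) (x y : Fin n → ℝ) (lam η₀ : ℝ)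
    (J : Fin 𝔅 → ℕ → Fin n) : ℕ → EuclideanSpace ℝ (Fin N)
  | 0 => 0
  | 1 => 0
  | t + 2 =>
    let W := sgd a b x y lam η₀ J (t + 1)
    let η : ℝ := η₀ * ((t + 1 : ℕ) : ℝ) ^ (-(1 / 2) : ℝ)
    ballProj lam (W - (2 * η / 𝔅) • ∑ i : Fin 𝔅,
      (inner ℝ W (features a b (x (J i (t + 1)))) - y (J i (t + 1))) •
        features a b (x (J i (t + 1))))

/-- The batch indices `J i t`, `i = 1,…,𝔅`, `t = 1,…,T`, are i.i.d., uniform on the `n` sample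
indices and independent of all the other random variables. -/
structure IsBatchSample {Ω : Type*} [MeasurableSpace Ω] (P : Measure Ω) {N n 𝔅 : ℕ} (T : ℕ)
    (A B : Fin N → Ω → ℝ) (X ε : Fin n → Ω → ℝ) (Xbar : Ω → ℝ)
    (J : Fin 𝔅 → ℕ → Ω → Fin n) : Prop where
  measurable_J : ∀ i, ∀ t ∈ Finset.Icc 1 T, Measurable (J i t)
  law_J : ∀ i, ∀ t ∈ Finset.Icc 1 T, P.map (J i t) = uniformOn Set.univ
  indep_J : iIndepFun (fun (k : Fin 𝔅 × Finset.Icc 1 T) => J k.1 k.2) P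
  indep : IndepFun (fun ω => fun (k : Fin 𝔅 × Finset.Icc 1 T) => J k.1 k.2 ω)
    (fun ω => ((fun j => A j ω, fun j => B j ω), (fun i => X i ω, fun i => ε i ω), Xbar ω)) P

/-!
The exponent `β₀ = 2` works. The decay hypothesis makes the characteristic function of the basket
value integrable, so its law gives every interval a mass at most a constant times the length
(`measureReal_Icc_le_of_charFun`, by testing against a Gaussian) and has a bounded density `f`. The
put price is then `H(x) = ∫ f(t) (x - t)⁺ dt`. The density of `A` is bounded below on `[1,2]`, that
of `B` on `[-2M,0]`, and `ϱ(a x - a t) = a (x - t)⁺` for `a > 0`, so the substitution `b = -a t`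
gives `H(x) = E[g(A,B) ϱ(A x + B)]` on `[0,M]` with `g` bounded and supported in
`[1,2] × [-2M,0]` (`exists_featureRepresentation`). The random network with weights `g(A_j,B_j)/N`,
whose norm is at most a constant over `√N`, is a mean of `N` independent copies of a bounded
variable with expectation `H(x)`, and so approximates `H` with mean square error of order `1/N`
(`lintegral_sq_sub_network_approxWeights_le`). These weights are the comparison for all three
estimators.

*Truncated least squares.* The strikes of the sample and the test strike are `n + 1` exchangeable
points. Let `P` be the orthogonal projection onto the space of all predictions at these points. When
the leverage `P_kk` of the left-out point is at most `1/2`, the leave-one-out formula bounds the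
prediction error there by twice the sum of the residual of `P H` and of the noise term
`∑ P_ki ε_i`, whose variance is at most a constant times the leverage; otherwise truncation bounds
the error by `2M` (`truncated_leaveOneOut_le`). By exchangeability the mean squared residual is at
most that of the comparison network, and the expected leverage is at most `N/(n+1)` because
`tr P ≤ N`. The mean square error is therefore of order `N/n + 1/N`, which is better than the rate
claimed by a logarithm.

*Bounded weights.* The error `H_W - H` is a linear combination of `1`, of `H` and of the features
`(ϱ(A_j x + B_j) - ϱ(B_j))/√N`, with coefficients `H_W(0)`, `-1` and `√N W_j`. Subtracting `ϱ(B_j)`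
makes the sum of the squares of these functions bounded on `[0,M]` in terms of the slopes alone,
whatever the law of `B` is. A deterministic oracle inequality (`integral_sq_le_empirical_add`)
bounds the population risk by the excess empirical risk over the comparison network, plus the
deviations of the empirical second moments and noise correlations, which are of order `n^{-1/2}` in
quadratic mean. The coefficient `H_W(0)` is controlled for the constrained minimizer by comparing
its empirical risk with that of the zero weights (`network_zero_sq_le_of_empiricalRisk_le`), and
for gradient descent by the fourth moment of `B`.

*Gradient descent.* Averaged over the independent batch indices, the empirical risk of the last
iterate exceeds that of any fixed weights in the ball by a term of order `(2 + log T)/√T` times a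
bound for the squared gradients (`uniformMean_empiricalRisk_sgd_le`), which follows by comparing the
averages over the final segments of the trajectory (`last_iterate_le`). The squared gradients are of
order `N` in expectation, by the fourth moments of `A`, `B` and the noise.
-/

/-! ### Bounded densities from integrable characteristic functions -/

/-- An interval has mass at most a constant times its length when the characteristic function is
integrable. The characteristic function is integrated against a centred Gaussian of variance `h⁻²`
in the frequency; the transform of this Gaussian is at least `exp (-1/2)` on the interval, and its
density is at most `h`. -/
theorem measureReal_Icc_le_of_charFun {μ : Measure ℝ} [IsProbabilityMeasure μ]
    (hint : Integrable (charFun μ)) (m : ℝ) {h : ℝ} (hh : 0 < h) :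
    μ.real (Set.Icc (m - h) (m + h)) ≤ Real.exp (1 / 2) * (∫ ξ, ‖charFun μ ξ‖) * h := by
  set v : NNReal := ⟨(h ^ 2)⁻¹, by positivity⟩ with hv
  have hvr : (v : ℝ) = (h ^ 2)⁻¹ := rfl
  have hv0 : v ≠ 0 := by
    intro h0
    have : (v : ℝ) = 0 := by rw [h0]; rfl
    rw [hvr] at this
    exact (by positivity : ((h ^ 2)⁻¹ : ℝ) ≠ 0) this
  set γ := gaussianReal 0 v
  have hγ : ∀ x : ℝ, ∫ ξ, Complex.exp (((x - m : ℝ) : ℂ) * ξ * Complex.I) ∂γ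
      = ((Real.exp (-(v * (x - m) ^ 2 / 2)) : ℝ) : ℂ) := by
    intro x
    rw [← charFun_apply_real, charFun_gaussianReal]
    push_cast
    congr 1
    ring
  have hmeas : Integrable (Function.uncurry fun (x ξ : ℝ) =>
      Complex.exp (((x - m : ℝ) : ℂ) * ξ * Complex.I)) (μ.prod γ) := by
    refine Integrable.of_bound (C := 1) (Continuous.aestronglyMeasurable ?_) (.of_forall fun p => ?_)
    · unfold Function.uncurry; fun_prop
    · rw [Function.uncurry, ← Complex.ofReal_mul, Complex.norm_exp_ofReal_mul_I]
  have hinner : ∀ ξ : ℝ, ∫ x, Complex.exp (((x - m : ℝ) : ℂ) * ξ * Complex.I) ∂μ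
      = Complex.exp (((-m * ξ : ℝ) : ℂ) * Complex.I) * charFun μ ξ := by
    intro ξ
    rw [charFun_apply_real, ← integral_const_mul]
    refine integral_congr_ae (.of_forall fun x => ?_)
    simp only
    rw [← Complex.exp_add]
    congr 1
    push_cast
    ring
  have hswap := integral_integral_swap hmeas
  simp_rw [hγ, hinner] at hswap
  rw [integral_complex_ofReal] at hswap
  have hnonneg : 0 ≤ ∫ x, Real.exp (-(v * (x - m) ^ 2 / 2)) ∂μ :=
    integral_nonneg fun x => (Real.exp_pos _).le
  have hle : ∫ x, Real.exp (-(v * (x - m) ^ 2 / 2)) ∂μ ≤ h * ∫ ξ, ‖charFun μ ξ‖ := by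
    have h1 : ∫ x, Real.exp (-(v * (x - m) ^ 2 / 2)) ∂μ
        = ‖∫ ξ, Complex.exp (((-m * ξ : ℝ) : ℂ) * Complex.I) * charFun μ ξ ∂γ‖ := by
      rw [← hswap, Complex.norm_real, Real.norm_of_nonneg hnonneg]
    rw [h1, integral_gaussianReal_eq_integral_smul hv0, ← integral_const_mul]
    refine (norm_integral_le_integral_norm _).trans
      (integral_mono_of_nonneg (.of_forall fun _ => norm_nonneg _) (hint.norm.const_mul h)
        (.of_forall fun ξ => ?_))
    simp only
    rw [norm_smul, norm_mul, Complex.norm_exp_ofReal_mul_I, one_mul]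
    refine mul_le_mul_of_nonneg_right ?_ (norm_nonneg _)
    rw [Real.norm_of_nonneg (gaussianPDFReal_nonneg _ _ _), gaussianPDFReal]
    have h2 : (√(2 * Real.pi * v))⁻¹ ≤ h := by
      rw [inv_le_comm₀ (by rw [hvr]; positivity) hh]
      refine Real.le_sqrt_of_sq_le ?_
      rw [hvr, inv_pow]
      have : (0:ℝ) < (h ^ 2)⁻¹ := by positivity
      nlinarith [Real.pi_gt_three]
    refine (mul_le_of_le_one_right (by positivity) ?_).trans h2
    rw [Real.exp_le_one_iff]
    have : 0 ≤ (ξ - 0) ^ 2 / (2 * (v : ℝ)) := by positivity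
    rw [neg_div]; linarith
  have hind : Real.exp (-(1 / 2)) * μ.real (Set.Icc (m - h) (m + h))
      ≤ ∫ x, Real.exp (-(v * (x - m) ^ 2 / 2)) ∂μ := by
    have hI : Integrable (fun x => Real.exp (-(v * (x - m) ^ 2 / 2))) μ := by
      refine Integrable.of_bound (C := 1) (Continuous.aestronglyMeasurable (by fun_prop))
        (.of_forall fun p => ?_)
      rw [Real.norm_of_nonneg (Real.exp_pos _).le, Real.exp_le_one_iff]
      have : 0 ≤ (v : ℝ) * (p - m) ^ 2 / 2 := by positivity
      linarith
    calc Real.exp (-(1 / 2)) * μ.real (Set.Icc (m - h) (m + h))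
        = ∫ x in Set.Icc (m - h) (m + h), Real.exp (-(1 / 2)) ∂μ := by
          rw [setIntegral_const, smul_eq_mul, mul_comm]
      _ ≤ ∫ x in Set.Icc (m - h) (m + h), Real.exp (-(v * (x - m) ^ 2 / 2)) ∂μ := by
          refine setIntegral_mono_on (integrable_const _).integrableOn hI.integrableOn
            measurableSet_Icc fun x hx => ?_
          rw [Real.exp_le_exp, neg_le_neg_iff]
          have h3 : (x - m) ^ 2 ≤ h ^ 2 := by
            refine sq_le_sq' ?_ ?_ <;> linarith [hx.1, hx.2]
          rw [hvr, inv_mul_eq_div]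
          have : (x - m) ^ 2 / h ^ 2 ≤ 1 := (div_le_one (by positivity)).2 h3
          linarith
      _ ≤ _ := setIntegral_le_integral hI (.of_forall fun x => (Real.exp_pos _).le)
  have hexp : Real.exp (1 / 2) * Real.exp (-(1 / 2)) = 1 := by
    rw [← Real.exp_add]; norm_num
  calc μ.real (Set.Icc (m - h) (m + h))
      = Real.exp (1 / 2) * (Real.exp (-(1 / 2)) * μ.real (Set.Icc (m - h) (m + h))) := by
        rw [← mul_assoc, hexp, one_mul]
    _ ≤ Real.exp (1 / 2) * (h * ∫ ξ, ‖charFun μ ξ‖) :=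
        mul_le_mul_of_nonneg_left (hind.trans hle) (Real.exp_pos _).le
    _ = _ := by ring

/-- A probability measure on the line whose distribution function is Lipschitz is dominated by a
multiple of Lebesgue measure. -/
theorem le_smul_volume_of_measureReal_Icc_le {μ : Measure ℝ} [IsProbabilityMeasure μ] {K : ℝ}
    (hK : 0 ≤ K) (h : ∀ a b, a < b → μ.real (Set.Icc a b) ≤ K * (b - a)) :
    μ ≤ ENNReal.ofReal K • volume := by
  have hcdf : ∀ a b, a ≤ b → cdf μ b - cdf μ a ≤ K * (b - a) := by
    intro a b hab
    rcases hab.eq_or_lt with rfl | hab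
    · simp
    have h1 : ENNReal.ofReal (cdf μ b - cdf μ a) = μ (Set.Ioc a b) := by
      rw [← StieltjesFunction.measure_Ioc, measure_cdf]
    have h2 : cdf μ b - cdf μ a = μ.real (Set.Ioc a b) := by
      rw [Measure.real, ← h1, ENNReal.toReal_ofReal (sub_nonneg.2 (monotone_cdf μ hab.le))]
    rw [h2]
    exact (measureReal_mono Set.Ioc_subset_Icc_self).trans (h a b hab)
  -- `K x - F(x)` is a Stieltjes function, and its measure is `K dx - μ`
  let G : StieltjesFunction ℝ :=
    { toFun := fun x => K * x - cdf μ x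
      mono' := fun a b hab => by
        have := hcdf a b hab
        simp only
        linarith
      right_continuous' := fun x => by
        refine ContinuousWithinAt.sub ?_ ((cdf μ).right_continuous x)
        fun_prop }
  have hG : ENNReal.ofReal K • volume = G.measure + μ := by
    refine Measure.ext_of_Ioc' _ _ (fun a b _ => ?_) fun a b hab => ?_
    · simp [ENNReal.mul_eq_top]
    symm
    have h1 : μ (Set.Ioc a b) = ENNReal.ofReal (cdf μ b - cdf μ a) := by
      rw [← StieltjesFunction.measure_Ioc, measure_cdf]
    rw [Measure.add_apply, h1, StieltjesFunction.measure_Ioc, Measure.smul_apply, Real.volume_Ioc,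
      smul_eq_mul, ← ENNReal.ofReal_mul hK, ← ENNReal.ofReal_add]
    · congr 1
      change (K * b - cdf μ b) - (K * a - cdf μ a) + _ = _
      ring
    · exact sub_nonneg.2 (G.mono hab.le)
    · exact sub_nonneg.2 (monotone_cdf μ hab.le)
  rw [hG]
  exact Measure.le_add_left le_rfl

/-- A measure dominated by a multiple of Lebesgue measure has a bounded density. -/
theorem exists_bounded_density_of_le_smul {μ : Measure ℝ} [IsFiniteMeasure μ] {K : ℝ}
    (hK : 0 ≤ K) (h : μ ≤ ENNReal.ofReal K • volume) :
    ∃ f : ℝ → ℝ, Measurable f ∧ (∀ t, 0 ≤ f t ∧ f t ≤ K) ∧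
      μ = volume.withDensity fun t => ENNReal.ofReal (f t) := by
  have hac : μ ≪ volume :=
    (Measure.absolutelyContinuous_of_le h).trans (Measure.smul_absolutelyContinuous)
  have hd : volume.withDensity (μ.rnDeriv volume) = μ := Measure.withDensity_rnDeriv_eq _ _ hac
  have hle : μ.rnDeriv volume ≤ᵐ[volume] fun _ => ENNReal.ofReal K := by
    refine ae_le_of_forall_setLIntegral_le_of_sigmaFinite (Measure.measurable_rnDeriv _ _) ?_
    intro s hs _
    rw [← withDensity_apply _ hs, hd, setLIntegral_const]
    simpa using h s
  refine ⟨fun t => min (μ.rnDeriv volume t).toReal K,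
    (Measure.measurable_rnDeriv _ _).ennreal_toReal.min measurable_const,
    fun t => ⟨le_min ENNReal.toReal_nonneg hK, min_le_right _ _⟩, ?_⟩
  conv_lhs => rw [← hd]
  refine withDensity_congr_ae ?_
  filter_upwards [hle] with t ht
  have htop : μ.rnDeriv volume t ≠ ⊤ := ne_top_of_le_ne_top ENNReal.ofReal_ne_top ht
  rw [min_eq_left (ENNReal.toReal_le_of_le_ofReal hK ht), ENNReal.ofReal_toReal htop]

/-- Fourier inversion in the form used here: an integrable characteristic function forces a bounded
density. -/
theorem exists_bounded_density_of_integrable_charFun {μ : Measure ℝ} [IsProbabilityMeasure μ]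
    (hint : Integrable (charFun μ)) :
    ∃ K : ℝ, 0 ≤ K ∧ ∃ f : ℝ → ℝ, Measurable f ∧ (∀ t, 0 ≤ f t ∧ f t ≤ K) ∧
      μ = volume.withDensity fun t => ENNReal.ofReal (f t) := by
  have hK : 0 ≤ Real.exp (1 / 2) * ∫ ξ, ‖charFun μ ξ‖ :=
    mul_nonneg (Real.exp_pos _).le (integral_nonneg fun _ => norm_nonneg _)
  refine ⟨_, hK, exists_bounded_density_of_le_smul hK
    (le_smul_volume_of_measureReal_Icc_le hK fun a b hab => ?_)⟩
  have := measureReal_Icc_le_of_charFun hint ((a + b) / 2) (h := (b - a) / 2) (by linarith)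
  rw [show (a + b) / 2 - (b - a) / 2 = a by ring, show (a + b) / 2 + (b - a) / 2 = b by ring] at this
  refine this.trans (mul_le_mul_of_nonneg_left (by linarith) hK)

/-- This is where the decay exponent enters: any exponent greater than `1` would do. -/
theorem integrable_charFun_of_decay {μ : Measure ℝ} [IsProbabilityMeasure μ] {β C : ℝ}
    (hβ : 2 ≤ β) (h : ∀ ξ, ‖charFun μ ξ‖ ≤ C * (1 + |ξ|) ^ (-β)) : Integrable (charFun μ) := by
  have h1 : Integrable fun ξ : ℝ => C * (1 + ‖ξ‖) ^ (-β) :=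
    (integrable_one_add_norm (by simp; linarith)).const_mul C
  exact h1.mono' measurable_charFun.aestronglyMeasurable (.of_forall fun ξ => by simpa using h ξ)

/-! ### Put payoffs as averages of random ReLU features -/

/-- The substitution `b = -a t`, under which `ϱ(a x + b) = a (x - t)⁺`.
-/
theorem lintegral_eq_lintegral_comp_neg_mul {a : ℝ} (ha : 0 < a) {F : ℝ → ENNReal}
    (hF : Measurable F) : ∫⁻ b, F b = ENNReal.ofReal a * ∫⁻ t, F (-a * t) := by
  have h := Real.smul_map_volume_mul_left (a := -a) (by linarith : -a ≠ 0)
  conv_lhs => rw [← h]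
  rw [lintegral_smul_measure, lintegral_map hF (measurable_const_mul _), abs_neg, abs_of_pos ha,
    smul_eq_mul]

theorem measurable_relu : Measurable relu := measurable_id.max measurable_const

theorem relu_nonneg (z : ℝ) : 0 ≤ relu z := le_max_right _ _

/-- Integral representation of a put payoff by random ReLU features. Since
`ϱ(a x - a t) = a ϱ(x - t)` for `a > 0`, the substitution `b = -a t` turns `∫ f(t) (x - t)⁺ dt` into
an expectation of `g(A,B) ϱ(A x + B)`, where `g` is bounded and vanishes outside
`[1,2] × [-2M,0]`. -/
theorem exists_bounded_feature_weight {qA qB f : ℝ → ℝ} {M K δA δB : ℝ} (hM : 0 < M) (hK : 0 ≤ K)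
    (hqA : Measurable qA) (hqB : Measurable qB) (hf : Measurable f)
    (hδA : 0 < δA) (hδB : 0 < δB) (hA : ∀ a ∈ Set.Icc (1 : ℝ) 2, δA ≤ qA a)
    (hB : ∀ b ∈ Set.Icc (-(2 * M)) 0, δB ≤ qB b) (hfK : ∀ t, 0 ≤ f t ∧ f t ≤ K)
    (hsupp : (volume.withDensity fun t => ENNReal.ofReal (f t)) (Set.Iio 0) = 0) :
    ∃ g : ℝ × ℝ → ℝ, Measurable g ∧ (∀ p, 0 ≤ g p ∧ g p ≤ K / (δA * δB)) ∧
      (∀ p, g p ≠ 0 → p.1 ∈ Set.Icc (1 : ℝ) 2 ∧ p.2 ∈ Set.Icc (-(2 * M)) 0) ∧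
      ∀ x ∈ Set.Icc 0 M,
        ∫⁻ p, ENNReal.ofReal (g p * relu (p.1 * x + p.2))
          ∂((volume.withDensity fun a => ENNReal.ofReal (qA a)).prod
            (volume.withDensity fun b => ENNReal.ofReal (qB b)))
        = ∫⁻ t, ENNReal.ofReal (max (x - t) 0) ∂(volume.withDensity fun t => ENNReal.ofReal (f t)) := by
  -- the weight is `f(t) / (a² qA(a) qB(b))` at `t = -b/a`: one factor `a` comes from `db = a dt`,
  -- the other from the homogeneity of `ϱ`
  set D : Set (ℝ × ℝ) := {p | p.1 ∈ Set.Icc (1 : ℝ) 2 ∧ -p.2 / p.1 ∈ Set.Icc 0 M} with hD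
  have hDm : MeasurableSet D := by
    refine (measurable_fst measurableSet_Icc).inter ?_
    exact (measurable_snd.neg.div measurable_fst) measurableSet_Icc
  have hDb : ∀ p ∈ D, p.2 ∈ Set.Icc (-(2 * M)) 0 := by
    rintro ⟨a, b⟩ ⟨⟨ha1, ha2⟩, hb1, hb2⟩
    simp only at ha1 ha2 hb1 hb2 ⊢
    have ha : 0 < a := by linarith
    rw [le_div_iff₀ ha] at hb1
    rw [div_le_iff₀ ha] at hb2
    exact ⟨by nlinarith, by linarith⟩
  set g : ℝ × ℝ → ℝ := D.indicator fun p => f (-p.2 / p.1) / (qA p.1 * p.1 ^ 2 * qB p.2) with hg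
  have hgm : Measurable g := by
    refine Measurable.indicator ?_ hDm
    refine (hf.comp (measurable_snd.neg.div measurable_fst)).div ?_
    exact ((hqA.comp measurable_fst).mul (measurable_fst.pow_const 2)).mul (hqB.comp measurable_snd)
  refine ⟨g, hgm, fun p => ?_, fun p hp => ?_, fun x hx => ?_⟩
  · by_cases hp : p ∈ D
    · have h1 := hA _ hp.1
      have h2 := hB _ (hDb p hp)
      have h3 : 1 ≤ p.1 ^ 2 := one_le_pow₀ hp.1.1
      rw [hg, Set.indicator_of_mem hp]
      have h4 : δA * δB ≤ qA p.1 * p.1 ^ 2 * qB p.2 := by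
        refine mul_le_mul ?_ h2 hδB.le (by nlinarith)
        nlinarith
      have h5 : 0 < δA * δB := mul_pos hδA hδB
      exact ⟨div_nonneg (hfK _).1 (h5.le.trans h4), div_le_div₀ hK (hfK _).2 h5 h4⟩
    · rw [hg, Set.indicator_of_notMem hp]
      exact ⟨le_rfl, by positivity⟩
  · have hpD : p ∈ D := by
      by_contra h
      exact hp (by rw [hg, Set.indicator_of_notMem h])
    exact ⟨hpD.1, hDb p hpD⟩
  · have hfeat : Measurable fun p : ℝ × ℝ => ENNReal.ofReal (g p * relu (p.1 * x + p.2)) :=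
      (hgm.mul (measurable_relu.comp
        ((measurable_fst.mul_const x).add measurable_snd))).ennreal_ofReal
    set I : ENNReal := ∫⁻ t, (Set.Icc 0 M).indicator
      (fun t => ENNReal.ofReal (f t) * ENNReal.ofReal (max (x - t) 0)) t with hI
    have hinner : ∀ a, ENNReal.ofReal (qA a) *
        ∫⁻ b, ENNReal.ofReal (g (a, b) * relu (a * x + b))
          ∂(volume.withDensity fun b => ENNReal.ofReal (qB b))
        = (Set.Icc (1 : ℝ) 2).indicator (fun _ => I) a := by
      intro a
      by_cases ha : a ∈ Set.Icc (1 : ℝ) 2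
      · have ha0 : 0 < a := by linarith [ha.1]
        have hqa : 0 < qA a := hδA.trans_le (hA a ha)
        have hma : Measurable fun b => ENNReal.ofReal (g (a, b) * relu (a * x + b)) :=
          hfeat.comp measurable_prodMk_left
        rw [Set.indicator_of_mem ha, lintegral_withDensity_eq_lintegral_mul _
          hqB.ennreal_ofReal hma,
          lintegral_eq_lintegral_comp_neg_mul ha0 (hqB.ennreal_ofReal.mul hma), ← mul_assoc,
          ← ENNReal.ofReal_mul hqa.le, ← lintegral_const_mul' _ _ ENNReal.ofReal_ne_top, hI]
        refine lintegral_congr fun t => ?_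
        simp only [Pi.mul_apply]
        have hdiv : -(-a * t) / a = t := by field_simp
        by_cases ht : t ∈ Set.Icc 0 M
        · have hmem : (a, -a * t) ∈ D := ⟨ha, by simpa only [hdiv] using ht⟩
          have hqb : 0 < qB (-a * t) := hδB.trans_le (hB _ (hDb _ hmem))
          have hrelu : relu (a * x + -a * t) = a * max (x - t) 0 := by
            rw [relu, mul_max_of_nonneg _ _ ha0.le, mul_zero]
            congr 1
            ring
          rw [Set.indicator_of_mem ht, hg, Set.indicator_of_mem hmem, hrelu,
            ← ENNReal.ofReal_mul hqb.le, ← ENNReal.ofReal_mul (by positivity),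
            ← ENNReal.ofReal_mul (hfK _).1]
          simp only [hdiv]
          congr 1
          have hqb' := hqb.ne'
          generalize qB (-a * t) = q at hqb' ⊢
          field_simp
        · have hmem : (a, -a * t) ∉ D := fun h => ht (by simpa only [hdiv] using h.2)
          rw [Set.indicator_of_notMem ht, hg, Set.indicator_of_notMem hmem]
          simp
      · rw [Set.indicator_of_notMem ha]
        have : ∀ b, g (a, b) = 0 := fun b => by
          rw [hg, Set.indicator_of_notMem fun h => ha h.1]
        simp [this]
    rw [lintegral_prod _ hfeat.aemeasurable, lintegral_withDensity_eq_lintegral_mul _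
      hqA.ennreal_ofReal hfeat.lintegral_prod_right']
    simp only [Pi.mul_apply]
    simp_rw [hinner]
    rw [lintegral_indicator measurableSet_Icc, setLIntegral_const, Real.volume_Icc,
      show (2 : ℝ) - 1 = 1 by norm_num, ENNReal.ofReal_one, mul_one]
    -- the mass of `f` on `(-∞,0)` vanishes, and so does the payoff for `t > M`
    have hmax : Measurable fun t => ENNReal.ofReal (max (x - t) 0) := by fun_prop
    rw [lintegral_withDensity_eq_lintegral_mul _ hf.ennreal_ofReal hmax, hI]
    rw [withDensity_apply _ measurableSet_Iio, setLIntegral_eq_zero_iff measurableSet_Iio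
      hf.ennreal_ofReal] at hsupp
    refine lintegral_congr_ae ?_
    filter_upwards [hsupp] with t ht
    by_cases htM : t ∈ Set.Icc 0 M
    · rw [Set.indicator_of_mem htM]
      simp
    · rw [Set.indicator_of_notMem htM]
      simp only [Pi.mul_apply]
      by_cases h0 : t < 0
      · rw [ht h0, zero_mul]
      · have : M < t := by
          by_contra h
          exact htM ⟨not_lt.1 h0, not_lt.1 h⟩
        rw [max_eq_right (by linarith [hx.2])]
        simp

theorem AtMostPolynomialDecay.exists_pos_le_on_Icc {q : ℝ → ℝ} (h : AtMostPolynomialDecay q)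
    (a b : ℝ) : ∃ δ > 0, ∀ z ∈ Set.Icc a b, δ ≤ q z := by
  obtain ⟨p, hp, hpq⟩ := h
  obtain ⟨C, hC⟩ := isCompact_Icc.exists_bound_of_continuousOn
    (s := Set.Icc a b) (f := fun z => p.eval z) p.continuous.continuousOn
  have hC' : 0 < max C 1 := lt_max_of_lt_right one_pos
  refine ⟨(max C 1)⁻¹, inv_pos.2 hC', fun z hz => ?_⟩
  have h1 : p.eval z ≤ max C 1 := ((le_abs_self _).trans (hC z hz)).trans (le_max_left _ _)
  have hq : 0 < q z := by
    by_contra hq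
    nlinarith [hp z, hpq z]
  rw [inv_le_iff_one_le_mul₀ hC', mul_comm]
  exact (hpq z).trans (mul_le_mul_of_nonneg_right h1 hq.le)

/-- The density of `studentT ν`. -/
noncomputable def studentDensity (ν x : ℝ) : ℝ :=
  Real.Gamma ((ν + 1) / 2) / (√(ν * Real.pi) * Real.Gamma (ν / 2))
      * (1 + x ^ 2 / ν) ^ (-((ν + 1) / 2))

theorem studentT_eq (ν : ℝ) :
    studentT ν = volume.withDensity fun x => ENNReal.ofReal (studentDensity ν x) := rfl

theorem continuous_studentDensity {ν : ℝ} (hν : 0 < ν) : Continuous (studentDensity ν) := by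
  unfold studentDensity
  refine continuous_const.mul (Continuous.rpow_const (by fun_prop) fun x => Or.inl ?_)
  positivity

theorem studentDensity_pos {ν : ℝ} (hν : 0 < ν) (x : ℝ) : 0 < studentDensity ν x := by
  unfold studentDensity
  have := Real.Gamma_pos_of_pos (by linarith : 0 < (ν + 1) / 2)
  have := Real.Gamma_pos_of_pos (by linarith : 0 < ν / 2)
  have := Real.pi_pos
  positivity

theorem exists_pos_le_studentDensity_on_Icc {ν : ℝ} (hν : 0 < ν) {a b : ℝ} (hab : a ≤ b) :
    ∃ δ > 0, ∀ z ∈ Set.Icc a b, δ ≤ studentDensity ν z := by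
  obtain ⟨z, -, hz⟩ := isCompact_Icc.exists_isMinOn (Set.nonempty_Icc.2 hab)
    (continuous_studentDensity hν).continuousOn
  exact ⟨_, studentDensity_pos hν z, fun y hy => hz hy⟩

/-- Student's distribution with `ν > 4` degrees of freedom has a finite fourth moment. -/
theorem lintegral_pow_four_studentT_lt_top {ν : ℝ} (hν : 4 < ν) :
    ∫⁻ a, ENNReal.ofReal (a ^ 4) ∂(studentT ν) < ⊤ := by
  have hν0 : 0 < ν := by linarith
  set c : ℝ := Real.Gamma ((ν + 1) / 2) / (√(ν * Real.pi) * Real.Gamma (ν / 2)) with hc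
  have hc0 : 0 ≤ c := by
    have := Real.Gamma_pos_of_pos (by linarith : 0 < (ν + 1) / 2)
    have := Real.Gamma_pos_of_pos (by linarith : 0 < ν / 2)
    positivity
  have hint : Integrable fun x : ℝ =>
      c * ν ^ 2 * (1 + ‖(√ν)⁻¹ * x‖ ^ 2) ^ (-(ν - 3) / 2) := by
    refine Integrable.const_mul ?_ _
    have h1 : Integrable fun x : ℝ => (1 + ‖x‖ ^ 2) ^ (-(ν - 3) / 2) :=
      integrable_rpow_neg_one_add_norm_sq (by simp; linarith)
    exact h1.comp_mul_left' (by positivity)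
  rw [studentT_eq, lintegral_withDensity_eq_lintegral_mul _
    (continuous_studentDensity hν0).measurable.ennreal_ofReal (by fun_prop)]
  refine lt_of_le_of_lt (lintegral_mono fun x => ?_) hint.lintegral_lt_top
  simp only [Pi.mul_apply]
  rw [← ENNReal.ofReal_mul (studentDensity_pos hν0 x).le]
  refine ENNReal.ofReal_le_ofReal ?_
  have hn : ‖(√ν)⁻¹ * x‖ ^ 2 = x ^ 2 / ν := by
    rw [Real.norm_eq_abs, sq_abs, mul_pow, inv_pow, Real.sq_sqrt hν0.le, inv_mul_eq_div]
  have hpos : 0 < 1 + x ^ 2 / ν := by positivity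
  rw [hn, studentDensity, ← hc, mul_assoc, mul_assoc]
  refine mul_le_mul_of_nonneg_left ?_ hc0
  have h4 : x ^ 4 ≤ ν ^ 2 * (1 + x ^ 2 / ν) ^ 2 := by
    have : ν * (1 + x ^ 2 / ν) = ν + x ^ 2 := by field_simp
    rw [← mul_pow, this]
    nlinarith [sq_nonneg x]
  have hexp : (1 + x ^ 2 / ν) ^ (-(ν - 3) / 2)
      = (1 + x ^ 2 / ν) ^ (-((ν + 1) / 2)) * (1 + x ^ 2 / ν) ^ 2 := by
    rw [← Real.rpow_natCast (1 + x ^ 2 / ν) 2, ← Real.rpow_add hpos]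
    congr 1
    push_cast
    ring
  rw [hexp]
  calc (1 + x ^ 2 / ν) ^ (-((ν + 1) / 2)) * x ^ 4
      ≤ (1 + x ^ 2 / ν) ^ (-((ν + 1) / 2)) * (ν ^ 2 * (1 + x ^ 2 / ν) ^ 2) :=
        mul_le_mul_of_nonneg_left h4 (Real.rpow_nonneg hpos.le _)
    _ = _ := by ring

/-! ### Sample means and the Monte Carlo approximation -/

/-- Independent centred summands are orthogonal. -/
theorem lintegral_sq_sum_pi {E ι : Type*} [MeasurableSpace E] [Fintype ι] {μ : Measure E}
    [IsProbabilityMeasure μ] {f : ι → E → ℝ} (hf : ∀ i, MemLp (f i) 2 μ)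
    (h0 : ∀ i, ∫ x, f i x ∂μ = 0) :
    ∫⁻ v, ENNReal.ofReal ((∑ i, f i (v i)) ^ 2) ∂(Measure.pi fun _ : ι => μ)
      = ENNReal.ofReal (∑ i, ∫ x, (f i x) ^ 2 ∂μ) := by
  have hmem : ∀ i, MemLp (fun v : ι → E => f i (v i)) 2 (Measure.pi fun _ : ι => μ) := fun i =>
    (hf i).comp_measurePreserving (measurePreserving_eval (fun _ : ι => μ) i)
  have hsum : MemLp (∑ i, fun v : ι → E => f i (v i)) 2 (Measure.pi fun _ : ι => μ) :=
    memLp_finsetSum' _ fun i _ => hmem i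
  have hmean : ∫ v, (∑ i, fun v : ι → E => f i (v i)) v ∂(Measure.pi fun _ : ι => μ) = 0 := by
    simp only [Finset.sum_apply]
    rw [integral_finsetSum _ fun i _ => (hmem i).integrable (by norm_num)]
    refine Finset.sum_eq_zero fun i _ => ?_
    rw [← h0 i, integral_comp_eval (μ := fun _ : ι => μ) (hf i).aestronglyMeasurable]
  have hvar := variance_sum_pi (μ := fun _ : ι => μ) (X := f) hf
  rw [variance_of_integral_eq_zero hsum.aemeasurable hmean] at hvar
  have h1 : ∑ i, Var[f i; μ] = ∑ i, ∫ x, (f i x) ^ 2 ∂μ :=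
    Finset.sum_congr rfl fun i _ => variance_of_integral_eq_zero (hf i).aemeasurable (h0 i)
  rw [← h1, ← hvar, ofReal_integral_eq_lintegral_ofReal hsum.integrable_sq
    (.of_forall fun _ => sq_nonneg _)]
  simp

/-- The mean square error of a sample mean. -/
theorem lintegral_sq_integral_sub_mean_le {E : Type*} [MeasurableSpace E] {n : ℕ} (hn : 0 < n)
    {μ : Measure E} [IsProbabilityMeasure μ] {f : E → ℝ} (hf : MemLp f 2 μ) :
    ∫⁻ v, ENNReal.ofReal ((∫ x, f x ∂μ - (1 / (n : ℝ)) * ∑ i, f (v i)) ^ 2)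
        ∂(Measure.pi fun _ : Fin n => μ)
      ≤ ENNReal.ofReal ((1 / (n : ℝ)) * ∫ x, (f x) ^ 2 ∂μ) := by
  have hn' : (n : ℝ) ≠ 0 := by positivity
  set m := ∫ x, f x ∂μ with hm
  have hint : Integrable f μ := hf.integrable (by norm_num)
  have hfm : MemLp (fun x => (1 / (n : ℝ)) * (m - f x)) 2 μ :=
    ((memLp_const m).sub hf).const_mul _
  have h0 : ∫ x, (1 / (n : ℝ)) * (m - f x) ∂μ = 0 := by
    rw [integral_const_mul, integral_sub (integrable_const _) hint]
    simp [hm]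
  have h := lintegral_sq_sum_pi (ι := Fin n) (fun _ => hfm) fun _ => h0
  have heq : ∀ v : Fin n → E, m - (1 / (n : ℝ)) * ∑ i, f (v i)
      = ∑ i, (1 / (n : ℝ)) * (m - f (v i)) := by
    intro v
    rw [← Finset.mul_sum, Finset.sum_sub_distrib]
    simp only [Finset.sum_const, Finset.card_univ, Fintype.card_fin, nsmul_eq_mul]
    field_simp
  simp_rw [heq, h]
  refine ENNReal.ofReal_le_ofReal ?_
  have h2 : ∫ x, (m - f x) ^ 2 ∂μ = ∫ x, (f x) ^ 2 ∂μ - m ^ 2 := by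
    have : ∀ x, (m - f x) ^ 2 = (f x ^ 2 - 2 * m * f x) + m ^ 2 := fun x => by ring
    have h3 : Integrable (fun x => f x ^ 2 - 2 * m * f x) μ :=
      hf.integrable_sq.sub (hint.const_mul _)
    simp_rw [this]
    rw [integral_add h3 (integrable_const _),
      integral_sub hf.integrable_sq (hint.const_mul _), integral_const_mul, ← hm]
    simp
    ring
  simp_rw [mul_pow]
  rw [Finset.sum_const, Finset.card_univ, Fintype.card_fin, nsmul_eq_mul, integral_const_mul, h2]
  have : (n : ℝ) * ((1 / (n : ℝ)) ^ 2 * (∫ x, (f x) ^ 2 ∂μ - m ^ 2))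
      = (1 / (n : ℝ)) * (∫ x, (f x) ^ 2 ∂μ - m ^ 2) := by field_simp
  rw [this]
  exact mul_le_mul_of_nonneg_left (by nlinarith [sq_nonneg m]) (by positivity)

/-- The random weights `W_j = g(A_j,B_j)/N`, for which the network is a sample mean of
`g(A,B) ϱ(A x + B)`. -/
noncomputable def approxWeights {N : ℕ} (g : ℝ × ℝ → ℝ) (u : Fin N → ℝ × ℝ) :
    EuclideanSpace ℝ (Fin N) :=
  WithLp.toLp 2 fun j => g (u j) / N

theorem network_approxWeights {N : ℕ} (g : ℝ × ℝ → ℝ) (u : Fin N → ℝ × ℝ) (x : ℝ) :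
    network (fun j => (u j).1) (fun j => (u j).2) (approxWeights g u) x
      = (1 / (N : ℝ)) * ∑ j, g (u j) * relu ((u j).1 * x + (u j).2) := by
  simp only [network, approxWeights, Finset.mul_sum]
  refine Finset.sum_congr rfl fun j _ => ?_
  ring

theorem norm_sq_approxWeights_le {N : ℕ} (hN : 0 < N) {g : ℝ × ℝ → ℝ} {cl : ℝ}
    (hg : ∀ p, 0 ≤ g p ∧ g p ≤ cl) (u : Fin N → ℝ × ℝ) :
    ‖approxWeights g u‖ ^ 2 ≤ cl ^ 2 / N := by
  have hN' : (0 : ℝ) < N := by positivity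
  rw [EuclideanSpace.real_norm_sq_eq]
  calc ∑ j, (approxWeights g u j) ^ 2 ≤ ∑ _j : Fin N, cl ^ 2 / N ^ 2 := by
        refine Finset.sum_le_sum fun j _ => ?_
        simp only [approxWeights, div_pow]
        exact div_le_div_of_nonneg_right (pow_le_pow_left₀ (hg _).1 (hg _).2 2) (by positivity)
    _ = cl ^ 2 / N := by
        rw [Finset.sum_const, Finset.card_univ, Fintype.card_fin, nsmul_eq_mul]
        field_simp

/-- The Monte Carlo rate of the approximation by random features. -/
theorem lintegral_sq_sub_network_approxWeights_le {N : ℕ} (hN : 0 < N)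
    {ρ : Measure (ℝ × ℝ)} [IsProbabilityMeasure ρ] {g : ℝ × ℝ → ℝ} {cl M x y : ℝ}
    (hM : 0 ≤ M) (hgm : Measurable g) (hg : ∀ p, 0 ≤ g p ∧ g p ≤ cl)
    (hsupp : ∀ p, g p ≠ 0 → p.1 ∈ Set.Icc (1 : ℝ) 2 ∧ p.2 ∈ Set.Icc (-(2 * M)) 0)
    (hx : x ∈ Set.Icc 0 M) (hy : 0 ≤ y)
    (hrep : ∫⁻ p, ENNReal.ofReal (g p * relu (p.1 * x + p.2)) ∂ρ = ENNReal.ofReal y) :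
    ∫⁻ u, ENNReal.ofReal ((y -
        network (fun j => (u j).1) (fun j => (u j).2) (approxWeights g u) x) ^ 2)
        ∂(Measure.pi fun _ : Fin N => ρ)
      ≤ ENNReal.ofReal ((2 * M * cl) ^ 2 / N) := by
  have hZm : Measurable fun p : ℝ × ℝ => g p * relu (p.1 * x + p.2) :=
    hgm.mul (measurable_relu.comp ((measurable_fst.mul_const x).add measurable_snd))
  have hcl : 0 ≤ cl := (hg 0).1.trans (hg 0).2
  have hZ : ∀ p : ℝ × ℝ, 0 ≤ g p * relu (p.1 * x + p.2) ∧
      g p * relu (p.1 * x + p.2) ≤ 2 * M * cl := by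
    intro p
    refine ⟨mul_nonneg (hg p).1 (relu_nonneg _), ?_⟩
    by_cases hp : g p = 0
    · rw [hp]; simp; positivity
    · obtain ⟨h1, h2⟩ := hsupp p hp
      have : relu (p.1 * x + p.2) ≤ 2 * M := by
        refine max_le ?_ (by linarith)
        nlinarith [h1.1, h1.2, h2.2, hx.1, hx.2]
      rw [mul_comm]
      exact mul_le_mul this (hg p).2 (hg p).1 (by linarith)
  have hmem : MemLp (fun p : ℝ × ℝ => g p * relu (p.1 * x + p.2)) 2 ρ :=
    MemLp.of_bound hZm.aestronglyMeasurable (2 * M * cl) (.of_forall fun p => by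
      rw [Real.norm_of_nonneg (hZ p).1]; exact (hZ p).2)
  have hmean : ∫ p, g p * relu (p.1 * x + p.2) ∂ρ = y := by
    rw [integral_eq_lintegral_of_nonneg_ae (.of_forall fun p => (hZ p).1)
      hZm.aestronglyMeasurable, hrep, ENNReal.toReal_ofReal hy]
  have h := lintegral_sq_integral_sub_mean_le hN hmem
  simp_rw [hmean, ← network_approxWeights] at h
  refine h.trans (ENNReal.ofReal_le_ofReal ?_)
  rw [one_div, inv_mul_eq_div]
  refine div_le_div_of_nonneg_right ?_ (by positivity)
  calc ∫ p, (g p * relu (p.1 * x + p.2)) ^ 2 ∂ρ ≤ ∫ _p, (2 * M * cl) ^ 2 ∂ρ :=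
        integral_mono hmem.integrable_sq (integrable_const _) fun p =>
          pow_le_pow_left₀ (hZ p).1 (hZ p).2 2
    _ = _ := by simp

/-- The mean square distance, in Frobenius norm, of the empirical second moment matrix of a feature
vector to its expectation. -/
theorem lintegral_sq_secondMoment_le {E ι : Type*} [MeasurableSpace E] [Fintype ι] {n : ℕ}
    (hn : 0 < n) {μ : Measure E} [IsProbabilityMeasure μ] {φ : E → ι → ℝ} {τ : ℝ}
    (hφ : ∀ j, Measurable fun x => φ x j) (hτ : ∀ᵐ x ∂μ, ∑ j, φ x j ^ 2 ≤ τ) :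
    ∫⁻ v, ENNReal.ofReal (∑ j, ∑ k, (∫ x, φ x j * φ x k ∂μ
        - (1 / (n : ℝ)) * ∑ i, φ (v i) j * φ (v i) k) ^ 2) ∂(Measure.pi fun _ : Fin n => μ)
      ≤ ENNReal.ofReal (τ ^ 2 / n) := by
  have hb : ∀ j, ∀ᵐ x ∂μ, φ x j ^ 2 ≤ τ := fun j => by
    filter_upwards [hτ] with x hx
    exact (Finset.single_le_sum (f := fun j => φ x j ^ 2) (fun j _ => sq_nonneg _)
      (Finset.mem_univ j)).trans hx
  have hmem : ∀ j k, MemLp (fun x => φ x j * φ x k) 2 μ := fun j k => by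
    refine MemLp.of_bound ((hφ j).mul (hφ k)).aestronglyMeasurable τ ?_
    filter_upwards [hb j, hb k] with x h1 h2
    rw [Real.norm_eq_abs, abs_le]
    constructor <;> nlinarith [sq_nonneg (φ x j + φ x k), sq_nonneg (φ x j - φ x k)]
  have hmeas : ∀ j k, Measurable fun v : Fin n → E => ENNReal.ofReal ((∫ x, φ x j * φ x k ∂μ
      - (1 / (n : ℝ)) * ∑ i, φ (v i) j * φ (v i) k) ^ 2) := fun j k => by
    have h1 : ∀ i : Fin n, Measurable fun v : Fin n → E => φ (v i) j * φ (v i) k := fun i =>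
      ((hφ j).comp (measurable_pi_apply i)).mul ((hφ k).comp (measurable_pi_apply i))
    exact ((measurable_const.sub ((Finset.measurable_fun_sum _ fun i _ => h1 i).const_mul _)).pow_const
      2).ennreal_ofReal
  have h1 : ∀ v : Fin n → E, ENNReal.ofReal (∑ j, ∑ k, (∫ x, φ x j * φ x k ∂μ
        - (1 / (n : ℝ)) * ∑ i, φ (v i) j * φ (v i) k) ^ 2)
      = ∑ j, ∑ k, ENNReal.ofReal ((∫ x, φ x j * φ x k ∂μ
        - (1 / (n : ℝ)) * ∑ i, φ (v i) j * φ (v i) k) ^ 2) := fun v => by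
    rw [ENNReal.ofReal_sum_of_nonneg fun j _ => Finset.sum_nonneg fun k _ => sq_nonneg _]
    refine Finset.sum_congr rfl fun j _ => ?_
    rw [ENNReal.ofReal_sum_of_nonneg fun k _ => sq_nonneg _]
  simp_rw [h1]
  rw [lintegral_finsetSum _ fun j _ => Finset.measurable_fun_sum _ fun k _ => hmeas j k]
  simp_rw [lintegral_finsetSum _ fun k _ => hmeas _ k]
  calc ∑ j, ∑ k, ∫⁻ v, ENNReal.ofReal ((∫ x, φ x j * φ x k ∂μ
        - (1 / (n : ℝ)) * ∑ i, φ (v i) j * φ (v i) k) ^ 2) ∂(Measure.pi fun _ : Fin n => μ)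
      ≤ ∑ j, ∑ k, ENNReal.ofReal ((1 / (n : ℝ)) * ∫ x, (φ x j * φ x k) ^ 2 ∂μ) :=
        Finset.sum_le_sum fun j _ => Finset.sum_le_sum fun k _ =>
          lintegral_sq_integral_sub_mean_le hn (hmem j k)
    _ = ENNReal.ofReal (∑ j, ∑ k, (1 / (n : ℝ)) * ∫ x, (φ x j * φ x k) ^ 2 ∂μ) := by
        have hnn : ∀ j k, 0 ≤ (1 / (n : ℝ)) * ∫ x, (φ x j * φ x k) ^ 2 ∂μ := fun j k =>
          mul_nonneg (by positivity) (integral_nonneg fun x => sq_nonneg _)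
        rw [ENNReal.ofReal_sum_of_nonneg fun j _ => Finset.sum_nonneg fun k _ => hnn j k]
        refine Finset.sum_congr rfl fun j _ => ?_
        rw [ENNReal.ofReal_sum_of_nonneg fun k _ => hnn j k]
    _ ≤ _ := by
        refine ENNReal.ofReal_le_ofReal ?_
        have h2 : ∑ j, ∑ k, (1 / (n : ℝ)) * ∫ x, (φ x j * φ x k) ^ 2 ∂μ
            = (1 / (n : ℝ)) * ∫ x, (∑ j, φ x j ^ 2) ^ 2 ∂μ := by
          simp_rw [← Finset.mul_sum]
          congr 1
          simp_rw [← integral_finsetSum _ fun k _ => (hmem _ k).integrable_sq]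
          rw [← integral_finsetSum _ fun j _ =>
            integrable_finsetSum _ fun k _ => (hmem j k).integrable_sq]
          refine integral_congr_ae (.of_forall fun x => ?_)
          simp only [sq (∑ j, φ x j ^ 2), Finset.sum_mul_sum, mul_pow]
        rw [h2, one_div, inv_mul_eq_div]
        refine div_le_div_of_nonneg_right ?_ (by positivity)
        calc ∫ x, (∑ j, φ x j ^ 2) ^ 2 ∂μ ≤ ∫ _x, τ ^ 2 ∂μ := by
              refine integral_mono_of_nonneg (.of_forall fun x => sq_nonneg _) (integrable_const _) ?_
              filter_upwards [hτ] with x hx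
              exact pow_le_pow_left₀ (Finset.sum_nonneg fun j _ => sq_nonneg _) hx 2
          _ = τ ^ 2 := by simp

/-- The mean square norm of the empirical correlation of centred noise with a feature vector. -/
theorem lintegral_sq_noise_correlation_le {ι : Type*} [Fintype ι] {n : ℕ} (hn : 0 < n)
    {μ με : Measure ℝ} [IsProbabilityMeasure μ] [IsProbabilityMeasure με] {φ : ℝ → ι → ℝ} {τ : ℝ}
    (hφ : ∀ j, Measurable fun x => φ x j) (hτ : ∀ᵐ x ∂μ, ∑ j, φ x j ^ 2 ≤ τ)
    (hε : MemLp (fun e : ℝ => e) 2 με) (hε0 : ∫ e, e ∂με = 0) :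
    ∫⁻ v, ENNReal.ofReal (∑ j, ((1 / (n : ℝ)) * ∑ i, (v i).2 * φ (v i).1 j) ^ 2)
        ∂(Measure.pi fun _ : Fin n => μ.prod με)
      ≤ ENNReal.ofReal ((∫ e, e ^ 2 ∂με) * τ / n) := by
  have hb : ∀ j, ∀ᵐ x ∂μ, φ x j ^ 2 ≤ τ := fun j => by
    filter_upwards [hτ] with x hx
    exact (Finset.single_le_sum (f := fun j => φ x j ^ 2) (fun j _ => sq_nonneg _)
      (Finset.mem_univ j)).trans hx
  have hφ2 : ∀ j, MemLp (fun x => φ x j) 2 μ := fun j => by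
    refine MemLp.of_bound (hφ j).aestronglyMeasurable (√τ) ?_
    filter_upwards [hb j] with x h1
    exact Real.abs_le_sqrt h1
  have hm : ∀ j, Measurable fun p : ℝ × ℝ => p.2 * φ p.1 j := fun j =>
    measurable_snd.mul ((hφ j).comp measurable_fst)
  have hsq : ∀ j, ∫ p : ℝ × ℝ, (p.2 * φ p.1 j) ^ 2 ∂(μ.prod με)
      = (∫ x, φ x j ^ 2 ∂μ) * ∫ e, e ^ 2 ∂με := fun j => by
    rw [← integral_prod_mul]
    refine integral_congr_ae (.of_forall fun p => ?_)
    simp only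
    ring
  have hmem : ∀ j, MemLp (fun p : ℝ × ℝ => p.2 * φ p.1 j) 2 (μ.prod με) := fun j => by
    rw [memLp_two_iff_integrable_sq (hm j).aestronglyMeasurable]
    have := (hφ2 j).integrable_sq.mul_prod hε.integrable_sq
    refine this.congr (.of_forall fun p => ?_)
    simp only
    ring
  have h0 : ∀ j, ∫ p : ℝ × ℝ, p.2 * φ p.1 j ∂(μ.prod με) = 0 := fun j => by
    have : ∀ p : ℝ × ℝ, p.2 * φ p.1 j = φ p.1 j * p.2 := fun p => mul_comm _ _
    simp_rw [this]
    rw [integral_prod_mul (fun x => φ x j) (fun e => e), hε0, mul_zero]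
  have hmeas : ∀ j, Measurable fun v : Fin n → ℝ × ℝ =>
      ENNReal.ofReal (((1 / (n : ℝ)) * ∑ i, (v i).2 * φ (v i).1 j) ^ 2) := fun j => by
    have h1 : ∀ i : Fin n, Measurable fun v : Fin n → ℝ × ℝ => (v i).2 * φ (v i).1 j := fun i =>
      (hm j).comp (measurable_pi_apply i)
    exact (((Finset.measurable_fun_sum _ fun i _ => h1 i).const_mul _).pow_const 2).ennreal_ofReal
  simp_rw [ENNReal.ofReal_sum_of_nonneg fun j (_ : j ∈ Finset.univ) => sq_nonneg _]
  rw [lintegral_finsetSum _ fun j _ => hmeas j]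
  calc ∑ j, ∫⁻ v, ENNReal.ofReal (((1 / (n : ℝ)) * ∑ i, (v i).2 * φ (v i).1 j) ^ 2)
        ∂(Measure.pi fun _ : Fin n => μ.prod με)
      ≤ ∑ j, ENNReal.ofReal ((1 / (n : ℝ)) * ((∫ x, φ x j ^ 2 ∂μ) * ∫ e, e ^ 2 ∂με)) := by
        refine Finset.sum_le_sum fun j _ => ?_
        have h := lintegral_sq_integral_sub_mean_le hn (hmem j)
        simp_rw [h0, hsq, zero_sub, neg_sq] at h
        exact h
    _ = ENNReal.ofReal (∑ j, (1 / (n : ℝ)) * ((∫ x, φ x j ^ 2 ∂μ) * ∫ e, e ^ 2 ∂με)) := by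
        rw [ENNReal.ofReal_sum_of_nonneg fun j _ => ?_]
        exact mul_nonneg (by positivity) (mul_nonneg (integral_nonneg fun x => sq_nonneg _)
          (integral_nonneg fun x => sq_nonneg _))
    _ ≤ _ := by
        refine ENNReal.ofReal_le_ofReal ?_
        rw [← Finset.mul_sum, ← Finset.sum_mul,
          ← integral_finsetSum _ fun j _ => (hφ2 j).integrable_sq, one_div, inv_mul_eq_div]
        refine div_le_div_of_nonneg_right ?_ (by positivity)
        rw [mul_comm]
        refine mul_le_mul_of_nonneg_left ?_ (integral_nonneg fun x => sq_nonneg _)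
        calc ∫ x, ∑ j, φ x j ^ 2 ∂μ ≤ ∫ _x, τ ∂μ :=
              integral_mono_of_nonneg (.of_forall fun x => Finset.sum_nonneg fun j _ => sq_nonneg _)
                (integrable_const _) hτ
          _ = τ := by simp

/-! ### An oracle inequality for linear combinations of features -/

/-- A deterministic oracle inequality for quadratic risks. The population risk of the linear
combination `∑ θ_j φ_j` exceeds its noisy empirical risk by at most a quadratic form in `θ`, whose
matrix is the error of the empirical second moments, and a linear form in `θ - θ'`, whose
coefficients are the empirical correlations of the noise with the features. -/
theorem integral_sq_le_empirical_add {E ι : Type*} [MeasurableSpace E] [Fintype ι] {n : ℕ}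
    (hn : 0 < n) {μ : Measure E} {φ : E → ι → ℝ}
    (hint : ∀ j k, Integrable (fun x => φ x j * φ x k) μ) (x : Fin n → E) (e : Fin n → ℝ)
    {θ θ' : ι → ℝ} {τ : ℝ} (hτ1 : 1 ≤ τ) (hθ : ∑ j, θ j ^ 2 ≤ τ) (hθ' : ∑ j, θ' j ^ 2 ≤ τ) :
    ∫ z, (∑ j, θ j * φ z j) ^ 2 ∂μ ≤
      (1 / (n : ℝ)) * ∑ i, (∑ j, θ j * φ (x i) j - e i) ^ 2
      - (1 / (n : ℝ)) * ∑ i, (∑ j, θ' j * φ (x i) j - e i) ^ 2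
      + ((1 / (n : ℝ)) * ∑ i, (∑ j, θ' j * φ (x i) j) ^ 2 + 5 * τ ^ 2 / √n
        + √n * (∑ j, ((1 / (n : ℝ)) * ∑ i, e i * φ (x i) j) ^ 2
          + 1 / 2 * ∑ j, ∑ k, (∫ z, φ z j * φ z k ∂μ
            - (1 / (n : ℝ)) * ∑ i, φ (x i) j * φ (x i) k) ^ 2)) := by
  have hn' : (0 : ℝ) < √n := Real.sqrt_pos.2 (by positivity)
  -- the weight `√n` balances the bounded coefficients against the deviations, which are squares of
  -- order `1/n`
  have hamgm : ∀ p q : ℝ, p * q ≤ 1 / 2 * (p ^ 2 / √n + √n * q ^ 2) := by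
    intro p q
    have h1 : 0 ≤ (p - √n * q) ^ 2 / √n := by positivity
    have h2 : (p - √n * q) ^ 2 / √n = p ^ 2 / √n - 2 * (p * q) + √n * q ^ 2 := by
      field_simp
      ring
    linarith
  set D : ι → ι → ℝ := fun j k => ∫ z, φ z j * φ z k ∂μ
    - (1 / (n : ℝ)) * ∑ i, φ (x i) j * φ (x i) k with hD
  set c : ι → ℝ := fun j => (1 / (n : ℝ)) * ∑ i, e i * φ (x i) j with hc
  have hsq : ∀ z : E, (∑ j, θ j * φ z j) ^ 2 = ∑ j, ∑ k, θ j * θ k * (φ z j * φ z k) := by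
    intro z
    rw [sq, Finset.sum_mul_sum]
    exact Finset.sum_congr rfl fun j _ => Finset.sum_congr rfl fun k _ => by ring
  have hpop : ∫ z, (∑ j, θ j * φ z j) ^ 2 ∂μ
      = ∑ j, ∑ k, θ j * θ k * ∫ z, φ z j * φ z k ∂μ := by
    simp_rw [hsq]
    rw [integral_finsetSum _ fun j _ => integrable_finsetSum _ fun k _ => (hint j k).const_mul _]
    refine Finset.sum_congr rfl fun j _ => ?_
    rw [integral_finsetSum _ fun k _ => (hint j k).const_mul _]
    exact Finset.sum_congr rfl fun k _ => integral_const_mul _ _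
  have hemp : (1 / (n : ℝ)) * ∑ i, (∑ j, θ j * φ (x i) j) ^ 2
      = ∑ j, ∑ k, θ j * θ k * ((1 / (n : ℝ)) * ∑ i, φ (x i) j * φ (x i) k) := by
    simp_rw [hsq]
    rw [Finset.sum_comm, Finset.mul_sum]
    refine Finset.sum_congr rfl fun j _ => ?_
    rw [Finset.sum_comm, Finset.mul_sum]
    refine Finset.sum_congr rfl fun k _ => ?_
    rw [← Finset.mul_sum]
    ring
  have hquad : ∑ j, ∑ k, θ j * θ k * D j k
      ≤ 1 / 2 * (τ ^ 2 / √n) + 1 / 2 * (√n * ∑ j, ∑ k, D j k ^ 2) := by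
    calc ∑ j, ∑ k, θ j * θ k * D j k
        ≤ ∑ j, ∑ k, 1 / 2 * ((θ j * θ k) ^ 2 / √n + √n * D j k ^ 2) :=
          Finset.sum_le_sum fun j _ => Finset.sum_le_sum fun k _ => hamgm _ _
      _ = 1 / 2 * ((∑ j, θ j ^ 2) ^ 2 / √n) + 1 / 2 * (√n * ∑ j, ∑ k, D j k ^ 2) := by
          rw [sq (∑ j, θ j ^ 2), Finset.sum_mul_sum]
          simp_rw [mul_add, Finset.sum_add_distrib, Finset.mul_sum, Finset.sum_div, Finset.mul_sum,
            mul_pow]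
      _ ≤ _ := by
          have : (∑ j, θ j ^ 2) ^ 2 ≤ τ ^ 2 :=
            pow_le_pow_left₀ (Finset.sum_nonneg fun j _ => sq_nonneg _) hθ 2
          gcongr
  have hnoise : 2 * ∑ j, (θ j - θ' j) * c j ≤ 4 * τ / √n + √n * ∑ j, c j ^ 2 := by
    have h1 : ∑ j, (θ j - θ' j) ^ 2 ≤ 4 * τ := by
      calc ∑ j, (θ j - θ' j) ^ 2 ≤ ∑ j, (2 * θ j ^ 2 + 2 * θ' j ^ 2) :=
            Finset.sum_le_sum fun j _ => by nlinarith [sq_nonneg (θ j + θ' j)]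
        _ = 2 * ∑ j, θ j ^ 2 + 2 * ∑ j, θ' j ^ 2 := by
            rw [Finset.sum_add_distrib, Finset.mul_sum, Finset.mul_sum]
        _ ≤ _ := by linarith
    calc 2 * ∑ j, (θ j - θ' j) * c j
        ≤ 2 * ∑ j, 1 / 2 * ((θ j - θ' j) ^ 2 / √n + √n * c j ^ 2) := by
          refine mul_le_mul_of_nonneg_left (Finset.sum_le_sum fun j _ => hamgm _ _) (by norm_num)
      _ = (∑ j, (θ j - θ' j) ^ 2) / √n + √n * ∑ j, c j ^ 2 := by
          rw [← Finset.mul_sum, Finset.sum_add_distrib, Finset.sum_div, Finset.mul_sum]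
          ring
      _ ≤ _ := by gcongr
  have hcross : ∀ t : ι → ℝ, (1 / (n : ℝ)) * ∑ i, (∑ j, t j * φ (x i) j - e i) ^ 2
      = (1 / (n : ℝ)) * ∑ i, (∑ j, t j * φ (x i) j) ^ 2 - 2 * ∑ j, t j * c j
        + (1 / (n : ℝ)) * ∑ i, e i ^ 2 := by
    intro t
    have h1 : ∑ j, t j * c j = (1 / (n : ℝ)) * ∑ i, e i * ∑ j, t j * φ (x i) j := by
      simp only [hc, Finset.mul_sum]
      rw [Finset.sum_comm]
      exact Finset.sum_congr rfl fun i _ => Finset.sum_congr rfl fun j _ => by ring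
    rw [h1]
    simp only [Finset.mul_sum, ← Finset.sum_add_distrib, ← Finset.sum_sub_distrib]
    refine Finset.sum_congr rfl fun i _ => ?_
    simp only [← Finset.mul_sum]
    ring
  have hpe : ∑ j, ∑ k, θ j * θ k * D j k = ∫ z, (∑ j, θ j * φ z j) ^ 2 ∂μ
      - (1 / (n : ℝ)) * ∑ i, (∑ j, θ j * φ (x i) j) ^ 2 := by
    rw [hpop, hemp, ← Finset.sum_sub_distrib]
    refine Finset.sum_congr rfl fun j _ => ?_
    rw [← Finset.sum_sub_distrib]
    exact Finset.sum_congr rfl fun k _ => by rw [hD]; ring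
  have hlin : 2 * ∑ j, (θ j - θ' j) * c j = 2 * ∑ j, θ j * c j - 2 * ∑ j, θ' j * c j := by
    simp only [sub_mul, Finset.sum_sub_distrib]
    ring
  have hτ2 : 4 * τ / √n + 1 / 2 * (τ ^ 2 / √n) ≤ 5 * τ ^ 2 / √n := by
    rw [← mul_div_assoc, ← add_div]
    refine div_le_div_of_nonneg_right ?_ hn'.le
    nlinarith
  rw [hcross θ, hcross θ']
  rw [hpe] at hquad
  rw [hlin] at hnoise
  linarith

section Features

variable {N : ℕ}

/-- The functions `1`, `h` and `(ϱ(a_j x + b_j) - ϱ(b_j))/√N`, whose span contains the error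
`H^{a,b}_W - h` of every network. On `[0,M]` they are bounded independently of `b`. -/
noncomputable def errorFeature (h : ℝ → ℝ) (u : Fin N → ℝ × ℝ) (x : ℝ) :
    Option (Option (Fin N)) → ℝ
  | none => 1
  | some none => h x
  | some (some j) => (relu ((u j).1 * x + (u j).2) - relu (u j).2) / √N

/-- The coefficients of `H^{a,b}_W - h` with respect to `errorFeature`. -/
noncomputable def errorCoef (u : Fin N → ℝ × ℝ) (W : EuclideanSpace ℝ (Fin N)) :
    Option (Option (Fin N)) → ℝ
  | none => network (fun j => (u j).1) (fun j => (u j).2) W 0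
  | some none => -1
  | some (some j) => √N * W j

theorem sum_errorCoef_mul_errorFeature (hN : 0 < N) (h : ℝ → ℝ) (u : Fin N → ℝ × ℝ)
    (W : EuclideanSpace ℝ (Fin N)) (x : ℝ) :
    ∑ j, errorCoef u W j * errorFeature h u x j
      = network (fun j => (u j).1) (fun j => (u j).2) W x - h x := by
  have hN' : √(N : ℝ) ≠ 0 := (Real.sqrt_pos.2 (by positivity)).ne'
  rw [Fintype.sum_option, Fintype.sum_option]
  simp only [errorCoef, errorFeature, network, mul_one, neg_mul, one_mul, mul_zero, zero_add]
  have : ∀ j, √(N : ℝ) * W j * ((relu ((u j).1 * x + (u j).2) - relu (u j).2) / √N)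
      = W j * relu ((u j).1 * x + (u j).2) - W j * relu (u j).2 := fun j => by
    field_simp
  simp_rw [this, Finset.sum_sub_distrib]
  ring

theorem sum_errorCoef_sq (u : Fin N → ℝ × ℝ) (W : EuclideanSpace ℝ (Fin N)) :
    ∑ j, errorCoef u W j ^ 2
      = network (fun j => (u j).1) (fun j => (u j).2) W 0 ^ 2 + 1 + N * ‖W‖ ^ 2 := by
  rw [Fintype.sum_option, Fintype.sum_option, EuclideanSpace.real_norm_sq_eq]
  simp only [errorCoef, mul_pow, Real.sq_sqrt (Nat.cast_nonneg N), ← Finset.mul_sum]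
  ring

/-- The average of the squares of the slopes `a_j`. -/
noncomputable def meanSqSlope (u : Fin N → ℝ × ℝ) : ℝ := (1 / (N : ℝ)) * ∑ j, (u j).1 ^ 2

/-- The average of the squares of the intercepts `b_j`. -/
noncomputable def meanSqIntercept (u : Fin N → ℝ × ℝ) : ℝ := (1 / (N : ℝ)) * ∑ j, (u j).2 ^ 2

theorem meanSqSlope_nonneg (u : Fin N → ℝ × ℝ) : 0 ≤ meanSqSlope u :=
  mul_nonneg (by positivity) (Finset.sum_nonneg fun _ _ => sq_nonneg _)

theorem meanSqIntercept_nonneg (u : Fin N → ℝ × ℝ) : 0 ≤ meanSqIntercept u :=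
  mul_nonneg (by positivity) (Finset.sum_nonneg fun _ _ => sq_nonneg _)

theorem sum_slope_sq (hN : 0 < N) (u : Fin N → ℝ × ℝ) :
    ∑ j, (u j).1 ^ 2 = N * meanSqSlope u := by
  have : (N : ℝ) ≠ 0 := by positivity
  rw [meanSqSlope]
  field_simp

theorem sum_intercept_sq (hN : 0 < N) (u : Fin N → ℝ × ℝ) :
    ∑ j, (u j).2 ^ 2 = N * meanSqIntercept u := by
  have : (N : ℝ) ≠ 0 := by positivity
  rw [meanSqIntercept]
  field_simp

theorem abs_relu_sub_relu_le (y z : ℝ) : |relu y - relu z| ≤ |y - z| :=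
  abs_max_sub_max_le_abs y z 0

theorem relu_sub_sq_le {M x : ℝ} (hx : x ∈ Set.Icc 0 M) (a b : ℝ) :
    (relu (a * x + b) - relu b) ^ 2 ≤ M ^ 2 * a ^ 2 := by
  have h1 := abs_relu_sub_relu_le (a * x + b) b
  rw [add_sub_cancel_right] at h1
  calc (relu (a * x + b) - relu b) ^ 2 ≤ (a * x) ^ 2 := sq_le_sq.2 h1
    _ = x ^ 2 * a ^ 2 := by ring
    _ ≤ M ^ 2 * a ^ 2 :=
        mul_le_mul_of_nonneg_right (pow_le_pow_left₀ hx.1 hx.2 2) (sq_nonneg _)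

theorem sum_errorFeature_sq_le (hN : 0 < N) {h : ℝ → ℝ} {M x : ℝ} (hx : x ∈ Set.Icc 0 M)
    (hh : 0 ≤ h x ∧ h x ≤ M) (u : Fin N → ℝ × ℝ) :
    ∑ j, errorFeature h u x j ^ 2 ≤ 1 + M ^ 2 + M ^ 2 * meanSqSlope u := by
  have hN' : (0 : ℝ) < N := by positivity
  rw [Fintype.sum_option, Fintype.sum_option]
  simp only [errorFeature, div_pow, Real.sq_sqrt hN'.le]
  have h1 : ∑ j, (relu ((u j).1 * x + (u j).2) - relu (u j).2) ^ 2 / (N : ℝ)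
      ≤ M ^ 2 * meanSqSlope u := by
    rw [meanSqSlope, ← mul_assoc, mul_comm (M ^ 2), mul_assoc, Finset.mul_sum, Finset.mul_sum]
    refine Finset.sum_le_sum fun j _ => ?_
    rw [one_div, inv_mul_eq_div]
    exact div_le_div_of_nonneg_right (relu_sub_sq_le hx _ _) hN'.le
  have h2 : h x ^ 2 ≤ M ^ 2 := pow_le_pow_left₀ hh.1 hh.2 2
  linarith

theorem measurable_errorFeature {h : ℝ → ℝ} (hh : Measurable h) (j : Option (Option (Fin N))) :
    Measurable fun p : (Fin N → ℝ × ℝ) × ℝ => errorFeature h p.1 p.2 j := by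
  match j with
  | none => exact measurable_const
  | some none => exact hh.comp measurable_snd
  | some (some j) =>
    have h1 : Measurable fun p : (Fin N → ℝ × ℝ) × ℝ => p.1 j :=
      (measurable_pi_apply j).comp measurable_fst
    exact ((measurable_relu.comp ((h1.fst.mul measurable_snd).add h1.snd)).sub
      (measurable_relu.comp h1.snd)).div_const _

/-- The value at `0` of the network is controlled by the weights and the intercepts. -/
theorem network_zero_sq_le (hN : 0 < N) (u : Fin N → ℝ × ℝ) (W : EuclideanSpace ℝ (Fin N)) :
    network (fun j => (u j).1) (fun j => (u j).2) W 0 ^ 2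
      ≤ N * ‖W‖ ^ 2 * meanSqIntercept u := by
  have h1 : network (fun j => (u j).1) (fun j => (u j).2) W 0 = ∑ j, W j * relu (u j).2 := by
    simp [network]
  rw [h1]
  refine (Finset.sum_mul_sq_le_sq_mul_sq _ _ _).trans ?_
  rw [EuclideanSpace.real_norm_sq_eq, mul_comm (N : ℝ), mul_assoc, ← sum_intercept_sq hN]
  refine mul_le_mul_of_nonneg_left (Finset.sum_le_sum fun j _ => ?_)
    (Finset.sum_nonneg fun _ _ => sq_nonneg _)
  have : |relu (u j).2| ≤ |(u j).2| := by
    simpa [relu] using abs_relu_sub_relu_le (u j).2 0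
  exact sq_le_sq.2 this

theorem network_sub_network_zero_sq_le (hN : 0 < N) {M x : ℝ} (hx : x ∈ Set.Icc 0 M)
    (u : Fin N → ℝ × ℝ) (W : EuclideanSpace ℝ (Fin N)) :
    (network (fun j => (u j).1) (fun j => (u j).2) W x
      - network (fun j => (u j).1) (fun j => (u j).2) W 0) ^ 2
      ≤ N * ‖W‖ ^ 2 * (M ^ 2 * meanSqSlope u) := by
  have h1 : network (fun j => (u j).1) (fun j => (u j).2) W x
      - network (fun j => (u j).1) (fun j => (u j).2) W 0
      = ∑ j, W j * (relu ((u j).1 * x + (u j).2) - relu (u j).2) := by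
    simp only [network, mul_zero, zero_add, ← Finset.sum_sub_distrib, mul_sub]
  rw [h1]
  refine (Finset.sum_mul_sq_le_sq_mul_sq _ _ _).trans ?_
  have h2 : (N : ℝ) * ‖W‖ ^ 2 * (M ^ 2 * meanSqSlope u)
      = (∑ j, W j ^ 2) * ∑ j, M ^ 2 * (u j).1 ^ 2 := by
    rw [EuclideanSpace.real_norm_sq_eq, ← Finset.mul_sum, sum_slope_sq hN]
    ring
  rw [h2]
  exact mul_le_mul_of_nonneg_left (Finset.sum_le_sum fun j _ => relu_sub_sq_le hx _ _)
    (Finset.sum_nonneg fun _ _ => sq_nonneg _)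

/-- The weights of the Monte Carlo approximation vanish where the features do not vanish at `0`. -/
theorem network_approxWeights_zero {g : ℝ × ℝ → ℝ} (hg : ∀ p, g p ≠ 0 → p.2 ≤ 0)
    (u : Fin N → ℝ × ℝ) :
    network (fun j => (u j).1) (fun j => (u j).2) (approxWeights g u) 0 = 0 := by
  rw [network_approxWeights]
  refine mul_eq_zero_of_right _ (Finset.sum_eq_zero fun j _ => ?_)
  by_cases h : g (u j) = 0
  · rw [h, zero_mul]
  · rw [mul_zero, zero_add, relu, max_eq_right (hg _ h), mul_zero]

end Features

/-! ### Generalization error of networks with bounded weights -/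

theorem lintegral_mean_eq {E : Type*} [MeasurableSpace E] {N : ℕ} (hN : 0 < N) {ρ : Measure E}
    [IsProbabilityMeasure ρ] {q : E → ℝ} (hq : Measurable q) (hq0 : ∀ p, 0 ≤ q p) :
    ∫⁻ u, ENNReal.ofReal ((1 / (N : ℝ)) * ∑ j, q (u j)) ∂(Measure.pi fun _ : Fin N => ρ)
      = ∫⁻ p, ENNReal.ofReal (q p) ∂ρ := by
  have hN' : (0 : ℝ) < N := by positivity
  simp_rw [ENNReal.ofReal_mul (by positivity : (0 : ℝ) ≤ 1 / N),
    ENNReal.ofReal_sum_of_nonneg fun j (_ : j ∈ Finset.univ) => hq0 _]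
  have hqj : ∀ j, Measurable fun u : Fin N → E => ENNReal.ofReal (q (u j)) := fun j =>
    (hq.comp (measurable_pi_apply j)).ennreal_ofReal
  rw [lintegral_const_mul' _ _ ENNReal.ofReal_ne_top, lintegral_finsetSum _ fun j _ => hqj j]
  have h1 : ∀ j : Fin N, ∫⁻ u, ENNReal.ofReal (q (u j)) ∂(Measure.pi fun _ : Fin N => ρ)
      = ∫⁻ p, ENNReal.ofReal (q p) ∂ρ := fun j =>
    (measurePreserving_eval (fun _ : Fin N => ρ) j).lintegral_comp hq.ennreal_ofReal
  simp_rw [h1]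
  rw [Finset.sum_const, Finset.card_univ, Fintype.card_fin, nsmul_eq_mul, ← mul_assoc,
    ← ENNReal.ofReal_natCast, ← ENNReal.ofReal_mul (by positivity), one_div,
    inv_mul_cancel₀ hN'.ne', ENNReal.ofReal_one, one_mul]

theorem sq_mean_le_mean_sq {N : ℕ} (hN : 0 < N) (z : Fin N → ℝ) :
    ((1 / (N : ℝ)) * ∑ j, z j) ^ 2 ≤ (1 / (N : ℝ)) * ∑ j, z j ^ 2 := by
  have hN' : (0 : ℝ) < N := by positivity
  have h := sq_sum_le_card_mul_sum_sq (s := Finset.univ) (f := z)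
  rw [Finset.card_univ, Fintype.card_fin] at h
  calc ((1 / (N : ℝ)) * ∑ j, z j) ^ 2 = (1 / (N : ℝ)) ^ 2 * (∑ j, z j) ^ 2 := by ring
    _ ≤ (1 / (N : ℝ)) ^ 2 * (N * ∑ j, z j ^ 2) := by gcongr
    _ = _ := by field_simp

section

variable {N n : ℕ}

/-- The empirical mean square error of the Monte Carlo approximation. -/
noncomputable def approxError (h : ℝ → ℝ) (g : ℝ × ℝ → ℝ) (u : Fin N → ℝ × ℝ)
    (v : Fin n → ℝ × ℝ) : ℝ :=
  (1 / (n : ℝ)) * ∑ i,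
    (network (fun j => (u j).1) (fun j => (u j).2) (approxWeights g u) (v i).1 - h (v i).1) ^ 2

/-- The squared deviations of the empirical noise correlations and second moments of `errorFeature`
from their expectations. -/
noncomputable def featureError (μX : Measure ℝ) (h : ℝ → ℝ) (u : Fin N → ℝ × ℝ)
    (v : Fin n → ℝ × ℝ) : ℝ :=
  ∑ j, ((1 / (n : ℝ)) * ∑ i, (v i).2 * errorFeature h u (v i).1 j) ^ 2
    + 1 / 2 * ∑ j, ∑ k, (∫ z, errorFeature h u z j * errorFeature h u z k ∂μX
      - (1 / (n : ℝ)) * ∑ i, errorFeature h u (v i).1 j * errorFeature h u (v i).1 k) ^ 2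

theorem approxError_nonneg (h : ℝ → ℝ) (g : ℝ × ℝ → ℝ) (u : Fin N → ℝ × ℝ)
    (v : Fin n → ℝ × ℝ) : 0 ≤ approxError h g u v :=
  mul_nonneg (by positivity) (Finset.sum_nonneg fun _ _ => sq_nonneg _)

theorem featureError_nonneg (μX : Measure ℝ) (h : ℝ → ℝ) (u : Fin N → ℝ × ℝ)
    (v : Fin n → ℝ × ℝ) : 0 ≤ featureError μX h u v :=
  add_nonneg (Finset.sum_nonneg fun _ _ => sq_nonneg _) (mul_nonneg (by norm_num)
    (Finset.sum_nonneg fun _ _ => Finset.sum_nonneg fun _ _ => sq_nonneg _))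

theorem integrable_errorFeature_mul (hN : 0 < N) {μX : Measure ℝ} [IsProbabilityMeasure μX]
    {h : ℝ → ℝ} {M : ℝ} (hX : ∀ᵐ x ∂μX, x ∈ Set.Icc 0 M) (hhm : Measurable h)
    (hh : ∀ x ∈ Set.Icc 0 M, 0 ≤ h x ∧ h x ≤ M) (u : Fin N → ℝ × ℝ)
    (j k : Option (Option (Fin N))) :
    Integrable (fun x => errorFeature h u x j * errorFeature h u x k) μX := by
  have hm : ∀ j, Measurable fun x => errorFeature h u x j := fun j =>
    (measurable_errorFeature hhm j).comp measurable_prodMk_left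
  refine Integrable.of_bound ((hm j).mul (hm k)).aestronglyMeasurable
    (1 + M ^ 2 + M ^ 2 * meanSqSlope u) ?_
  filter_upwards [hX] with x hx
  have h1 : ∀ j, errorFeature h u x j ^ 2 ≤ 1 + M ^ 2 + M ^ 2 * meanSqSlope u := fun j =>
    (Finset.single_le_sum (f := fun j => errorFeature h u x j ^ 2) (fun j _ => sq_nonneg _)
      (Finset.mem_univ j)).trans (sum_errorFeature_sq_le hN hx (hh x hx) u)
  rw [Real.norm_eq_abs, abs_le]
  constructor <;> nlinarith [h1 j, h1 k, sq_nonneg (errorFeature h u x j + errorFeature h u x k),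
    sq_nonneg (errorFeature h u x j - errorFeature h u x k)]

/-- The deterministic risk bound behind both regularized estimators: the weights enter only through
their empirical risk, their norm and the value of the network at `0`. -/
theorem integral_sq_network_sub_le (hN : 0 < N) (hn : 0 < n) {μX : Measure ℝ}
    [IsProbabilityMeasure μX] {h : ℝ → ℝ} {M : ℝ} (hX : ∀ᵐ x ∂μX, x ∈ Set.Icc 0 M)
    (hhm : Measurable h) (hh : ∀ x ∈ Set.Icc 0 M, 0 ≤ h x ∧ h x ≤ M) {g : ℝ × ℝ → ℝ}
    (hg : ∀ p, g p ≠ 0 → p.2 ≤ 0) (u : Fin N → ℝ × ℝ) (v : Fin n → ℝ × ℝ)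
    (W : EuclideanSpace ℝ (Fin N)) {r κ : ℝ} (hr : 0 ≤ r) (hκ : 0 ≤ κ) (hW : N * ‖W‖ ^ 2 ≤ r)
    (hW' : N * ‖approxWeights g u‖ ^ 2 ≤ r)
    (hW0 : network (fun j => (u j).1) (fun j => (u j).2) W 0 ^ 2 ≤ κ) :
    ∫ x, (h x - network (fun j => (u j).1) (fun j => (u j).2) W x) ^ 2 ∂μX
      ≤ empiricalRisk (fun j => (u j).1) (fun j => (u j).2) (fun i => (v i).1)
          (fun i => h (v i).1 + (v i).2) W
        - empiricalRisk (fun j => (u j).1) (fun j => (u j).2) (fun i => (v i).1)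
          (fun i => h (v i).1 + (v i).2) (approxWeights g u)
        + (approxError h g u v + 5 * (κ + 1 + r) ^ 2 / √n + √n * featureError μX h u v) := by
  have h1 := integral_sq_le_empirical_add hn (μ := μX) (φ := errorFeature h u)
    (integrable_errorFeature_mul hN hX hhm hh u) (fun i => (v i).1) (fun i => (v i).2)
    (θ := errorCoef u W) (θ' := errorCoef u (approxWeights g u)) (τ := κ + 1 + r)
    (by linarith) (by rw [sum_errorCoef_sq]; linarith)
    (by rw [sum_errorCoef_sq, network_approxWeights_zero hg]; linarith)
  simp_rw [sum_errorCoef_mul_errorFeature hN] at h1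
  have h2 : ∀ x, (h x - network (fun j => (u j).1) (fun j => (u j).2) W x) ^ 2
      = (network (fun j => (u j).1) (fun j => (u j).2) W x - h x) ^ 2 := fun x => by ring
  simp_rw [h2, empiricalRisk, ← sub_sub]
  exact h1

theorem measurable_network_approxWeights {g : ℝ × ℝ → ℝ} (hg : Measurable g) :
    Measurable fun p : (Fin N → ℝ × ℝ) × ℝ =>
      network (fun j => (p.1 j).1) (fun j => (p.1 j).2) (approxWeights g p.1) p.2 := by
  simp_rw [network_approxWeights]
  refine (Finset.measurable_fun_sum _ fun j _ => ?_).const_mul _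
  have h1 : Measurable fun p : (Fin N → ℝ × ℝ) × ℝ => p.1 j :=
    (measurable_pi_apply j).comp measurable_fst
  exact (hg.comp h1).mul (measurable_relu.comp ((h1.fst.mul measurable_snd).add h1.snd))

theorem measurable_approxError {h : ℝ → ℝ} {g : ℝ × ℝ → ℝ} (hh : Measurable h)
    (hg : Measurable g) :
    Measurable fun p : (Fin N → ℝ × ℝ) × (Fin n → ℝ × ℝ) => approxError h g p.1 p.2 := by
  refine (Finset.measurable_fun_sum _ fun i _ => ?_).const_mul _
  have h1 : Measurable fun p : (Fin N → ℝ × ℝ) × (Fin n → ℝ × ℝ) => (p.2 i).1 :=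
    ((measurable_pi_apply i).comp measurable_snd).fst
  exact (((measurable_network_approxWeights hg).comp (measurable_fst.prodMk h1)).sub
    (hh.comp h1)).pow_const 2

theorem measurable_featureError {μX : Measure ℝ} [IsProbabilityMeasure μX] {h : ℝ → ℝ}
    (hh : Measurable h) :
    Measurable fun p : (Fin N → ℝ × ℝ) × (Fin n → ℝ × ℝ) => featureError μX h p.1 p.2 := by
  have h1 : ∀ i, Measurable fun p : (Fin N → ℝ × ℝ) × (Fin n → ℝ × ℝ) => p.2 i := fun i =>
    (measurable_pi_apply i).comp measurable_snd
  have h2 : ∀ i j, Measurable fun p : (Fin N → ℝ × ℝ) × (Fin n → ℝ × ℝ) =>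
      errorFeature h p.1 (p.2 i).1 j := fun i j =>
    (measurable_errorFeature hh j).comp (measurable_fst.prodMk (h1 i).fst)
  have h3 : ∀ j k, Measurable fun u : Fin N → ℝ × ℝ =>
      ∫ z, errorFeature h u z j * errorFeature h u z k ∂μX := fun j k =>
    (((measurable_errorFeature hh j).mul
      (measurable_errorFeature hh k)).stronglyMeasurable.integral_prod_right' (ν := μX)).measurable
  refine Measurable.add (Finset.measurable_fun_sum _ fun j _ => ?_)
    ((Finset.measurable_fun_sum _ fun j _ => Finset.measurable_fun_sum _ fun k _ => ?_).const_mul _)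
  · exact ((Finset.measurable_fun_sum _ fun i _ => (h1 i).snd.mul (h2 i j)).const_mul _).pow_const 2
  · exact (((h3 j k).comp measurable_fst).sub
      ((Finset.measurable_fun_sum _ fun i _ => (h2 i j).mul (h2 i k)).const_mul _)).pow_const 2

/-- The mean square error of the Monte Carlo approximation is of order `1/N` at each point, hence
also on the sample. -/
theorem lintegral_approxError_le (hN : 0 < N) (hn : 0 < n) {ρ : Measure (ℝ × ℝ)}
    [IsProbabilityMeasure ρ] {μX με : Measure ℝ} [IsProbabilityMeasure μX] [IsProbabilityMeasure με]
    {h : ℝ → ℝ} {g : ℝ × ℝ → ℝ} {cl M : ℝ} (hM : 0 ≤ M) (hX : ∀ᵐ x ∂μX, x ∈ Set.Icc 0 M)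
    (hhm : Measurable h) (hh : ∀ x ∈ Set.Icc 0 M, 0 ≤ h x) (hgm : Measurable g)
    (hg : ∀ p, 0 ≤ g p ∧ g p ≤ cl)
    (hsupp : ∀ p, g p ≠ 0 → p.1 ∈ Set.Icc (1 : ℝ) 2 ∧ p.2 ∈ Set.Icc (-(2 * M)) 0)
    (hrep : ∀ x ∈ Set.Icc 0 M,
      ∫⁻ p, ENNReal.ofReal (g p * relu (p.1 * x + p.2)) ∂ρ = ENNReal.ofReal (h x)) :
    ∫⁻ p, ENNReal.ofReal (approxError h g p.1 p.2)
        ∂((Measure.pi fun _ : Fin N => ρ).prod (Measure.pi fun _ : Fin n => μX.prod με))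
      ≤ ENNReal.ofReal ((2 * M * cl) ^ 2 / N) := by
  set q : (Fin N → ℝ × ℝ) → ℝ × ℝ → ℝ := fun u p =>
    (network (fun j => (u j).1) (fun j => (u j).2) (approxWeights g u) p.1 - h p.1) ^ 2 with hq
  have hqm : Measurable fun p : (Fin N → ℝ × ℝ) × (ℝ × ℝ) => q p.1 p.2 :=
    (((measurable_network_approxWeights hgm).comp
      (measurable_fst.prodMk measurable_snd.fst)).sub (hhm.comp measurable_snd.fst)).pow_const 2
  rw [lintegral_prod _ (measurable_approxError hhm hgm).ennreal_ofReal.aemeasurable]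
  have h1 : ∀ u : Fin N → ℝ × ℝ, ∫⁻ v, ENNReal.ofReal (approxError h g u v)
      ∂(Measure.pi fun _ : Fin n => μX.prod με) = ∫⁻ p, ENNReal.ofReal (q u p) ∂(μX.prod με) :=
    fun u => lintegral_mean_eq hn (hqm.comp measurable_prodMk_left) fun p => sq_nonneg _
  simp_rw [h1]
  rw [lintegral_lintegral_swap hqm.ennreal_ofReal.aemeasurable]
  have hX' : ∀ᵐ p ∂(μX.prod με), p.1 ∈ Set.Icc 0 M := Measure.quasiMeasurePreserving_fst.ae hX
  calc ∫⁻ p, ∫⁻ u, ENNReal.ofReal (q u p) ∂(Measure.pi fun _ : Fin N => ρ) ∂(μX.prod με)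
      ≤ ∫⁻ _p, ENNReal.ofReal ((2 * M * cl) ^ 2 / N) ∂(μX.prod με) := by
        refine lintegral_mono_ae ?_
        filter_upwards [hX'] with p hp
        have h2 := lintegral_sq_sub_network_approxWeights_le hN hM hgm hg hsupp hp (hh _ hp)
          (hrep _ hp)
        refine le_trans (le_of_eq (lintegral_congr fun u => ?_)) h2
        rw [hq]
        congr 1
        ring
    _ = _ := by simp

/-- The empirical moments of `errorFeature` deviate by `O(1/n)` in mean square, for an arbitrary law
of the intercepts, since only the slopes enter the bound for the features. -/
theorem lintegral_featureError_le (hN : 0 < N) (hn : 0 < n) {ρ : Measure (ℝ × ℝ)}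
    [IsProbabilityMeasure ρ] {μX με : Measure ℝ} [IsProbabilityMeasure μX] [IsProbabilityMeasure με]
    {h : ℝ → ℝ} {M Ct : ℝ} (hX : ∀ᵐ x ∂μX, x ∈ Set.Icc 0 M)
    (hhm : Measurable h) (hh : ∀ x ∈ Set.Icc 0 M, 0 ≤ h x ∧ h x ≤ M)
    (hε : MemLp (fun e : ℝ => e) 2 με) (hε0 : ∫ e, e ∂με = 0)
    (hCt : ∫⁻ u, ENNReal.ofReal ((1 + M ^ 2 + M ^ 2 * meanSqSlope u) ^ 2)
      ∂(Measure.pi fun _ : Fin N => ρ) ≤ ENNReal.ofReal Ct) :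
    ∫⁻ p, ENNReal.ofReal (featureError μX h p.1 p.2)
        ∂((Measure.pi fun _ : Fin N => ρ).prod (Measure.pi fun _ : Fin n => μX.prod με))
      ≤ ENNReal.ofReal (((∫ e, e ^ 2 ∂με) + 1 / 2) * Ct / n) := by
  have hn' : (0 : ℝ) < n := by positivity
  have hσ : 0 ≤ ∫ e, e ^ 2 ∂με := integral_nonneg fun _ => sq_nonneg _
  rw [lintegral_prod _ (measurable_featureError hhm).ennreal_ofReal.aemeasurable]
  have hX' : ∀ᵐ p ∂(μX.prod με), p.1 ∈ Set.Icc 0 M := Measure.quasiMeasurePreserving_fst.ae hX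
  have hinner : ∀ u : Fin N → ℝ × ℝ, ∫⁻ v, ENNReal.ofReal (featureError μX h u v)
      ∂(Measure.pi fun _ : Fin n => μX.prod με)
      ≤ ENNReal.ofReal (((∫ e, e ^ 2 ∂με) + 1 / 2) / n)
        * ENNReal.ofReal ((1 + M ^ 2 + M ^ 2 * meanSqSlope u) ^ 2) := by
    intro u
    set t := 1 + M ^ 2 + M ^ 2 * meanSqSlope u with ht
    have ht1 : 1 ≤ t := by
      have := meanSqSlope_nonneg u
      have : 0 ≤ M ^ 2 * meanSqSlope u := by positivity
      nlinarith [sq_nonneg M]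
    have hm : ∀ j, Measurable fun x => errorFeature h u x j := fun j =>
      (measurable_errorFeature hhm j).comp measurable_prodMk_left
    have hbd : ∀ᵐ x ∂μX, ∑ j, errorFeature h u x j ^ 2 ≤ t := by
      filter_upwards [hX] with x hx using sum_errorFeature_sq_le hN hx (hh x hx) u
    have hbd' : ∀ᵐ p ∂(μX.prod με), ∑ j, errorFeature h u p.1 j ^ 2 ≤ t :=
      Measure.quasiMeasurePreserving_fst.ae hbd
    have hA := lintegral_sq_noise_correlation_le (n := n) hn hm hbd hε hε0
    have hB := lintegral_sq_secondMoment_le (n := n) hn (μ := μX.prod με)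
      (φ := fun p => errorFeature h u p.1) (fun j => (hm j).comp measurable_fst) hbd'
    have hfst : ∀ j k, ∫ p : ℝ × ℝ, errorFeature h u p.1 j * errorFeature h u p.1 k ∂(μX.prod με)
        = ∫ x, errorFeature h u x j * errorFeature h u x k ∂μX := fun j k => by
      have := integral_fun_fst (μ := μX) (ν := με)
        (fun x => errorFeature h u x j * errorFeature h u x k)
      simpa using this
    simp_rw [hfst] at hB
    have hnm : Measurable fun v : Fin n → ℝ × ℝ => ENNReal.ofReal (∑ j, ((1 / (n : ℝ)) *
        ∑ i, (v i).2 * errorFeature h u (v i).1 j) ^ 2) := by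
      refine (Finset.measurable_fun_sum _ fun j _ => ?_).ennreal_ofReal
      refine ((Finset.measurable_fun_sum _ fun i _ => ?_).const_mul _).pow_const 2
      exact (measurable_pi_apply i).snd.mul ((hm j).comp (measurable_pi_apply i).fst)
    unfold featureError
    simp_rw [ENNReal.ofReal_add (Finset.sum_nonneg fun j (_ : j ∈ Finset.univ) => sq_nonneg _)
      (mul_nonneg (by norm_num : (0 : ℝ) ≤ 1 / 2) (Finset.sum_nonneg
        fun j (_ : j ∈ Finset.univ) => Finset.sum_nonneg fun k (_ : k ∈ Finset.univ) =>
          sq_nonneg _)), ENNReal.ofReal_mul (by norm_num : (0 : ℝ) ≤ 1 / 2)]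
    rw [lintegral_add_left hnm, lintegral_const_mul' _ _ ENNReal.ofReal_ne_top]
    refine (add_le_add hA (mul_le_mul_right hB _)).trans ?_
    rw [← ENNReal.ofReal_mul (by norm_num), ← ENNReal.ofReal_mul (by positivity),
      ← ENNReal.ofReal_add (by positivity) (by positivity)]
    refine ENNReal.ofReal_le_ofReal ?_
    have h1 : (∫ e, e ^ 2 ∂με) * t / n + 1 / 2 * (t ^ 2 / n)
        = ((∫ e, e ^ 2 ∂με) * t + 1 / 2 * t ^ 2) / n := by ring
    have h2 : ((∫ e, e ^ 2 ∂με) + 1 / 2) / n * t ^ 2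
        = (((∫ e, e ^ 2 ∂με) + 1 / 2) * t ^ 2) / n := by ring
    have h3 : (∫ e, e ^ 2 ∂με) * t ≤ (∫ e, e ^ 2 ∂με) * t ^ 2 :=
      mul_le_mul_of_nonneg_left (by nlinarith) hσ
    rw [h1, h2]
    refine div_le_div_of_nonneg_right ?_ hn'.le
    linarith
  refine (lintegral_mono hinner).trans ?_
  rw [lintegral_const_mul' _ _ ENNReal.ofReal_ne_top, mul_div_right_comm,
    ENNReal.ofReal_mul (by positivity)]
  exact mul_le_mul_right hCt _

end

/-! ### The last iterate of subgradient descent, and uniform means over finite sets -/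

section LastIterate

variable {e d : ℕ → ℝ} {r D G η₀ : ℝ}

theorem half_inv_sqrt_le {t : ℕ} (ht : 1 ≤ t) : 1 / (2 * √(t : ℝ)) ≤ √(t : ℝ) - √((t : ℝ) - 1) := by
  have ht' : (1 : ℝ) ≤ t := by exact_mod_cast ht
  have h0 : 0 < √(t : ℝ) := Real.sqrt_pos.2 (by linarith)
  have h1 := Real.sq_sqrt (by linarith : (0 : ℝ) ≤ t)
  have h2 := Real.sq_sqrt (by linarith : (0 : ℝ) ≤ (t : ℝ) - 1)
  have h3 := Real.sqrt_nonneg ((t : ℝ) - 1)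
  rw [div_le_iff₀ (by positivity)]
  nlinarith [sq_nonneg (√(t : ℝ) - √((t : ℝ) - 1))]

/-- The regret of a descent with step sizes `η₀/√t` on the window `[s,m]`, against a fixed reference
value `r`. -/
theorem sum_regret_le (hη : 0 < η₀) (hG : 0 ≤ G) {s T : ℕ} (hs : 1 ≤ s)
    (hd : ∀ t, 0 ≤ d t ∧ d t ≤ D)
    (hstep : ∀ t, s ≤ t → t ≤ T →
      d (t + 1) ≤ d t - 2 * (η₀ / √t) * (e t - r) + (η₀ / √t) ^ 2 * G)
    {m : ℕ} (hsm : s ≤ m) (hmT : m ≤ T) :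
    ∑ t ∈ Finset.Icc s m, (e t - r)
      ≤ 1 / (2 * η₀) * (√s * d s + D * (√m - √s) - √m * d (m + 1))
        + η₀ * G * (√m - √((s : ℝ) - 1)) := by
  have hone : ∀ t, s ≤ t → t ≤ T →
      e t - r ≤ 1 / (2 * η₀) * (√t * (d t - d (t + 1))) + η₀ * G * (√t - √((t : ℝ) - 1)) := by
    intro t hst htT
    have ht1 : 1 ≤ t := hs.trans hst
    have h0 : 0 < √(t : ℝ) := Real.sqrt_pos.2 (by exact_mod_cast ht1)
    have h1 := hstep t hst htT
    have h2 : e t - r ≤ 1 / (2 * η₀) * (√t * (d t - d (t + 1))) + η₀ * G * (1 / (2 * √t)) := by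
      have h3 : 2 * (η₀ / √t) * (e t - r) ≤ d t - d (t + 1) + (η₀ / √t) ^ 2 * G := by linarith
      have h4 : e t - r = (√t / (2 * η₀)) * (2 * (η₀ / √t) * (e t - r)) := by field_simp
      rw [h4]
      refine (mul_le_mul_of_nonneg_left h3 (by positivity)).trans (le_of_eq ?_)
      field_simp
    have h5 := mul_le_mul_of_nonneg_left (half_inv_sqrt_le ht1) (mul_nonneg hη.le hG)
    linarith
  induction m, hsm using Nat.le_induction with
  | base =>
    rw [Finset.Icc_self, Finset.sum_singleton]
    refine (hone s le_rfl hmT).trans (le_of_eq ?_)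
    ring
  | succ m hsm ih =>
    rw [← Finset.insert_Icc_right_eq_Icc_add_one (by omega), Finset.sum_insert (by simp)]
    have h1 := hone (m + 1) (by omega) hmT
    have h2 := ih (by omega)
    have h3 : √(m : ℝ) ≤ √((m + 1 : ℕ) : ℝ) := Real.sqrt_le_sqrt (by push_cast; linarith)
    have h4 : (√((m + 1 : ℕ) : ℝ) - √(m : ℝ)) * d (m + 1)
        ≤ (√((m + 1 : ℕ) : ℝ) - √(m : ℝ)) * D :=
      mul_le_mul_of_nonneg_left (hd _).2 (by linarith)
    have h5 : ((m + 1 : ℕ) : ℝ) - 1 = m := by push_cast; ring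
    rw [h5] at h1
    have h6 := mul_le_mul_of_nonneg_left h4 (by positivity : 0 ≤ 1 / (2 * η₀))
    nlinarith

/-- The last iterate of a descent with step sizes `η₀/√t` loses only a logarithm against the average
of the iterates: the suffix averages are compared with one another through the regret against the
first iterate of the suffix. -/
theorem last_iterate_le (hη : 0 < η₀) (hG : 0 ≤ G) (hD : 0 ≤ D) {T : ℕ} (hT : 1 ≤ T)
    (hanchor : ∀ s, 1 ≤ s → s ≤ T → ∃ d : ℕ → ℝ, d s = 0 ∧ (∀ t, 0 ≤ d t ∧ d t ≤ D) ∧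
      ∀ t, s ≤ t → t ≤ T → d (t + 1) ≤ d t - 2 * (η₀ / √t) * (e t - e s) + (η₀ / √t) ^ 2 * G)
    (hr : ∃ d : ℕ → ℝ, (∀ t, 0 ≤ d t ∧ d t ≤ D) ∧
      ∀ t, 1 ≤ t → t ≤ T → d (t + 1) ≤ d t - 2 * (η₀ / √t) * (e t - r) + (η₀ / √t) ^ 2 * G) :
    e T - r ≤ (D / (2 * η₀) + η₀ * G) / √T * (2 + Real.log T) := by
  have hT' : (1 : ℝ) ≤ T := by exact_mod_cast hT
  have hT0 : 0 < √(T : ℝ) := Real.sqrt_pos.2 (by linarith)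
  set B := D / (2 * η₀) + η₀ * G with hB
  have hB0 : 0 ≤ B := by positivity
  set b := B / √T with hb
  have hb0 : 0 ≤ b := by positivity
  -- the iterates on `[T - k, T]` are on average not much worse than the first of them
  have hsuffix : ∀ k, k + 1 ≤ T →
      ∑ t ∈ Finset.Icc (T - k) T, e t ≤ (k + 1) * (e (T - k) + b) := by
    intro k hk
    have hs1 : 1 ≤ T - k := by omega
    obtain ⟨d, hd0, hd, hstep⟩ := hanchor (T - k) hs1 (by omega)
    have h1 := sum_regret_le hη hG hs1 hd hstep (m := T) (by omega) le_rfl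
    have hcast : ((T - k : ℕ) : ℝ) = T - k := by rw [Nat.cast_sub (by omega)]
    have hk' : (k : ℝ) + 1 ≤ T := by exact_mod_cast hk
    rw [hd0, mul_zero, zero_add, Finset.sum_sub_distrib, Finset.sum_const, Nat.card_Icc,
      nsmul_eq_mul, hcast] at h1
    have hcard : ((T + 1 - (T - k) : ℕ) : ℝ) = k + 1 := by
      rw [show T + 1 - (T - k) = k + 1 by omega]; push_cast; ring
    rw [hcard] at h1
    -- both square root differences are at most `(k + 1) / √T`
    have h2 : √(T : ℝ) - √((T : ℝ) - k - 1) ≤ (k + 1) / √T := by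
      have h3 := Real.sq_sqrt (by linarith : (0 : ℝ) ≤ T)
      have h4 := Real.sq_sqrt (by linarith : (0 : ℝ) ≤ (T : ℝ) - k - 1)
      have h5 := Real.sqrt_nonneg ((T : ℝ) - k - 1)
      have h6 : √((T : ℝ) - k - 1) ≤ √(T : ℝ) := Real.sqrt_le_sqrt (by linarith)
      rw [le_div_iff₀ hT0]
      nlinarith
    have h7 : √((T : ℝ) - k - 1) ≤ √((T : ℝ) - k) := Real.sqrt_le_sqrt (by linarith)
    have h8 : 0 ≤ √(T : ℝ) * d (T + 1) := mul_nonneg hT0.le (hd _).1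
    have h9 : 1 / (2 * η₀) * (D * (√T - √((T : ℝ) - k)) - √T * d (T + 1))
        ≤ D / (2 * η₀) * ((k + 1) / √T) := by
      have : D * (√T - √((T : ℝ) - k)) - √T * d (T + 1) ≤ D * ((k + 1) / √T) := by
        have := mul_le_mul_of_nonneg_left (by linarith : √(T : ℝ) - √((T : ℝ) - k) ≤ (k + 1) / √T) hD
        linarith
      refine (mul_le_mul_of_nonneg_left this (by positivity)).trans (le_of_eq (by ring))
    have h10 := mul_le_mul_of_nonneg_left h2 (mul_nonneg hη.le hG)
    have h11 : (k + 1) * (e (T - k) + b) = (k + 1) * e (T - k)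
        + (D / (2 * η₀) * ((k + 1) / √T) + η₀ * G * ((k + 1) / √T)) := by
      rw [hb, hB]; ring
    rw [h11]
    linarith
  -- hence removing the first iterate of a suffix raises the average by at most `b / (k + 1)`
  have hchain : ∀ k, k + 1 ≤ T →
      e T ≤ (∑ t ∈ Finset.Icc (T - k) T, e t) / (k + 1) + b * (harmonic k : ℝ) := by
    intro k
    induction k with
    | zero => intro _; simp
    | succ k ih =>
      intro hk
      have h1 := ih (by omega)
      have h2 := hsuffix (k + 1) hk
      have h3 : ∑ t ∈ Finset.Icc (T - (k + 1)) T, e t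
          = e (T - (k + 1)) + ∑ t ∈ Finset.Icc (T - k) T, e t := by
        rw [← Finset.insert_Icc_add_one_left_eq_Icc (by omega), Finset.sum_insert (by simp),
          show T - (k + 1) + 1 = T - k by omega]
      have h4 : ((harmonic (k + 1) : ℚ) : ℝ) = (harmonic k : ℝ) + 1 / ((k : ℝ) + 1) := by
        rw [harmonic_succ]; push_cast; ring
      push_cast at h2
      rw [h4]
      push_cast
      rw [h3] at h2 ⊢
      set Sk := ∑ t ∈ Finset.Icc (T - k) T, e t
      have hk1 : (0 : ℝ) < (k : ℝ) + 1 := by positivity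
      have h5 : Sk / ((k : ℝ) + 1)
          ≤ (e (T - (k + 1)) + Sk) / ((k : ℝ) + 1 + 1) + b * (1 / ((k : ℝ) + 1)) := by
        rw [mul_one_div, div_add_div _ _ (by positivity) hk1.ne', div_le_div_iff₀ hk1 (by positivity)]
        have : (Sk - ((k : ℝ) + 1) * e (T - (k + 1)) - ((k : ℝ) + 1 + 1) * b) * ((k : ℝ) + 1) ≤ 0 :=
          mul_nonpos_of_nonpos_of_nonneg (by linarith) hk1.le
        nlinarith
      linarith
  have hk : T - 1 + 1 ≤ T := by omega
  have h1 := hchain (T - 1) hk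
  rw [show T - (T - 1) = 1 by omega, Nat.cast_sub hT, Nat.cast_one, sub_add_cancel] at h1
  obtain ⟨d, hd, hstep⟩ := hr
  have h2 := sum_regret_le hη hG le_rfl hd hstep (m := T) hT le_rfl
  rw [Finset.sum_sub_distrib, Finset.sum_const, Nat.card_Icc, Nat.add_sub_cancel,
    nsmul_eq_mul] at h2
  simp only [Nat.cast_one, Real.sqrt_one, one_mul, sub_self, Real.sqrt_zero, sub_zero] at h2
  have h3 : (∑ t ∈ Finset.Icc 1 T, e t) / T ≤ r + b := by
    rw [div_le_iff₀ (by linarith)]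
    have h4 : b * T = B * √T := by
      rw [hb, div_mul_eq_mul_div, div_eq_iff hT0.ne', mul_assoc,
        Real.mul_self_sqrt (by linarith)]
    have h5 : 1 / (2 * η₀) * (d 1 + D * (√T - 1) - √T * d (T + 1)) ≤ D / (2 * η₀) * √T := by
      have : d 1 + D * (√T - 1) - √T * d (T + 1) ≤ D * √T := by
        have := mul_nonneg hT0.le (hd (T + 1)).1
        linarith [(hd 1).2]
      refine (mul_le_mul_of_nonneg_left this (by positivity)).trans (le_of_eq (by ring))
    have h6 : (r + b) * T = T * r + (D / (2 * η₀) * √T + η₀ * G * √T) := by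
      rw [add_mul, h4, hB]; ring
    rw [h6]
    linarith
  have h7 : (harmonic (T - 1) : ℝ) ≤ 1 + Real.log T := by
    refine (harmonic_le_one_add_log _).trans ?_
    rcases Nat.eq_zero_or_pos (T - 1) with h0 | h0
    · rw [h0, Nat.cast_zero, Real.log_zero]
      linarith [Real.log_nonneg hT']
    · have := Real.log_le_log (by exact_mod_cast h0 : (0 : ℝ) < ((T - 1 : ℕ) : ℝ))
        (by exact_mod_cast Nat.sub_le T 1 : ((T - 1 : ℕ) : ℝ) ≤ T)
      linarith
  have h8 := mul_le_mul_of_nonneg_left h7 hb0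
  have h9 : b * (2 + Real.log T) = b + b * (1 + Real.log T) := by ring
  rw [h9]
  linarith

end LastIterate

/-- The mean of a function on a finite type. -/
noncomputable def uniformMean {α : Type*} [Fintype α] (F : α → ℝ) : ℝ :=
  (Fintype.card α : ℝ)⁻¹ * ∑ a, F a

section UniformMean

variable {α : Type*} [Fintype α]

theorem uniformMean_mono {F F' : α → ℝ} (h : ∀ a, F a ≤ F' a) : uniformMean F ≤ uniformMean F' :=
  mul_le_mul_of_nonneg_left (Finset.sum_le_sum fun a _ => h a) (by positivity)

theorem uniformMean_add (F F' : α → ℝ) :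
    uniformMean (fun a => F a + F' a) = uniformMean F + uniformMean F' := by
  rw [uniformMean, Finset.sum_add_distrib, mul_add]; rfl

theorem uniformMean_sub (F F' : α → ℝ) :
    uniformMean (fun a => F a - F' a) = uniformMean F - uniformMean F' := by
  rw [uniformMean, Finset.sum_sub_distrib, mul_sub]; rfl

theorem uniformMean_const_mul (c : ℝ) (F : α → ℝ) :
    uniformMean (fun a => c * F a) = c * uniformMean F := by
  rw [uniformMean, uniformMean, ← Finset.mul_sum]; ring

theorem uniformMean_sum {ι : Type*} (s : Finset ι) (F : ι → α → ℝ) :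
    uniformMean (fun a => ∑ i ∈ s, F i a) = ∑ i ∈ s, uniformMean (F i) := by
  simp only [uniformMean]
  rw [Finset.sum_comm, Finset.mul_sum]

theorem uniformMean_const [Nonempty α] (c : ℝ) : uniformMean (fun _ : α => c) = c := by
  rw [uniformMean, Finset.sum_const, nsmul_eq_mul, ← mul_assoc, Finset.card_univ,
    inv_mul_cancel₀ (by positivity), one_mul]

/-- A coordinate of a uniformly distributed function is uniformly distributed and independent of
the other coordinates. -/
theorem uniformMean_apply_coord {K β : Type*} [Fintype K] [DecidableEq K] [Fintype β]
    [Nonempty β] (k : K) {F : (K → β) → β → ℝ}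
    (hF : ∀ j b c, F (Function.update j k b) c = F j c) :
    uniformMean (fun j => F j (j k)) = uniformMean fun j => uniformMean (F j) := by
  have hupd : ∀ (b m : β) (y : {i // i ≠ k} → β),
      Function.update ((Equiv.funSplitAt k β).symm (b, y)) k m
        = (Equiv.funSplitAt k β).symm (m, y) := by
    intro b m y
    ext i
    by_cases hi : i = k
    · subst hi; simp [Equiv.funSplitAt, Equiv.piSplitAt]
    · simp [Equiv.funSplitAt, Equiv.piSplitAt, hi]
  have hval : ∀ (m : β) (y : {i // i ≠ k} → β), (Equiv.funSplitAt k β).symm (m, y) k = m := by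
    intro m y; simp [Equiv.funSplitAt, Equiv.piSplitAt]
  have hcard : (Fintype.card β : ℝ) ≠ 0 := by positivity
  have h1 : ∑ j, F j (j k) = ∑ y, ∑ m, F ((Equiv.funSplitAt k β).symm (m, y)) m := by
    rw [← Equiv.sum_comp (Equiv.funSplitAt k β).symm, Fintype.sum_prod_type, Finset.sum_comm]
    simp only [hval]
  have h2 : ∑ j, uniformMean (F j) = ∑ y, ∑ m, F ((Equiv.funSplitAt k β).symm (m, y)) m := by
    rw [← Equiv.sum_comp (Equiv.funSplitAt k β).symm, Fintype.sum_prod_type, Finset.sum_comm]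
    refine Finset.sum_congr rfl fun y _ => ?_
    have h3 : ∀ b, ∑ m, F ((Equiv.funSplitAt k β).symm (b, y)) m
        = ∑ m, F ((Equiv.funSplitAt k β).symm (m, y)) m := fun b =>
      Finset.sum_congr rfl fun m _ => by rw [← hupd b m y, hF]
    simp only [uniformMean, h3]
    rw [Finset.sum_const, nsmul_eq_mul, Finset.card_univ, ← mul_assoc, mul_inv_cancel₀ hcard,
      one_mul]
  rw [uniformMean, uniformMean, h1, h2]

end UniformMean

/-! ### Projected stochastic gradient descent -/

theorem network_eq_inner {N : ℕ} (a b : Fin N → ℝ) (w : EuclideanSpace ℝ (Fin N)) (x : ℝ) :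
    network a b w x = inner ℝ w (features a b x) := by
  simp [network, features, PiLp.inner_apply, mul_comm]

/-- The projection onto the ball does not increase the distance to points of the ball. -/
theorem norm_ballProj_sub_le {N : ℕ} {lam : ℝ} (hlam : 0 ≤ lam) (v w : EuclideanSpace ℝ (Fin N))
    (hw : ‖w‖ ≤ lam) : ‖ballProj lam v - w‖ ^ 2 ≤ ‖v - w‖ ^ 2 := by
  unfold ballProj
  split_ifs with h
  · exact le_rfl
  · have hv : 0 < ‖v‖ := lt_of_le_of_lt hlam (not_le.mp h)
    have hv' := (not_le.mp h).le
    have hin : inner ℝ v w ≤ ‖v‖ * lam :=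
      (real_inner_le_norm v w).trans (mul_le_mul_of_nonneg_left hw hv.le)
    have hs : 0 ≤ 1 - lam / ‖v‖ := by rw [sub_nonneg, div_le_one hv]; exact hv'
    rw [norm_sub_sq_real, norm_sub_sq_real, norm_smul, Real.norm_of_nonneg (by positivity),
      real_inner_smul_left, div_mul_cancel₀ _ hv.ne']
    have h1 := mul_le_mul_of_nonneg_left hin hs
    have h2 : (1 - lam / ‖v‖) * (‖v‖ * lam) = ‖v‖ * lam - lam ^ 2 := by field_simp
    have h3 : (1 - lam / ‖v‖) * inner ℝ v w = inner ℝ v w - lam / ‖v‖ * inner ℝ v w := by ring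
    nlinarith [sq_nonneg (‖v‖ - lam)]

section Sgd

variable {N n 𝔅 : ℕ} (a b : Fin N → ℝ) (x y : Fin n → ℝ) (lam η₀ : ℝ)

/-- The squared prediction error at the `k`-th sample point. -/
noncomputable def sampleLoss (k : Fin n) (w : EuclideanSpace ℝ (Fin N)) : ℝ :=
  (inner ℝ w (features a b (x k)) - y k) ^ 2

/-- The stochastic gradient of the empirical risk for the batch `J`. -/
noncomputable def batchGradient (W : EuclideanSpace ℝ (Fin N)) (J : Fin 𝔅 → Fin n) :
    EuclideanSpace ℝ (Fin N) :=
  (2 / (𝔅 : ℝ)) • ∑ i, (inner ℝ W (features a b (x (J i))) - y (J i)) • features a b (x (J i))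

/-- A bound for the squared norm of the gradient of `sampleLoss` on the ball of radius `lam`. -/
noncomputable def gradBound (k : Fin n) : ℝ :=
  8 * ‖features a b (x k)‖ ^ 2 * (lam ^ 2 * ‖features a b (x k)‖ ^ 2 + y k ^ 2)

theorem empiricalRisk_eq_uniformMean (w : EuclideanSpace ℝ (Fin N)) :
    empiricalRisk a b x y w = uniformMean fun k => sampleLoss a b x y k w := by
  simp [empiricalRisk, uniformMean, sampleLoss, network_eq_inner]

theorem sgd_succ (J : Fin 𝔅 → ℕ → Fin n) {t : ℕ} (ht : 1 ≤ t) :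
    sgd a b x y lam η₀ J (t + 1) = ballProj lam (sgd a b x y lam η₀ J t
      - (η₀ / √t) • batchGradient a b x y (sgd a b x y lam η₀ J t) fun i => J i t) := by
  obtain ⟨t, rfl⟩ : ∃ s, t = s + 1 := ⟨t - 1, by omega⟩
  rw [sgd, batchGradient, smul_smul]
  have h1 : ((t + 1 : ℕ) : ℝ) ^ (-(1 / 2) : ℝ) = (√((t + 1 : ℕ) : ℝ))⁻¹ := by
    rw [Real.rpow_neg (by positivity), Real.sqrt_eq_rpow]
  simp only [h1]
  congr 3
  ring

theorem norm_sgd_le (hlam : 0 ≤ lam) (J : Fin 𝔅 → ℕ → Fin n) (t : ℕ) :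
    ‖sgd a b x y lam η₀ J t‖ ≤ lam := by
  match t with
  | 0 => simpa [sgd] using hlam
  | 1 => simpa [sgd] using hlam
  | t + 2 =>
    rw [sgd_succ a b x y lam η₀ J (by omega)]
    exact (ballProj_nearest hlam _).1

theorem sgd_congr {J J' : Fin 𝔅 → ℕ → Fin n} {t : ℕ}
    (h : ∀ i, ∀ s, 1 ≤ s → s < t → J i s = J' i s) :
    sgd a b x y lam η₀ J t = sgd a b x y lam η₀ J' t := by
  match t with
  | 0 => rfl
  | 1 => rfl
  | t + 2 =>
    rw [sgd_succ a b x y lam η₀ J (by omega), sgd_succ a b x y lam η₀ J' (by omega),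
      sgd_congr (t := t + 1) fun i s h1 h2 => h i s h1 (by omega)]
    congr 4
    ext i
    rw [h i (t + 1) (by omega) (by omega)]

/-- The gradient inequality for the convex batch loss. -/
theorem sub_le_inner_batchGradient (W w : EuclideanSpace ℝ (Fin N)) (J : Fin 𝔅 → Fin n) :
    (1 / (𝔅 : ℝ)) * ∑ i, (sampleLoss a b x y (J i) W - sampleLoss a b x y (J i) w)
      ≤ inner ℝ (batchGradient a b x y W J) (W - w) := by
  rw [batchGradient, real_inner_smul_left, sum_inner, div_eq_mul_one_div (2 : ℝ), mul_comm (2 : ℝ),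
    mul_assoc, Finset.mul_sum (a := (2 : ℝ))]
  refine mul_le_mul_of_nonneg_left (Finset.sum_le_sum fun i _ => ?_) (by positivity)
  rw [real_inner_smul_left, inner_sub_right, real_inner_comm W, real_inner_comm w]
  unfold sampleLoss
  nlinarith [sq_nonneg (inner ℝ W (features a b (x (J i))) - inner ℝ w (features a b (x (J i))))]

theorem norm_batchGradient_sq_le {W : EuclideanSpace ℝ (Fin N)} (hW : ‖W‖ ≤ lam)
    (J : Fin 𝔅 → Fin n) :
    ‖batchGradient a b x y W J‖ ^ 2 ≤ (1 / (𝔅 : ℝ)) * ∑ i, gradBound a b x y lam (J i) := by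
  rcases Nat.eq_zero_or_pos 𝔅 with h0 | h0
  · subst h0; simp [batchGradient]
  have h𝔅 : (0 : ℝ) < 𝔅 := by positivity
  have h1 : ‖∑ i, (inner ℝ W (features a b (x (J i))) - y (J i)) • features a b (x (J i))‖ ^ 2
      ≤ 𝔅 * ∑ i, ‖(inner ℝ W (features a b (x (J i))) - y (J i)) • features a b (x (J i))‖ ^ 2 := by
    have h2 := sq_sum_le_card_mul_sum_sq (s := Finset.univ)
      (f := fun i => ‖(inner ℝ W (features a b (x (J i))) - y (J i)) • features a b (x (J i))‖)
    rw [Finset.card_univ, Fintype.card_fin] at h2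
    exact (pow_le_pow_left₀ (norm_nonneg _) (norm_sum_le _ _) 2).trans h2
  have h3 : ∀ i, ‖(inner ℝ W (features a b (x (J i))) - y (J i)) • features a b (x (J i))‖ ^ 2
      ≤ gradBound a b x y lam (J i) / 4 := by
    intro i
    have h4 : (inner ℝ W (features a b (x (J i))) - y (J i)) ^ 2
        ≤ 2 * (lam ^ 2 * ‖features a b (x (J i))‖ ^ 2 + y (J i) ^ 2) := by
      have h5 : (inner ℝ W (features a b (x (J i)))) ^ 2
          ≤ lam ^ 2 * ‖features a b (x (J i))‖ ^ 2 := by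
        rw [← mul_pow, ← sq_abs]
        refine pow_le_pow_left₀ (abs_nonneg _) ((abs_real_inner_le_norm _ _).trans ?_) 2
        exact mul_le_mul_of_nonneg_right hW (norm_nonneg _)
      nlinarith [sq_nonneg (inner ℝ W (features a b (x (J i))) + y (J i))]
    rw [norm_smul, mul_pow, Real.norm_eq_abs, sq_abs, gradBound]
    have := mul_le_mul_of_nonneg_right h4 (sq_nonneg ‖features a b (x (J i))‖)
    linarith
  rw [batchGradient, norm_smul, mul_pow, Real.norm_of_nonneg (by positivity)]
  calc (2 / (𝔅 : ℝ)) ^ 2 * ‖∑ i, (inner ℝ W (features a b (x (J i))) - y (J i)) •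
          features a b (x (J i))‖ ^ 2
      ≤ (2 / (𝔅 : ℝ)) ^ 2 * (𝔅 * ∑ i, gradBound a b x y lam (J i) / 4) := by
        refine mul_le_mul_of_nonneg_left (h1.trans ?_) (by positivity)
        exact mul_le_mul_of_nonneg_left (Finset.sum_le_sum fun i _ => h3 i) h𝔅.le
    _ = _ := by
        rw [← Finset.sum_div]
        field_simp
        ring

theorem norm_sgd_succ_sub_sq_le (hlam : 0 ≤ lam) (hη : 0 ≤ η₀) (J : Fin 𝔅 → ℕ → Fin n) {t : ℕ}
    (ht : 1 ≤ t) {w : EuclideanSpace ℝ (Fin N)} (hw : ‖w‖ ≤ lam) :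
    ‖sgd a b x y lam η₀ J (t + 1) - w‖ ^ 2 ≤ ‖sgd a b x y lam η₀ J t - w‖ ^ 2
      - 2 * (η₀ / √t) * ((1 / (𝔅 : ℝ)) * ∑ i, (sampleLoss a b x y (J i t) (sgd a b x y lam η₀ J t)
        - sampleLoss a b x y (J i t) w))
      + (η₀ / √t) ^ 2 * ((1 / (𝔅 : ℝ)) * ∑ i, gradBound a b x y lam (J i t)) := by
  set W := sgd a b x y lam η₀ J t with hW
  set η := η₀ / √(t : ℝ) with hηt
  have hη0 : 0 ≤ η := by positivity
  set gr := batchGradient a b x y W fun i => J i t with hgr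
  rw [sgd_succ a b x y lam η₀ J ht]
  refine (norm_ballProj_sub_le hlam _ _ hw).trans ?_
  have h1 : ‖W - η • gr - w‖ ^ 2 = ‖W - w‖ ^ 2 - 2 * η * inner ℝ gr (W - w) + η ^ 2 * ‖gr‖ ^ 2 := by
    rw [show W - η • gr - w = (W - w) - η • gr by abel, norm_sub_sq_real, norm_smul, mul_pow,
      Real.norm_of_nonneg hη0, real_inner_smul_right, real_inner_comm]
    ring
  rw [← hW, h1]
  have h2 := mul_le_mul_of_nonneg_left (sub_le_inner_batchGradient a b x y W w fun i => J i t)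
    (by positivity : 0 ≤ 2 * η)
  have h3 := mul_le_mul_of_nonneg_left (norm_batchGradient_sq_le a b x y lam
    (norm_sgd_le a b x y lam η₀ hlam J t) fun i => J i t) (sq_nonneg η)
  rw [← hW, ← hgr] at h3
  linarith

/-- Batch indices for the times `1,…,T`, extended arbitrarily to all times. -/
def extendBatch (hn : 0 < n) {T : ℕ} (j : Fin 𝔅 × Finset.Icc 1 T → Fin n) (i : Fin 𝔅) (t : ℕ) :
    Fin n :=
  if h : t ∈ Finset.Icc 1 T then j (i, ⟨t, h⟩) else ⟨0, hn⟩

/-- A batch average at time `t` of a function that does not depend on the indices drawn at time `t`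
is, in the mean, the average over the whole sample. -/
theorem uniformMean_extendBatch (hn : 0 < n) (h𝔅 : 0 < 𝔅) {T t : ℕ} (ht : t ∈ Finset.Icc 1 T)
    {F : (Fin 𝔅 × Finset.Icc 1 T → Fin n) → Fin n → ℝ}
    (hF : ∀ j i b c, F (Function.update j (i, ⟨t, ht⟩) b) c = F j c) :
    uniformMean (fun j => (1 / (𝔅 : ℝ)) * ∑ i, F j (extendBatch hn j i t))
      = uniformMean fun j => uniformMean (F j) := by
  have : Nonempty (Fin n) := ⟨⟨0, hn⟩⟩
  have h𝔅' : (𝔅 : ℝ) ≠ 0 := by positivity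
  rw [uniformMean_const_mul, uniformMean_sum]
  have h1 : ∀ i : Fin 𝔅, uniformMean (fun j => F j (extendBatch hn j i t))
      = uniformMean fun j => uniformMean (F j) := fun i => by
    simp only [extendBatch, dif_pos ht]
    exact uniformMean_apply_coord (i, ⟨t, ht⟩) fun j b c => hF j i b c
  rw [Finset.sum_congr rfl fun i _ => h1 i, Finset.sum_const, Finset.card_univ, Fintype.card_fin,
    nsmul_eq_mul, ← mul_assoc, one_div, inv_mul_cancel₀ h𝔅', one_mul]

/-- Optimization error of projected stochastic gradient descent for fixed data, averaged over the
batch indices. -/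
theorem uniformMean_empiricalRisk_sgd_le (hn : 0 < n) (h𝔅 : 0 < 𝔅) (hlam : 0 ≤ lam) (hη : 0 < η₀)
    {T : ℕ} (hT : 1 ≤ T) {w : EuclideanSpace ℝ (Fin N)} (hw : ‖w‖ ≤ lam) :
    uniformMean (fun j : Fin 𝔅 × Finset.Icc 1 T → Fin n =>
        empiricalRisk a b x y (sgd a b x y lam η₀ (extendBatch hn j) T)
          - empiricalRisk a b x y w)
      ≤ (4 * lam ^ 2 / (2 * η₀) + η₀ * uniformMean (gradBound a b x y lam)) / √T
        * (2 + Real.log T) := by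
  have hne : Nonempty (Fin 𝔅 × Finset.Icc 1 T → Fin n) := ⟨fun _ => ⟨0, hn⟩⟩
  set Wt : (Fin 𝔅 × Finset.Icc 1 T → Fin n) → ℕ → EuclideanSpace ℝ (Fin N) :=
    fun j t => sgd a b x y lam η₀ (extendBatch hn j) t with hWt
  have hWn : ∀ j t, ‖Wt j t‖ ≤ lam := fun j t => norm_sgd_le a b x y lam η₀ hlam _ t
  -- the iterate at time `s` does not depend on the batches drawn at times `t ≥ s`
  have hind : ∀ (s t : ℕ) (ht : t ∈ Finset.Icc 1 T), s ≤ t → ∀ j i c,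
      Wt (Function.update j (i, ⟨t, ht⟩) c) s = Wt j s := by
    intro s t ht hst j i c
    refine sgd_congr a b x y lam η₀ fun i' s' h1 h2 => ?_
    unfold extendBatch
    split_ifs with h
    · rw [Function.update_of_ne]
      intro heq
      have : s' = t := congrArg (fun p => (p.2 : ℕ)) heq
      omega
    · rfl
  have hG : 0 ≤ uniformMean (gradBound a b x y lam) :=
    mul_nonneg (by positivity) (Finset.sum_nonneg fun k _ => by unfold gradBound; positivity)
  have hdist : ∀ j t (w : EuclideanSpace ℝ (Fin N)), ‖w‖ ≤ lam → ‖Wt j t - w‖ ^ 2 ≤ 4 * lam ^ 2 := by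
    intro j t w hw
    have h1 : ‖Wt j t - w‖ ≤ 2 * lam := (norm_sub_le _ _).trans (by linarith [hWn j t])
    calc ‖Wt j t - w‖ ^ 2 ≤ (2 * lam) ^ 2 := pow_le_pow_left₀ (norm_nonneg _) h1 2
      _ = _ := by ring
  -- one step, against a reference point that does not depend on the current batch
  have hstep : ∀ (t : ℕ) (ht : t ∈ Finset.Icc 1 T)
      (w : (Fin 𝔅 × Finset.Icc 1 T → Fin n) → EuclideanSpace ℝ (Fin N)),
      (∀ j, ‖w j‖ ≤ lam) → (∀ j i c, w (Function.update j (i, ⟨t, ht⟩) c) = w j) →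
      uniformMean (fun j => ‖Wt j (t + 1) - w j‖ ^ 2) ≤ uniformMean (fun j => ‖Wt j t - w j‖ ^ 2)
        - 2 * (η₀ / √t) * (uniformMean (fun j => empiricalRisk a b x y (Wt j t))
          - uniformMean (fun j => empiricalRisk a b x y (w j)))
        + (η₀ / √t) ^ 2 * uniformMean (gradBound a b x y lam) := by
    intro t ht w hwn hwi
    have h0 : ∀ j, ‖Wt j (t + 1) - w j‖ ^ 2 ≤ ‖Wt j t - w j‖ ^ 2
        - 2 * (η₀ / √t) * ((1 / (𝔅 : ℝ)) * ∑ i, (sampleLoss a b x y (extendBatch hn j i t) (Wt j t)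
          - sampleLoss a b x y (extendBatch hn j i t) (w j)))
        + (η₀ / √t) ^ 2 * ((1 / (𝔅 : ℝ)) * ∑ i, gradBound a b x y lam (extendBatch hn j i t)) :=
      fun j => norm_sgd_succ_sub_sq_le a b x y lam η₀ hlam hη.le
        (extendBatch hn j) (Finset.mem_Icc.1 ht).1 (hwn j)
    have h1 := uniformMean_mono h0
    rw [uniformMean_add, uniformMean_sub, uniformMean_const_mul (2 * (η₀ / √(t : ℝ))),
      uniformMean_const_mul ((η₀ / √(t : ℝ)) ^ 2),
      uniformMean_extendBatch hn h𝔅 ht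
        (F := fun j k => sampleLoss a b x y k (Wt j t) - sampleLoss a b x y k (w j))
        (fun j i c k => by simp only [hind t t ht le_rfl, hwi]),
      uniformMean_extendBatch hn h𝔅 ht (F := fun _ k => gradBound a b x y lam k)
        (fun j i c k => rfl), uniformMean_const] at h1
    simp only [uniformMean_sub, ← empiricalRisk_eq_uniformMean] at h1
    exact h1
  have hmain := last_iterate_le (e := fun t => uniformMean fun j => empiricalRisk a b x y (Wt j t))
    (r := empiricalRisk a b x y w) (D := 4 * lam ^ 2) hη hG (by positivity) hT
    (fun s hs1 hsT => ⟨fun t => uniformMean fun j => ‖Wt j t - Wt j s‖ ^ 2, by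
      simp [uniformMean], fun t => ⟨mul_nonneg (by positivity)
        (Finset.sum_nonneg fun j _ => sq_nonneg _),
        (uniformMean_mono fun j => hdist j t _ (hWn j s)).trans (uniformMean_const _).le⟩,
      fun t hst htT => hstep t (Finset.mem_Icc.2 ⟨by omega, htT⟩) (fun j => Wt j s)
        (fun j => hWn j s) (hind s t _ hst)⟩)
    ⟨fun t => uniformMean fun j => ‖Wt j t - w‖ ^ 2, fun t => ⟨mul_nonneg (by positivity)
        (Finset.sum_nonneg fun j _ => sq_nonneg _),
        (uniformMean_mono fun j => hdist j t _ hw).trans (uniformMean_const _).le⟩,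
      fun t h1 htT => by
        have := hstep t (Finset.mem_Icc.2 ⟨h1, htT⟩) (fun _ => w) (fun _ => hw)
          (fun _ _ _ => rfl)
        rwa [uniformMean_const] at this⟩
  rw [uniformMean_sub, uniformMean_const]
  exact hmain

end Sgd

/-! ### The hat matrix and the leave-one-out formula -/

section LeaveOneOut

variable {κ : Type*} {N : ℕ}

/-- The vector of predictions `(w · φ_i)_i` at the design points, as a linear function of `w`. -/
noncomputable def predictionMap (φ : κ → EuclideanSpace ℝ (Fin N)) :
    EuclideanSpace ℝ (Fin N) →ₗ[ℝ] EuclideanSpace ℝ κ where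
  toFun w := WithLp.toLp 2 fun i => inner ℝ w (φ i)
  map_add' w w' := by ext i; simp [inner_add_left]
  map_smul' c w := by ext i; simp [real_inner_smul_left]

theorem predictionMap_apply (φ : κ → EuclideanSpace ℝ (Fin N)) (w : EuclideanSpace ℝ (Fin N))
    (i : κ) : predictionMap φ w i = inner ℝ w (φ i) := rfl

variable [Fintype κ]

/-- The orthogonal projection onto the space of predictions. -/
noncomputable def hatMap (φ : κ → EuclideanSpace ℝ (Fin N)) :
    EuclideanSpace ℝ κ →L[ℝ] EuclideanSpace ℝ κ :=
  (LinearMap.range (predictionMap φ)).starProjection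

theorem hatMap_idem (φ : κ → EuclideanSpace ℝ (Fin N)) (v : EuclideanSpace ℝ κ) :
    hatMap φ (hatMap φ v) = hatMap φ v :=
  Submodule.starProjection_eq_self_iff.2 (Submodule.starProjection_apply_mem _ _)

variable [DecidableEq κ]

/-- The entries of the hat matrix of the design `φ`. -/
noncomputable def hatEntry (φ : κ → EuclideanSpace ℝ (Fin N)) (k i : κ) : ℝ :=
  hatMap φ (EuclideanSpace.single i 1) k

variable (φ : κ → EuclideanSpace ℝ (Fin N))

theorem hatEntry_eq_inner (k i : κ) :
    hatEntry φ k i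
      = inner ℝ (EuclideanSpace.single k (1 : ℝ)) (hatMap φ (EuclideanSpace.single i 1)) := by
  rw [EuclideanSpace.inner_single_left]
  simp [hatEntry]

theorem hatEntry_comm (k i : κ) : hatEntry φ k i = hatEntry φ i k := by
  rw [hatEntry_eq_inner, hatEntry_eq_inner, hatMap, ← Submodule.inner_starProjection_left_eq_right,
    real_inner_comm]

theorem hatEntry_eq_inner_hatMap (k i : κ) : hatEntry φ k i
    = inner ℝ (hatMap φ (EuclideanSpace.single k 1)) (hatMap φ (EuclideanSpace.single i 1)) := by
  rw [hatEntry_eq_inner]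
  conv_lhs => rw [← hatMap_idem, hatMap, ← Submodule.inner_starProjection_left_eq_right]
  rfl

theorem hatMap_apply (v : EuclideanSpace ℝ κ) (k : κ) :
    hatMap φ v k = ∑ i, hatEntry φ k i * v i := by
  have h : v = ∑ i, v i • EuclideanSpace.single i (1 : ℝ) := by
    ext j
    simp [Finset.sum_apply, Pi.single_apply]
  conv_lhs => rw [h, map_sum]
  simp [hatEntry, mul_comm]

theorem hatEntry_self_eq_norm_sq (k : κ) :
    hatEntry φ k k = ‖hatMap φ (EuclideanSpace.single k 1)‖ ^ 2 := by
  rw [hatEntry_eq_inner_hatMap, real_inner_self_eq_norm_sq]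

theorem sum_hatEntry_sq (k : κ) : ∑ i, hatEntry φ k i ^ 2 = hatEntry φ k k := by
  rw [hatEntry_self_eq_norm_sq, EuclideanSpace.real_norm_sq_eq]
  exact Finset.sum_congr rfl fun i _ => by rw [hatEntry_comm]; rfl

theorem hatEntry_self_nonneg (k : κ) : 0 ≤ hatEntry φ k k := by
  rw [hatEntry_self_eq_norm_sq]; positivity

theorem sum_hatEntry_self_le : ∑ k, hatEntry φ k k ≤ N := by
  set U := LinearMap.range (predictionMap φ) with hU
  have hproj : LinearMap.IsProj U (hatMap φ : EuclideanSpace ℝ κ →ₗ[ℝ] EuclideanSpace ℝ κ) :=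
    ⟨fun x => Submodule.starProjection_apply_mem _ _,
      fun x hx => Submodule.starProjection_eq_self_iff.2 hx⟩
  have h1 := hproj.trace
  rw [LinearMap.trace_eq_sum_inner _ (EuclideanSpace.basisFun κ ℝ)] at h1
  have h2 : ∑ k, hatEntry φ k k = (Module.finrank ℝ U : ℝ) := by
    rw [← h1]
    exact Finset.sum_congr rfl fun k _ => by rw [hatEntry_eq_inner]; simp
  rw [h2]
  have h3 := LinearMap.finrank_range_le (predictionMap φ)
  rw [finrank_euclideanSpace_fin] at h3
  exact_mod_cast h3

/-- The residual of the projection is the least mean square error. -/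
theorem sum_hatMap_sub_sq_le (v : κ → ℝ) (w : EuclideanSpace ℝ (Fin N)) :
    ∑ k, (∑ i, hatEntry φ k i * v i - v k) ^ 2 ≤ ∑ k, (inner ℝ w (φ k) - v k) ^ 2 := by
  set V : EuclideanSpace ℝ κ := WithLp.toLp 2 v with hV
  have h1 : ‖V - hatMap φ V‖ ≤ ‖V - predictionMap φ w‖ := by
    rw [hatMap, Submodule.starProjection_minimal]
    exact ciInf_le (f := fun x : LinearMap.range (predictionMap φ) => ‖V - x‖)
      ⟨0, Set.forall_mem_range.mpr fun _ => norm_nonneg _⟩ ⟨_, LinearMap.mem_range_self _ w⟩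
  have h2 := pow_le_pow_left₀ (norm_nonneg _) h1 2
  rw [EuclideanSpace.real_norm_sq_eq, EuclideanSpace.real_norm_sq_eq] at h2
  calc ∑ k, (∑ i, hatEntry φ k i * v i - v k) ^ 2 = ∑ k, ((V - hatMap φ V) k) ^ 2 := by
        refine Finset.sum_congr rfl fun k _ => ?_
        rw [PiLp.sub_apply, hatMap_apply, sub_sq_comm]
    _ ≤ ∑ k, ((V - predictionMap φ w) k) ^ 2 := h2
    _ = _ := by
        refine Finset.sum_congr rfl fun k _ => ?_
        rw [PiLp.sub_apply, predictionMap_apply, sub_sq_comm]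

/-- Leave-one-out formula: if `w` is a least squares fit to all points but the `k`-th, then its
predictions are the projection of the responses in which the `k`-th one is replaced by the
prediction itself. -/
theorem one_sub_hatEntry_mul_prediction {y : κ → ℝ} {k : κ} {w : EuclideanSpace ℝ (Fin N)}
    (hw : ∀ w' : EuclideanSpace ℝ (Fin N), ∑ i ∈ Finset.univ.erase k, (inner ℝ w (φ i) - y i) ^ 2
      ≤ ∑ i ∈ Finset.univ.erase k, (inner ℝ w' (φ i) - y i) ^ 2) :
    (1 - hatEntry φ k k) * inner ℝ w (φ k)
      = ∑ i ∈ Finset.univ.erase k, hatEntry φ k i * y i := by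
  -- the normal equations
  have hnormal : ∀ w' : EuclideanSpace ℝ (Fin N),
      ∑ i ∈ Finset.univ.erase k, (inner ℝ w (φ i) - y i) * inner ℝ w' (φ i) = 0 := by
    intro w'
    set A := ∑ i ∈ Finset.univ.erase k, (inner ℝ w (φ i) - y i) * inner ℝ w' (φ i) with hA
    set B := ∑ i ∈ Finset.univ.erase k, (inner ℝ w' (φ i)) ^ 2 with hB
    have hB0 : 0 ≤ B := Finset.sum_nonneg fun _ _ => sq_nonneg _
    have hq : ∀ t : ℝ, 0 ≤ 2 * t * A + t ^ 2 * B := by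
      intro t
      have h1 := hw (w + t • w')
      have h2 : ∑ i ∈ Finset.univ.erase k, (inner ℝ (w + t • w') (φ i) - y i) ^ 2
          = ∑ i ∈ Finset.univ.erase k, (inner ℝ w (φ i) - y i) ^ 2 + (2 * t * A + t ^ 2 * B) := by
        rw [hA, hB, Finset.mul_sum, Finset.mul_sum, ← Finset.sum_add_distrib,
          ← Finset.sum_add_distrib]
        refine Finset.sum_congr rfl fun i _ => ?_
        rw [inner_add_left, real_inner_smul_left]
        ring
      linarith
    have h1 := hq (-A / (B + 1))
    have h2 : 2 * (-A / (B + 1)) * A + (-A / (B + 1)) ^ 2 * B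
        = -(A ^ 2 * (B + 2)) / (B + 1) ^ 2 := by
      field_simp
      ring
    rw [h2, div_nonneg_iff] at h1
    rcases h1 with ⟨h1, -⟩ | ⟨-, h1⟩
    · by_contra hne
      have : 0 < A ^ 2 := by positivity
      nlinarith
    · nlinarith [sq_nonneg (B + 1)]
  set u := predictionMap φ w with hu
  set z : EuclideanSpace ℝ κ := WithLp.toLp 2 (Function.update y k (inner ℝ w (φ k))) with hz
  have hzk : z k = inner ℝ w (φ k) := by simp [hz]
  have hzi : ∀ i, i ≠ k → z i = y i := fun i hi => by simp [hz, hi]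
  have hPz : hatMap φ z = u := by
    refine Submodule.eq_starProjection_of_mem_of_inner_eq_zero (LinearMap.mem_range_self _ w) ?_
    rintro _ ⟨w', rfl⟩
    have h1 : inner ℝ (z - u) (predictionMap φ w') = ∑ i, (z i - u i) * inner ℝ w' (φ i) := by
      rw [PiLp.inner_apply]
      exact Finset.sum_congr rfl fun i _ => by
        rw [real_inner_comm, real_inner_eq_re_inner]; simp [predictionMap_apply]
    rw [h1, ← Finset.add_sum_erase _ _ (Finset.mem_univ k), hzk, hu, predictionMap_apply, sub_self,
      zero_mul, zero_add]
    have h2 := hnormal w'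
    rw [← neg_eq_zero, ← Finset.sum_neg_distrib] at h2
    rw [← h2]
    refine Finset.sum_congr rfl fun i hi => ?_
    rw [hzi i (Finset.ne_of_mem_erase hi), predictionMap_apply]
    ring
  have h1 : hatMap φ z k = inner ℝ w (φ k) := by rw [hPz]; rfl
  rw [hatMap_apply, ← Finset.add_sum_erase _ _ (Finset.mem_univ k), hzk] at h1
  have h2 : ∑ i ∈ Finset.univ.erase k, hatEntry φ k i * z i
      = ∑ i ∈ Finset.univ.erase k, hatEntry φ k i * y i :=
    Finset.sum_congr rfl fun i hi => by rw [hzi i (Finset.ne_of_mem_erase hi)]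
  rw [h2] at h1
  linarith

theorem truncate_sub_sq_le {M h u : ℝ} (hh : 0 ≤ h ∧ h ≤ M) :
    (h - truncate M u) ^ 2 ≤ (h - u) ^ 2 ∧ (h - truncate M u) ^ 2 ≤ 4 * M ^ 2 := by
  have hM : 0 ≤ M := hh.1.trans hh.2
  unfold truncate
  rcases le_total u M with h1 | h1
  · rw [min_eq_left h1]
    rcases le_total u (-M) with h2 | h2
    · rw [max_eq_right h2]
      exact ⟨by nlinarith, by nlinarith⟩
    · rw [max_eq_left h2]
      exact ⟨le_rfl, by nlinarith⟩
  · rw [min_eq_right h1, max_eq_left (by linarith)]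
    exact ⟨by nlinarith, by nlinarith⟩

/-- The truncated prediction at a left-out point. If the leverage of that point is at least `1/2`,
truncation alone suffices; otherwise the leave-one-out formula costs at most a factor `4`. -/
theorem truncated_leaveOneOut_le {h e : κ → ℝ} {k : κ} {M : ℝ} (hM : 0 ≤ h k ∧ h k ≤ M)
    {w : EuclideanSpace ℝ (Fin N)}
    (hw : ∀ w' : EuclideanSpace ℝ (Fin N),
      ∑ i ∈ Finset.univ.erase k, (inner ℝ w (φ i) - (h i + e i)) ^ 2
      ≤ ∑ i ∈ Finset.univ.erase k, (inner ℝ w' (φ i) - (h i + e i)) ^ 2) :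
    (h k - truncate M (inner ℝ w (φ k))) ^ 2 ≤ 8 * M ^ 2 * hatEntry φ k k
      + 8 * (∑ i, hatEntry φ k i * h i - h k) ^ 2
      + 8 * (∑ i ∈ Finset.univ.erase k, hatEntry φ k i * e i) ^ 2 := by
  obtain ⟨h1, h2⟩ := truncate_sub_sq_le (u := inner ℝ w (φ k)) hM
  have hH := hatEntry_self_nonneg φ k
  set H := hatEntry φ k k with hHdef
  set p := ∑ i, hatEntry φ k i * h i - h k with hp
  set q := ∑ i ∈ Finset.univ.erase k, hatEntry φ k i * e i with hq
  rcases le_total (1 / 2) H with hc | hc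
  · have : 4 * M ^ 2 ≤ 8 * M ^ 2 * H := by nlinarith [sq_nonneg M]
    nlinarith [sq_nonneg p, sq_nonneg q]
  · have h3 := one_sub_hatEntry_mul_prediction φ (y := fun i => h i + e i) hw
    have h4 : (1 - H) * (inner ℝ w (φ k) - h k) = p + q := by
      have h5 : ∑ i, hatEntry φ k i * h i
          = H * h k + ∑ i ∈ Finset.univ.erase k, hatEntry φ k i * h i :=
        (Finset.add_sum_erase _ _ (Finset.mem_univ k)).symm
      simp only [mul_add, Finset.sum_add_distrib] at h3
      rw [hp, h5]
      linarith
    have h6 : (h k - inner ℝ w (φ k)) ^ 2 ≤ 4 * (p + q) ^ 2 := by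
      rw [← h4, mul_pow, sub_sq_comm]
      have : 1 ≤ 4 * (1 - H) ^ 2 := by nlinarith
      nlinarith [sq_nonneg (inner ℝ w (φ k) - h k)]
    have h7 : 0 ≤ 8 * M ^ 2 * H := by positivity
    nlinarith [sq_nonneg (p - q)]

/-- Permuting the design points permutes the rows and columns of the hat matrix. -/
theorem hatEntry_comp_equiv (σ : Equiv.Perm κ) (k i : κ) :
    hatEntry (fun j => φ (σ j)) k i = hatEntry φ (σ k) (σ i) := by
  set v : EuclideanSpace ℝ κ := hatMap φ (EuclideanSpace.single (σ i) 1) with hv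
  have hmem : v ∈ LinearMap.range (predictionMap φ) := Submodule.starProjection_apply_mem _ _
  obtain ⟨w, hw⟩ := hmem
  have h1 : hatMap (fun j => φ (σ j)) (EuclideanSpace.single i 1)
      = predictionMap (fun j => φ (σ j)) w := by
    refine Submodule.eq_starProjection_of_mem_of_inner_eq_zero (LinearMap.mem_range_self _ w) ?_
    rintro _ ⟨w', rfl⟩
    have h2 := Submodule.starProjection_inner_eq_zero (K := LinearMap.range (predictionMap φ))
      (EuclideanSpace.single (σ i) (1 : ℝ)) _ (LinearMap.mem_range_self _ w')
    rw [← h2]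
    change _ = inner ℝ (EuclideanSpace.single (σ i) (1 : ℝ) - v) _
    rw [← hw, PiLp.inner_apply, PiLp.inner_apply]
    refine Fintype.sum_equiv σ _ _ fun j => ?_
    simp [predictionMap_apply]
  rw [hatEntry, h1, hatEntry, ← hv, ← hw]
  rfl

theorem measurable_hatEntry (k i : κ) :
    Measurable fun φ : κ → EuclideanSpace ℝ (Fin N) => hatEntry φ k i := by
  -- distances to the space of predictions are infima over a countable dense set of weights
  have hdist : ∀ v : EuclideanSpace ℝ κ,
      Measurable fun φ : κ → EuclideanSpace ℝ (Fin N) => ‖v - hatMap φ v‖ := by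
    intro v
    refine measurable_of_Iio fun r => ?_
    have hset : (fun φ : κ → EuclideanSpace ℝ (Fin N) => ‖v - hatMap φ v‖) ⁻¹' Set.Iio r
        = ⋃ m : ℕ, {φ | ‖v - predictionMap φ (TopologicalSpace.denseSeq _ m)‖ < r} := by
      ext φ
      simp only [Set.mem_preimage, Set.mem_Iio, Set.mem_iUnion, Set.mem_ofPred_eq]
      constructor
      · intro hlt
        obtain ⟨w, hw⟩ : hatMap φ v ∈ LinearMap.range (predictionMap φ) :=
          Submodule.starProjection_apply_mem _ _
        have hcont : Continuous fun w => ‖v - predictionMap φ w‖ :=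
          (continuous_const.sub (predictionMap φ).continuous_of_finiteDimensional).norm
        have hopen : IsOpen {w | ‖v - predictionMap φ w‖ < r} :=
          isOpen_lt hcont continuous_const
        obtain ⟨_, hmem, m, rfl⟩ := (TopologicalSpace.denseRange_denseSeq
          (EuclideanSpace ℝ (Fin N))).exists_mem_open hopen
            ⟨w, by rw [Set.mem_ofPred_eq, hw]; exact hlt⟩ |>.elim
            fun m hm => (⟨_, hm, m, rfl⟩ : ∃ w ∈ {w | ‖v - predictionMap φ w‖ < r},
              ∃ m, TopologicalSpace.denseSeq _ m = w)
        exact ⟨m, hmem⟩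
      · rintro ⟨m, hm⟩
        refine lt_of_le_of_lt ?_ hm
        rw [hatMap, Submodule.starProjection_minimal]
        exact ciInf_le (f := fun x : LinearMap.range (predictionMap φ) => ‖v - x‖)
          ⟨0, Set.forall_mem_range.mpr fun _ => norm_nonneg _⟩ ⟨_, LinearMap.mem_range_self _ _⟩
    rw [hset]
    refine MeasurableSet.iUnion fun m => ?_
    have hcont : Continuous fun φ : κ → EuclideanSpace ℝ (Fin N) =>
        ‖v - predictionMap φ (TopologicalSpace.denseSeq _ m)‖ := by
      refine (continuous_const.sub ?_).norm
      refine (PiLp.continuous_toLp 2 _).comp (continuous_pi fun j => ?_)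
      exact continuous_const.inner (continuous_apply j)
    exact (isOpen_lt hcont continuous_const).measurableSet
  -- the entries are recovered from these distances by Pythagoras and polarization
  have hpol : ∀ φ : κ → EuclideanSpace ℝ (Fin N), hatEntry φ k i
      = ((‖(EuclideanSpace.single k (1 : ℝ) + EuclideanSpace.single i 1 : EuclideanSpace ℝ κ)‖ ^ 2
          - ‖(EuclideanSpace.single k (1 : ℝ) + EuclideanSpace.single i 1 : EuclideanSpace ℝ κ)
            - hatMap φ (EuclideanSpace.single k (1 : ℝ) + EuclideanSpace.single i 1)‖ ^ 2)
        - (‖(EuclideanSpace.single k (1 : ℝ) - EuclideanSpace.single i 1 : EuclideanSpace ℝ κ)‖ ^ 2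
          - ‖(EuclideanSpace.single k (1 : ℝ) - EuclideanSpace.single i 1 : EuclideanSpace ℝ κ)
            - hatMap φ (EuclideanSpace.single k (1 : ℝ) - EuclideanSpace.single i 1)‖ ^ 2)) / 4 := by
    intro φ
    have hpyth : ∀ v : EuclideanSpace ℝ κ, ‖v‖ ^ 2 - ‖v - hatMap φ v‖ ^ 2 = ‖hatMap φ v‖ ^ 2 := by
      intro v
      have h1 : inner ℝ (v - hatMap φ v) (hatMap φ v) = 0 :=
        Submodule.starProjection_inner_eq_zero _ _ (Submodule.starProjection_apply_mem _ _)
      have h2 := norm_add_sq_real (v - hatMap φ v) (hatMap φ v)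
      rw [sub_add_cancel, h1] at h2
      linarith
    rw [hpyth, hpyth, map_add, map_sub, norm_add_sq_real, norm_sub_sq_real,
      hatEntry_eq_inner_hatMap]
    ring
  simp_rw [hpol]
  exact (((measurable_const.sub ((hdist _).pow_const 2)).sub
    (measurable_const.sub ((hdist _).pow_const 2))).div_const 4)

end LeaveOneOut

/-! ### A leave-one-out bound for truncated least squares -/

/-- Functions of an i.i.d. sample that are permuted along with the sample points have equal
expectations. -/
theorem card_mul_lintegral_eq_of_equivariant {κ E : Type*} [Fintype κ] [DecidableEq κ]
    [MeasurableSpace E] {μ : Measure E} [IsProbabilityMeasure μ] {q : κ → (κ → E) → ENNReal}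
    (hm : ∀ k, Measurable (q k)) (hq : ∀ (σ : Equiv.Perm κ) k x, q k (fun j => x (σ j)) = q (σ k) x)
    (k₀ : κ) :
    Fintype.card κ * ∫⁻ x, q k₀ x ∂(Measure.pi fun _ : κ => μ)
      = ∫⁻ x, ∑ k, q k x ∂(Measure.pi fun _ : κ => μ) := by
  rw [lintegral_finsetSum _ fun k _ => hm k]
  have h1 : ∀ k, ∫⁻ x, q k x ∂(Measure.pi fun _ : κ => μ)
      = ∫⁻ x, q k₀ x ∂(Measure.pi fun _ : κ => μ) := by
    intro k
    have hp := measurePreserving_arrowCongr' (fun _ : κ => μ) (fun _ : κ => μ) (Equiv.swap k₀ k)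
      (MeasurableEquiv.refl E) fun _ => MeasurePreserving.id μ
    rw [← hp.lintegral_comp (hm k₀)]
    refine lintegral_congr fun x => ?_
    have h2 := hq (Equiv.swap k₀ k) k₀ x
    rw [Equiv.swap_apply_left] at h2
    rw [← h2]
    congr 1
  simp_rw [h1]
  rw [Finset.sum_const, Finset.card_univ, nsmul_eq_mul]

section

variable {N n : ℕ}

theorem sum_erase_none (f : Option (Fin n) → ℝ) :
    ∑ i ∈ Finset.univ.erase none, f i = ∑ i : Fin n, f (some i) := by
  have h1 := Finset.add_sum_erase Finset.univ f (Finset.mem_univ none)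
  have h2 := Fintype.sum_option f
  linarith

/-- The features at all points of a sample. -/
noncomputable def designFeatures {κ : Type*} (u : Fin N → ℝ × ℝ) (x : κ → ℝ) (k : κ) :
    EuclideanSpace ℝ (Fin N) :=
  features (fun j => (u j).1) (fun j => (u j).2) (x k)

theorem measurable_designFeatures {κ : Type*} :
    Measurable fun p : (Fin N → ℝ × ℝ) × (κ → ℝ) => designFeatures p.1 p.2 := by
  refine measurable_pi_lambda _ fun k => ?_
  refine (PiLp.continuous_toLp 2 _).measurable.comp (measurable_pi_lambda _ fun j => ?_)
  have h1 : Measurable fun p : (Fin N → ℝ × ℝ) × (κ → ℝ) => p.1 j :=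
    (measurable_pi_apply j).comp measurable_fst
  exact measurable_relu.comp
    ((h1.fst.mul ((measurable_pi_apply k).comp measurable_snd)).add h1.snd)

/-- The leave-one-out bound for the squared error of the truncated least squares estimator at the
test point `x none`, after fitting to the points `x (some i)` with noise `e i`. -/
noncomputable def leaveOneOutBound (M : ℝ) (h : ℝ → ℝ) (u : Fin N → ℝ × ℝ)
    (x : Option (Fin n) → ℝ) (e : Fin n → ℝ) : ℝ :=
  8 * M ^ 2 * hatEntry (designFeatures u x) none none
    + 8 * (∑ i, hatEntry (designFeatures u x) none i * h (x i) - h (x none)) ^ 2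
    + 8 * (∑ i : Fin n, hatEntry (designFeatures u x) none (some i) * e i) ^ 2

theorem sq_sub_truncate_le_leaveOneOutBound {M : ℝ} {h : ℝ → ℝ} (u : Fin N → ℝ × ℝ)
    (x : Option (Fin n) → ℝ) (e : Fin n → ℝ) (hn : 0 < n)
    (hM : 0 ≤ h (x none) ∧ h (x none) ≤ M) {w : EuclideanSpace ℝ (Fin N)}
    (hw : ∀ w', empiricalRisk (fun j => (u j).1) (fun j => (u j).2) (fun i => x (some i))
        (fun i => h (x (some i)) + e i) w
      ≤ empiricalRisk (fun j => (u j).1) (fun j => (u j).2) (fun i => x (some i))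
        (fun i => h (x (some i)) + e i) w') :
    (h (x none) - truncate M (network (fun j => (u j).1) (fun j => (u j).2) w (x none))) ^ 2
      ≤ leaveOneOutBound M h u x e := by
  have hn' : (0 : ℝ) < 1 / (n : ℝ) := by positivity
  have h1 := truncated_leaveOneOut_le (designFeatures u x) (h := fun i => h (x i))
    (e := fun i => i.elim 0 e) (k := none) hM (w := w) fun w' => by
      rw [sum_erase_none, sum_erase_none]
      have := le_of_mul_le_mul_left (hw w') hn'
      simp only [network_eq_inner] at this
      exact this
  rw [sum_erase_none] at h1
  rw [network_eq_inner]
  exact h1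

theorem measurable_leaveOneOutBound {M : ℝ} {h : ℝ → ℝ} (hh : Measurable h) :
    Measurable fun p : (Fin N → ℝ × ℝ) × ((Option (Fin n) → ℝ) × (Fin n → ℝ)) =>
      leaveOneOutBound M h p.1 p.2.1 p.2.2 := by
  have h1 : ∀ k i, Measurable fun p : (Fin N → ℝ × ℝ) × ((Option (Fin n) → ℝ) × (Fin n → ℝ)) =>
      hatEntry (designFeatures p.1 p.2.1) k i := fun k i => by
    have hd : Measurable fun p : (Fin N → ℝ × ℝ) × ((Option (Fin n) → ℝ) × (Fin n → ℝ)) =>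
        designFeatures p.1 p.2.1 :=
      measurable_designFeatures.comp (measurable_fst.prodMk measurable_snd.fst)
    exact (measurable_hatEntry k i).comp hd
  have h2 : ∀ i, Measurable fun p : (Fin N → ℝ × ℝ) × ((Option (Fin n) → ℝ) × (Fin n → ℝ)) =>
      h (p.2.1 i) := fun i => hh.comp ((measurable_pi_apply i).comp measurable_snd.fst)
  have h3 : ∀ i, Measurable fun p : (Fin N → ℝ × ℝ) × ((Option (Fin n) → ℝ) × (Fin n → ℝ)) =>
      p.2.2 i := fun i => (measurable_pi_apply i).comp measurable_snd.snd
  refine Measurable.add (Measurable.add ((h1 _ _).const_mul _) (Measurable.const_mul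
    (Measurable.pow_const (Measurable.sub ?_ (h2 _)) 2) _))
    (Measurable.const_mul (Measurable.pow_const ?_ 2) _)
  · exact Finset.measurable_fun_sum _ fun i _ => (h1 _ i).mul (h2 i)
  · exact Finset.measurable_fun_sum _ fun i _ => (h1 _ _).mul (h3 i)

/-- The expectation of the leave-one-out bound for fixed hidden weights. By exchangeability the
leverages average to at most `N/(n+1)`. -/
theorem lintegral_leaveOneOutBound_le {μX με : Measure ℝ} [IsProbabilityMeasure μX]
    [IsProbabilityMeasure με] {M : ℝ} {h : ℝ → ℝ} (hh : Measurable h) (hn : 0 < n)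
    (hε : MemLp (fun e : ℝ => e) 2 με) (hε0 : ∫ e, e ∂με = 0) (u : Fin N → ℝ × ℝ)
    (w : EuclideanSpace ℝ (Fin N)) :
    ∫⁻ p, ENNReal.ofReal (leaveOneOutBound M h u p.1 p.2)
        ∂((Measure.pi fun _ : Option (Fin n) => μX).prod (Measure.pi fun _ : Fin n => με))
      ≤ ENNReal.ofReal (8 * (M ^ 2 + ∫ e, e ^ 2 ∂με) * N / n)
        + 8 * ∫⁻ z, ENNReal.ofReal
          ((h z - network (fun j => (u j).1) (fun j => (u j).2) w z) ^ 2) ∂μX := by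
  have hn' : (0 : ℝ) < n := by positivity
  have hσ : 0 ≤ ∫ e, e ^ 2 ∂με := integral_nonneg fun _ => sq_nonneg _
  set s := ∫ e, e ^ 2 ∂με with hs
  have hφ : Measurable fun x : Option (Fin n) → ℝ => designFeatures u x :=
    measurable_designFeatures.comp measurable_prodMk_left
  have hH : ∀ k i, Measurable fun x : Option (Fin n) → ℝ => hatEntry (designFeatures u x) k i :=
    fun k i => (measurable_hatEntry k i).comp hφ
  have hhx : ∀ i, Measurable fun x : Option (Fin n) → ℝ => h (x i) := fun i =>
    hh.comp (measurable_pi_apply i)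
  have hperm : ∀ (σ : Equiv.Perm (Option (Fin n))) (x : Option (Fin n) → ℝ) k i,
      hatEntry (designFeatures u fun j => x (σ j)) k i
        = hatEntry (designFeatures u x) (σ k) (σ i) := fun σ x k i =>
    hatEntry_comp_equiv (designFeatures u x) σ k i
  have hcard : ((Fintype.card (Option (Fin n)) : ℕ) : ENNReal) = ENNReal.ofReal ((n : ℝ) + 1) := by
    rw [Fintype.card_option, Fintype.card_fin, ← ENNReal.ofReal_natCast]
    push_cast
    rfl
  have hcard0 : ENNReal.ofReal ((n : ℝ) + 1) ≠ 0 := by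
    rw [Ne, ENNReal.ofReal_eq_zero, not_le]; positivity
  -- the leverage
  have hlev : ∫⁻ x, ENNReal.ofReal (hatEntry (designFeatures u x) none none)
      ∂(Measure.pi fun _ : Option (Fin n) => μX) ≤ ENNReal.ofReal (N / n) := by
    have h1 := card_mul_lintegral_eq_of_equivariant (μ := μX)
      (q := fun k (x : Option (Fin n) → ℝ) => ENNReal.ofReal (hatEntry (designFeatures u x) k k))
      (fun k => (hH k k).ennreal_ofReal) (fun σ k x => by rw [hperm]) none
    have h2 : ∫⁻ x, ∑ k, ENNReal.ofReal (hatEntry (designFeatures u x) k k)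
        ∂(Measure.pi fun _ : Option (Fin n) => μX) ≤ ENNReal.ofReal N := by
      calc ∫⁻ x, ∑ k, ENNReal.ofReal (hatEntry (designFeatures u x) k k)
            ∂(Measure.pi fun _ : Option (Fin n) => μX)
          ≤ ∫⁻ _x, ENNReal.ofReal N ∂(Measure.pi fun _ : Option (Fin n) => μX) := by
            refine lintegral_mono fun x => ?_
            simp only
            rw [← ENNReal.ofReal_sum_of_nonneg fun k _ => hatEntry_self_nonneg _ k]
            exact ENNReal.ofReal_le_ofReal (sum_hatEntry_self_le _)
        _ = _ := by simp
    rw [← h1, hcard, mul_comm, ← ENNReal.le_div_iff_mul_le (Or.inl hcard0)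
      (Or.inl ENNReal.ofReal_ne_top), ← ENNReal.ofReal_div_of_pos (by positivity)] at h2
    refine h2.trans (ENNReal.ofReal_le_ofReal ?_)
    exact div_le_div_of_nonneg_left (Nat.cast_nonneg N) hn' (by linarith)
  -- the residual of the projection
  have hrm : Measurable fun x : Option (Fin n) → ℝ => ENNReal.ofReal
      ((∑ i, hatEntry (designFeatures u x) none i * h (x i) - h (x none)) ^ 2) :=
    (((Finset.measurable_fun_sum _ fun i _ => (hH none i).mul (hhx i)).sub (hhx none)).pow_const
      2).ennreal_ofReal
  have hres : ∫⁻ x, ENNReal.ofReal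
      ((∑ i, hatEntry (designFeatures u x) none i * h (x i) - h (x none)) ^ 2)
        ∂(Measure.pi fun _ : Option (Fin n) => μX)
      ≤ ∫⁻ z, ENNReal.ofReal
          ((h z - network (fun j => (u j).1) (fun j => (u j).2) w z) ^ 2) ∂μX := by
    have h1 := card_mul_lintegral_eq_of_equivariant (μ := μX)
      (q := fun k (x : Option (Fin n) → ℝ) => ENNReal.ofReal
        ((∑ i, hatEntry (designFeatures u x) k i * h (x i) - h (x k)) ^ 2))
      (fun k => (((Finset.measurable_fun_sum _ fun i _ => (hH k i).mul (hhx i)).sub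
        (hhx k)).pow_const 2).ennreal_ofReal)
      (fun σ k x => by
        simp only [hperm]
        rw [Equiv.sum_comp σ fun i => hatEntry (designFeatures u x) (σ k) i * h (x i)]) none
    have hnet : Measurable fun z => ENNReal.ofReal
        ((h z - network (fun j => (u j).1) (fun j => (u j).2) w z) ^ 2) := by
      refine ((hh.sub (Finset.measurable_fun_sum _ fun j _ => ?_)).pow_const 2).ennreal_ofReal
      exact (measurable_relu.comp ((measurable_id.const_mul _).add_const _)).const_mul _
    have h2 : ∫⁻ x, ∑ k, ENNReal.ofReal
          ((∑ i, hatEntry (designFeatures u x) k i * h (x i) - h (x k)) ^ 2)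
          ∂(Measure.pi fun _ : Option (Fin n) => μX)
        ≤ ENNReal.ofReal ((n : ℝ) + 1) * ∫⁻ z, ENNReal.ofReal
          ((h z - network (fun j => (u j).1) (fun j => (u j).2) w z) ^ 2) ∂μX := by
      calc ∫⁻ x, ∑ k, ENNReal.ofReal
              ((∑ i, hatEntry (designFeatures u x) k i * h (x i) - h (x k)) ^ 2)
              ∂(Measure.pi fun _ : Option (Fin n) => μX)
          ≤ ∫⁻ x, ∑ k, ENNReal.ofReal
              ((h (x k) - network (fun j => (u j).1) (fun j => (u j).2) w (x k)) ^ 2)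
              ∂(Measure.pi fun _ : Option (Fin n) => μX) := by
            refine lintegral_mono fun x => ?_
            simp only
            rw [← ENNReal.ofReal_sum_of_nonneg fun k _ => sq_nonneg _,
              ← ENNReal.ofReal_sum_of_nonneg fun k _ => sq_nonneg _]
            refine ENNReal.ofReal_le_ofReal ?_
            refine (sum_hatMap_sub_sq_le (designFeatures u x) (fun i => h (x i)) w).trans
              (le_of_eq (Finset.sum_congr rfl fun k _ => ?_))
            rw [network_eq_inner, sub_sq_comm]
            rfl
        _ = _ := by
            have hnetk : ∀ k, Measurable fun x : Option (Fin n) → ℝ => ENNReal.ofReal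
                ((h (x k) - network (fun j => (u j).1) (fun j => (u j).2) w (x k)) ^ 2) :=
              fun k => hnet.comp (measurable_pi_apply k)
            rw [lintegral_finsetSum _ fun k _ => hnetk k]
            have h3 : ∀ k : Option (Fin n), ∫⁻ x, ENNReal.ofReal
                ((h (x k) - network (fun j => (u j).1) (fun j => (u j).2) w (x k)) ^ 2)
                ∂(Measure.pi fun _ : Option (Fin n) => μX)
                = ∫⁻ z, ENNReal.ofReal
                  ((h z - network (fun j => (u j).1) (fun j => (u j).2) w z) ^ 2) ∂μX := fun k =>
              (measurePreserving_eval (fun _ : Option (Fin n) => μX) k).lintegral_comp hnet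
            rw [Finset.sum_congr rfl fun k _ => h3 k, Finset.sum_const, Finset.card_univ,
              nsmul_eq_mul, hcard]
    rw [← h1, hcard] at h2
    exact (ENNReal.mul_le_mul_iff_right hcard0 ENNReal.ofReal_ne_top).1 h2
  -- the noise
  have hnoise : ∀ x : Option (Fin n) → ℝ, ∫⁻ e, ENNReal.ofReal
      ((∑ i : Fin n, hatEntry (designFeatures u x) none (some i) * e i) ^ 2)
        ∂(Measure.pi fun _ : Fin n => με)
      ≤ ENNReal.ofReal s
        * ENNReal.ofReal (hatEntry (designFeatures u x) none none) := by
    intro x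
    rw [lintegral_sq_sum_pi (f := fun i e => hatEntry (designFeatures u x) none (some i) * e)
      (fun i => hε.const_mul _) (fun i => by rw [integral_const_mul, hε0, mul_zero]),
      ← ENNReal.ofReal_mul hσ]
    refine ENNReal.ofReal_le_ofReal ?_
    simp_rw [mul_pow, integral_const_mul]
    rw [← Finset.sum_mul, mul_comm]
    refine mul_le_mul_of_nonneg_left ?_ hσ
    rw [← sum_hatEntry_sq, Fintype.sum_option]
    linarith [sq_nonneg (hatEntry (designFeatures u x) none none)]
  have h8 : (8 : ENNReal) = ENNReal.ofReal 8 := by simp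
  have hbm : Measurable fun p : (Option (Fin n) → ℝ) × (Fin n → ℝ) =>
      ENNReal.ofReal (leaveOneOutBound M h u p.1 p.2) :=
    ((measurable_leaveOneOutBound hh).comp measurable_prodMk_left).ennreal_ofReal
  rw [lintegral_prod _ hbm.aemeasurable]
  calc ∫⁻ x, ∫⁻ e, ENNReal.ofReal (leaveOneOutBound M h u x e) ∂(Measure.pi fun _ : Fin n => με)
          ∂(Measure.pi fun _ : Option (Fin n) => μX)
      ≤ ∫⁻ x, (ENNReal.ofReal (8 * (M ^ 2 + s))
            * ENNReal.ofReal (hatEntry (designFeatures u x) none none)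
          + 8 * ENNReal.ofReal
            ((∑ i, hatEntry (designFeatures u x) none i * h (x i) - h (x none)) ^ 2))
          ∂(Measure.pi fun _ : Option (Fin n) => μX) := by
        refine lintegral_mono fun x => ?_
        simp only
        set H := hatEntry (designFeatures u x) none none with hHd
        have hH0 : 0 ≤ H := hatEntry_self_nonneg _ _
        set R := (∑ i, hatEntry (designFeatures u x) none i * h (x i) - h (x none)) ^ 2 with hR
        have hR0 : 0 ≤ R := sq_nonneg _
        have h1 : ∀ e : Fin n → ℝ, ENNReal.ofReal (leaveOneOutBound M h u x e)
            = ENNReal.ofReal (8 * M ^ 2 * H + 8 * R) + 8 * ENNReal.ofReal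
              ((∑ i : Fin n, hatEntry (designFeatures u x) none (some i) * e i) ^ 2) := fun e => by
          rw [h8, ← ENNReal.ofReal_mul (by norm_num), ← ENNReal.ofReal_add (by positivity)
            (by positivity)]
          rfl
        simp_rw [h1]
        rw [lintegral_add_left measurable_const, lintegral_const, measure_univ, mul_one,
          lintegral_const_mul' _ _ (by simp)]
        refine (add_le_add_right (mul_le_mul_right (hnoise x) _) _).trans (le_of_eq ?_)
        rw [h8, ← ENNReal.ofReal_mul hσ, ← ENNReal.ofReal_mul (by positivity),
          ← ENNReal.ofReal_mul (by positivity), ← ENNReal.ofReal_mul (by positivity),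
          ← ENNReal.ofReal_add (by positivity) (by positivity),
          ← ENNReal.ofReal_add (by positivity) (by positivity)]
        congr 1
        ring
    _ ≤ _ := by
        rw [lintegral_add_right _ (hrm.const_mul _), lintegral_const_mul' _ _ ENNReal.ofReal_ne_top,
          lintegral_const_mul' _ _ (by simp), mul_div_assoc,
          ENNReal.ofReal_mul (p := 8 * (M ^ 2 + s)) (by positivity)]
        exact add_le_add (mul_le_mul_right hlev _) (mul_le_mul_right hres _)

end

/-! ### Joint laws of the sample -/

section JointLaws

variable {Ω : Type*} [MeasurableSpace Ω] {P : Measure Ω} {ν M : ℝ}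
  {πb : ℝ → ℝ} {με : Measure ℝ} {N n : ℕ} {A B : Fin N → Ω → ℝ} {X ε : Fin n → Ω → ℝ}
  {Xbar : Ω → ℝ}

/-- The law of the hidden intercepts. -/
noncomputable def interceptLaw (πb : ℝ → ℝ) : Measure ℝ :=
  volume.withDensity fun z => ENNReal.ofReal (πb z)

/-- The law of the strikes. -/
noncomputable def strikeLaw (M : ℝ) : Measure ℝ := ProbabilityTheory.cond volume (Set.Icc 0 M)

theorem isProbabilityMeasure_strikeLaw (hM : 0 < M) : IsProbabilityMeasure (strikeLaw M) :=
  cond_isProbabilityMeasure_of_finite (by simpa using hM) (by simp)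

theorem ae_strikeLaw_mem (M : ℝ) : ∀ᵐ x ∂(strikeLaw M), x ∈ Set.Icc 0 M :=
  ae_cond_mem measurableSet_Icc

theorem IsSample.isProbabilityMeasure_studentT [IsProbabilityMeasure P]
    (hs : IsSample P ν M πb με A B X ε Xbar)
    (hN : 0 < N) : IsProbabilityMeasure (studentT ν) := by
  rw [← hs.law_A ⟨0, hN⟩]
  exact Measure.isProbabilityMeasure_map (hs.measurable_A _).aemeasurable

/-- The pairs `(A_j, B_j)` of hidden weights. The same map with `X` and `ε` in place of `A` and `B`
yields the noisy sample `(X_i, ε_i)`. -/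
def hiddenPairs (A B : Fin N → Ω → ℝ) (ω : Ω) (j : Fin N) : ℝ × ℝ := (A j ω, B j ω)

theorem IsSample.measurable_hiddenPairs (hs : IsSample P ν M πb με A B X ε Xbar) :
    Measurable (hiddenPairs A B) :=
  measurable_pi_lambda _ fun j => (hs.measurable_A j).prodMk (hs.measurable_B j)

theorem IsSample.measurable_samplePairs (hs : IsSample P ν M πb με A B X ε Xbar) :
    Measurable (hiddenPairs X ε) :=
  measurable_pi_lambda _ fun i => (hs.measurable_X i).prodMk (hs.measurable_noise i)

/-- All real random variables of a sample as one family. -/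
def sampleFamily (A B : Fin N → Ω → ℝ) (X ε : Fin n → Ω → ℝ) (Xbar : Ω → ℝ) :
    Fin N ⊕ (Fin N ⊕ (Fin n ⊕ (Fin n ⊕ Unit))) → Ω → ℝ :=
  Sum.elim A (Sum.elim B (Sum.elim X (Sum.elim ε fun _ : Unit => Xbar)))

theorem IsSample.measurable_family (hs : IsSample P ν M πb με A B X ε Xbar)
    (k : Fin N ⊕ (Fin N ⊕ (Fin n ⊕ (Fin n ⊕ Unit)))) :
    Measurable (sampleFamily A B X ε Xbar k) := by
  rcases k with j | j | i | i | _
  exacts [hs.measurable_A j, hs.measurable_B j, hs.measurable_X i, hs.measurable_noise i,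
    hs.measurable_Xbar]

theorem IsSample.prod_family (hs : IsSample P ν M πb με A B X ε Xbar)
    (s : Fin N ⊕ (Fin N ⊕ (Fin n ⊕ (Fin n ⊕ Unit))) → Set ℝ) :
    ∏ k, P.map (sampleFamily A B X ε Xbar k) (s k)
      = (∏ j, studentT ν (s (Sum.inl j))) * ((∏ j, interceptLaw πb (s (Sum.inr (Sum.inl j))))
        * ((∏ i, strikeLaw M (s (Sum.inr (Sum.inr (Sum.inl i)))))
          * ((∏ i, με (s (Sum.inr (Sum.inr (Sum.inr (Sum.inl i))))))
            * strikeLaw M (s (Sum.inr (Sum.inr (Sum.inr (Sum.inr ())))))))) := by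
  have hX : ∀ i, P.map (X i) = strikeLaw M := fun i => hs.law_X i
  have hXbar : P.map Xbar = strikeLaw M := hs.law_Xbar
  simp only [Fintype.prod_sum_type, sampleFamily, Sum.elim_inl, Sum.elim_inr, hs.law_A, hs.law_B,
    hX, hs.law_noise, hXbar, Finset.univ_unique, Finset.prod_singleton]
  rfl

variable [IsProbabilityMeasure P]

theorem IsSample.map_family (hs : IsSample P ν M πb με A B X ε Xbar) :
    P.map (fun ω k => sampleFamily A B X ε Xbar k ω)
      = Measure.pi fun k => P.map (sampleFamily A B X ε Xbar k) :=
  (iIndepFun_iff_map_fun_eq_pi_map fun k => (hs.measurable_family k).aemeasurable).1 hs.indep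

/-- A rearrangement `F` of the family has law `μ`, if a right inverse of `F` transports `μ` to a
measure with the right values on boxes. -/
theorem IsSample.map_rearrange (hs : IsSample P ν M πb με A B X ε Xbar) {E : Type*}
    [MeasurableSpace E] {μ : Measure E}
    {F : (Fin N ⊕ (Fin N ⊕ (Fin n ⊕ (Fin n ⊕ Unit))) → ℝ) → E}
    {R : E → Fin N ⊕ (Fin N ⊕ (Fin n ⊕ (Fin n ⊕ Unit))) → ℝ} (hF : Measurable F)
    (hR : Measurable R) (hFR : ∀ z, F (R z) = z)
    (hbox : ∀ s : Fin N ⊕ (Fin N ⊕ (Fin n ⊕ (Fin n ⊕ Unit))) → Set ℝ, (∀ k, MeasurableSet (s k)) →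
      μ (R ⁻¹' Set.univ.pi s) = ∏ k, P.map (sampleFamily A B X ε Xbar k) (s k)) :
    P.map (fun ω => F fun k => sampleFamily A B X ε Xbar k ω) = μ := by
  have : ∀ k, IsProbabilityMeasure (P.map (sampleFamily A B X ε Xbar k)) := fun k =>
    Measure.isProbabilityMeasure_map (hs.measurable_family k).aemeasurable
  have h1 : Measure.pi (fun k => P.map (sampleFamily A B X ε Xbar k)) = μ.map R :=
    Measure.pi_eq fun s hsm => by
      rw [Measure.map_apply hR (MeasurableSet.univ_pi hsm), hbox s hsm]
  have h2 : P.map (fun ω => F fun k => sampleFamily A B X ε Xbar k ω)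
      = (P.map fun ω k => sampleFamily A B X ε Xbar k ω).map F :=
    (Measure.map_map hF (measurable_pi_lambda _ fun k => hs.measurable_family k)).symm
  rw [h2, hs.map_family, h1, Measure.map_map hF hR]
  have h3 : F ∘ R = id := funext hFR
  rw [h3, Measure.map_id]

variable [IsProbabilityMeasure με]

/-- The joint law of hidden weights, noisy sample and test strike. -/
theorem IsSample.map_hidden_sample_test (hs : IsSample P ν M πb με A B X ε Xbar) (hM : 0 < M)
    [IsProbabilityMeasure (studentT ν)] [IsProbabilityMeasure (interceptLaw πb)] :
    P.map (fun ω => ((hiddenPairs A B ω, hiddenPairs X ε ω), Xbar ω))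
      = ((Measure.pi fun _ : Fin N => (studentT ν).prod (interceptLaw πb)).prod
          (Measure.pi fun _ : Fin n => (strikeLaw M).prod με)).prod (strikeLaw M) := by
  have := isProbabilityMeasure_strikeLaw hM
  refine hs.map_rearrange
    (F := fun t => ((fun j => (t (Sum.inl j), t (Sum.inr (Sum.inl j))),
      fun i => (t (Sum.inr (Sum.inr (Sum.inl i))), t (Sum.inr (Sum.inr (Sum.inr (Sum.inl i)))))),
      t (Sum.inr (Sum.inr (Sum.inr (Sum.inr ()))))))
    (R := fun z => Sum.elim (fun j => (z.1.1 j).1) (Sum.elim (fun j => (z.1.1 j).2)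
      (Sum.elim (fun i => (z.1.2 i).1) (Sum.elim (fun i => (z.1.2 i).2) fun _ => z.2))))
    (by fun_prop) ?_ (fun z => rfl) fun s hsm => ?_
  · refine measurable_pi_lambda _ fun k => ?_
    rcases k with j | j | i | i | _ <;> simp only [Sum.elim_inl, Sum.elim_inr] <;> fun_prop
  · have hset : (fun z : ((Fin N → ℝ × ℝ) × (Fin n → ℝ × ℝ)) × ℝ =>
        (Sum.elim (fun j => (z.1.1 j).1) (Sum.elim (fun j => (z.1.1 j).2)
          (Sum.elim (fun i => (z.1.2 i).1) (Sum.elim (fun i => (z.1.2 i).2) fun _ => z.2))) :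
            Fin N ⊕ (Fin N ⊕ (Fin n ⊕ (Fin n ⊕ Unit))) → ℝ)) ⁻¹' Set.univ.pi s
        = ((Set.univ.pi fun j => s (Sum.inl j) ×ˢ s (Sum.inr (Sum.inl j))) ×ˢ
            (Set.univ.pi fun i => s (Sum.inr (Sum.inr (Sum.inl i))) ×ˢ
              s (Sum.inr (Sum.inr (Sum.inr (Sum.inl i)))))) ×ˢ
            s (Sum.inr (Sum.inr (Sum.inr (Sum.inr ())))) := by
      ext z
      simp only [Set.mem_preimage, Set.mem_pi, Set.mem_univ, Set.mem_prod, Sum.forall,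
        Sum.elim_inl, Sum.elim_inr, forall_and, Unique.forall_iff]
      tauto
    rw [hset, Measure.prod_prod, Measure.prod_prod, Measure.pi_pi, Measure.pi_pi, hs.prod_family]
    simp only [Measure.prod_prod, Finset.prod_mul_distrib]
    ring

/-- The joint law of hidden weights, of all strikes including the test strike, and of the noise. -/
theorem IsSample.map_hidden_strikes_noise (hs : IsSample P ν M πb με A B X ε Xbar) (hM : 0 < M)
    [IsProbabilityMeasure (studentT ν)] [IsProbabilityMeasure (interceptLaw πb)] :
    P.map (fun ω => (hiddenPairs A B ω,
        ((fun k : Option (Fin n) => k.elim (Xbar ω) fun i => X i ω), fun i => ε i ω)))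
      = (Measure.pi fun _ : Fin N => (studentT ν).prod (interceptLaw πb)).prod
          ((Measure.pi fun _ : Option (Fin n) => strikeLaw M).prod
            (Measure.pi fun _ : Fin n => με)) := by
  have := isProbabilityMeasure_strikeLaw hM
  refine hs.map_rearrange
    (F := fun t => (fun j => (t (Sum.inl j), t (Sum.inr (Sum.inl j))),
      ((fun k : Option (Fin n) => k.elim (t (Sum.inr (Sum.inr (Sum.inr (Sum.inr ())))))
        fun i => t (Sum.inr (Sum.inr (Sum.inl i)))),
        fun i => t (Sum.inr (Sum.inr (Sum.inr (Sum.inl i)))))))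
    (R := fun z => Sum.elim (fun j => (z.1 j).1) (Sum.elim (fun j => (z.1 j).2)
      (Sum.elim (fun i => z.2.1 (some i)) (Sum.elim (fun i => z.2.2 i) fun _ => z.2.1 none))))
    ?_ ?_ (fun z => ?_) fun s hsm => ?_
  · refine Measurable.prodMk (by fun_prop) (Measurable.prodMk (measurable_pi_lambda _ fun k => ?_)
      (by fun_prop))
    cases k <;> simp only [Option.elim_none, Option.elim_some] <;> fun_prop
  · refine measurable_pi_lambda _ fun k => ?_
    rcases k with j | j | i | i | _ <;> simp only [Sum.elim_inl, Sum.elim_inr] <;> fun_prop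
  · refine Prod.ext rfl (Prod.ext (funext fun k => ?_) rfl)
    cases k <;> rfl
  · have hset : (fun z : (Fin N → ℝ × ℝ) × ((Option (Fin n) → ℝ) × (Fin n → ℝ)) =>
        (Sum.elim (fun j => (z.1 j).1) (Sum.elim (fun j => (z.1 j).2)
          (Sum.elim (fun i => z.2.1 (some i)) (Sum.elim (fun i => z.2.2 i) fun _ => z.2.1 none))) :
            Fin N ⊕ (Fin N ⊕ (Fin n ⊕ (Fin n ⊕ Unit))) → ℝ)) ⁻¹' Set.univ.pi s
        = (Set.univ.pi fun j => s (Sum.inl j) ×ˢ s (Sum.inr (Sum.inl j))) ×ˢ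
            ((Set.univ.pi fun k : Option (Fin n) =>
                k.elim (s (Sum.inr (Sum.inr (Sum.inr (Sum.inr ())))))
                  fun i => s (Sum.inr (Sum.inr (Sum.inl i)))) ×ˢ
              (Set.univ.pi fun i => s (Sum.inr (Sum.inr (Sum.inr (Sum.inl i)))))) := by
      ext z
      simp only [Set.mem_preimage, Set.mem_pi, Set.mem_univ, Set.mem_prod, Sum.forall,
        Sum.elim_inl, Sum.elim_inr, forall_and, Unique.forall_iff, Option.forall, Option.elim_none,
        Option.elim_some]
      tauto
    rw [hset, Measure.prod_prod, Measure.prod_prod, Measure.pi_pi, Measure.pi_pi, Measure.pi_pi,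
      hs.prod_family, Fintype.prod_option]
    simp only [Measure.prod_prod, Finset.prod_mul_distrib, Option.elim_none, Option.elim_some]
    ring

theorem IsSample.lintegral_eq_lintegral_test (hs : IsSample P ν M πb με A B X ε Xbar) (hM : 0 < M)
    [IsProbabilityMeasure (studentT ν)] [IsProbabilityMeasure (interceptLaw πb)]
    {F : (((Fin N → ℝ × ℝ) × (Fin n → ℝ × ℝ)) × ℝ) → ENNReal} (hF : Measurable F) :
    ∫⁻ ω, F ((hiddenPairs A B ω, hiddenPairs X ε ω), Xbar ω) ∂P
      = ∫⁻ z, ∫⁻ x, F (z, x) ∂(strikeLaw M)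
        ∂((Measure.pi fun _ : Fin N => (studentT ν).prod (interceptLaw πb)).prod
          (Measure.pi fun _ : Fin n => (strikeLaw M).prod με)) := by
  have := isProbabilityMeasure_strikeLaw hM
  rw [← lintegral_prod _ hF.aemeasurable, ← hs.map_hidden_sample_test hM, lintegral_map hF
    ((hs.measurable_hiddenPairs.prodMk hs.measurable_samplePairs).prodMk hs.measurable_Xbar)]

theorem IsSample.map_hidden_sample (hs : IsSample P ν M πb με A B X ε Xbar) (hM : 0 < M)
    [IsProbabilityMeasure (studentT ν)] [IsProbabilityMeasure (interceptLaw πb)] :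
    P.map (fun ω => (hiddenPairs A B ω, hiddenPairs X ε ω))
      = (Measure.pi fun _ : Fin N => (studentT ν).prod (interceptLaw πb)).prod
          (Measure.pi fun _ : Fin n => (strikeLaw M).prod με) := by
  have := isProbabilityMeasure_strikeLaw hM
  have h1 := congrArg (Measure.map Prod.fst) (hs.map_hidden_sample_test hM)
  rw [Measure.map_map measurable_fst ((hs.measurable_hiddenPairs.prodMk
    hs.measurable_samplePairs).prodMk hs.measurable_Xbar), Measure.map_fst_prod, measure_univ,
    one_smul] at h1
  exact h1

end JointLaws

/-! ### Test error of truncated least squares, and the remainder of the oracle inequality -/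

/-- The price function `h` is bounded on `[0,M]`, where it is the expectation of the random ReLU
feature `ϱ(A x + B)` with a bounded weight `g(A,B)` of compact support. -/
structure FeatureRepresentation (ρ : Measure (ℝ × ℝ)) (h : ℝ → ℝ) (g : ℝ × ℝ → ℝ) (cl M : ℝ) :
    Prop where
  measurable_target : Measurable h
  target_mem : ∀ x ∈ Set.Icc 0 M, 0 ≤ h x ∧ h x ≤ M
  measurable_weight : Measurable g
  weight_mem : ∀ p, 0 ≤ g p ∧ g p ≤ cl
  support : ∀ p, g p ≠ 0 → p.1 ∈ Set.Icc (1 : ℝ) 2 ∧ p.2 ∈ Set.Icc (-(2 * M)) 0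
  representation : ∀ x ∈ Set.Icc 0 M,
    ∫⁻ p, ENNReal.ofReal (g p * relu (p.1 * x + p.2)) ∂ρ = ENNReal.ofReal (h x)

theorem eLpNorm_two_le_ofReal {Ω : Type*} [MeasurableSpace Ω] {P : Measure Ω} {f : Ω → ℝ}
    {K c : ℝ} (hf : ∫⁻ ω, ENNReal.ofReal (f ω ^ 2) ∂P ≤ ENNReal.ofReal K) (hc : 0 ≤ c)
    (hK : K ≤ c ^ 2) : eLpNorm f 2 P ≤ ENNReal.ofReal c := by
  have h1 : ∀ ω, ‖f ω‖ₑ ^ (2 : ℝ) = ENNReal.ofReal (f ω ^ 2) := fun ω => by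
    rw [Real.enorm_eq_ofReal_abs, ENNReal.ofReal_rpow_of_nonneg (abs_nonneg _) (by norm_num)]
    congr 1
    rw [show (2 : ℝ) = ((2 : ℕ) : ℝ) by norm_num, Real.rpow_natCast, sq_abs]
  rw [eLpNorm_eq_lintegral_rpow_enorm_toReal (by norm_num) (by norm_num)]
  simp only [ENNReal.toReal_ofNat, h1]
  calc (∫⁻ ω, ENNReal.ofReal (f ω ^ 2) ∂P) ^ (1 / 2 : ℝ)
      ≤ (ENNReal.ofReal (c ^ 2)) ^ (1 / 2 : ℝ) :=
        ENNReal.rpow_le_rpow (hf.trans (ENNReal.ofReal_le_ofReal hK)) (by norm_num)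
    _ = ENNReal.ofReal c := by
        rw [ENNReal.ofReal_rpow_of_nonneg (by positivity) (by norm_num), ← Real.sqrt_eq_rpow,
          Real.sqrt_sq hc]

section LeastSquares

variable {Ω : Type*} [MeasurableSpace Ω] {P : Measure Ω} {ν M : ℝ}
  {πb : ℝ → ℝ} {με : Measure ℝ} {N n : ℕ} {A B : Fin N → Ω → ℝ} {X ε : Fin n → Ω → ℝ}
  {Xbar : Ω → ℝ} {h : ℝ → ℝ} {g : ℝ × ℝ → ℝ} {cl : ℝ}

theorem continuous_empiricalRisk (a b : Fin N → ℝ) (x y : Fin n → ℝ) :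
    Continuous fun w : EuclideanSpace ℝ (Fin N) => empiricalRisk a b x y w := by
  unfold empiricalRisk network
  fun_prop

/-- An empirical risk minimizer among the random weights minimizes the empirical risk almost surely:
by continuity it suffices to compare with countably many constant weights. -/
theorem IsERM.ae_forall_le {Y : Fin n → Ω → ℝ} {What : Ω → EuclideanSpace ℝ (Fin N)}
    (hW : IsERM P A B X Y (dataMeasurable A B X Y) What) :
    ∀ᵐ ω ∂P, ∀ w : EuclideanSpace ℝ (Fin N),
      empiricalRisk (fun j => A j ω) (fun j => B j ω) (fun i => X i ω) (fun i => Y i ω) (What ω)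
      ≤ empiricalRisk (fun j => A j ω) (fun j => B j ω) (fun i => X i ω) (fun i => Y i ω) w := by
  have h1 : ∀ m : ℕ, ∀ᵐ ω ∂P,
      empiricalRisk (fun j => A j ω) (fun j => B j ω) (fun i => X i ω) (fun i => Y i ω) (What ω)
      ≤ empiricalRisk (fun j => A j ω) (fun j => B j ω) (fun i => X i ω) (fun i => Y i ω)
        (TopologicalSpace.denseSeq _ m) := fun m =>
    hW.2 (fun _ => TopologicalSpace.denseSeq _ m) (by
      unfold dataMeasurable
      exact measurable_const)
  filter_upwards [ae_all_iff.2 h1] with ω hω w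
  have hclosed : IsClosed {w : EuclideanSpace ℝ (Fin N) |
      empiricalRisk (fun j => A j ω) (fun j => B j ω) (fun i => X i ω) (fun i => Y i ω) (What ω)
      ≤ empiricalRisk (fun j => A j ω) (fun j => B j ω) (fun i => X i ω) (fun i => Y i ω) w} :=
    isClosed_le continuous_const (continuous_empiricalRisk _ _ _ _)
  exact (TopologicalSpace.denseRange_denseSeq _).induction_on w hclosed hω

/-- The test error of truncated least squares: the leave-one-out bound, averaged over the hidden
weights and compared with the Monte Carlo weights. -/
theorem IsSample.lintegral_truncated_leastSquares_le [IsProbabilityMeasure P]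
    [IsProbabilityMeasure με]
    (hs : IsSample P ν M πb με A B X ε Xbar) (hM : 0 < M) (hN : 0 < N) (hn : 0 < n)
    [IsProbabilityMeasure (studentT ν)] [IsProbabilityMeasure (interceptLaw πb)]
    (hrep : FeatureRepresentation ((studentT ν).prod (interceptLaw πb)) h g cl M)
    (hε : MemLp (fun e : ℝ => e) 2 με) (hε0 : ∫ e, e ∂με = 0)
    {What : Ω → EuclideanSpace ℝ (Fin N)}
    (hW : IsERM P A B X (quote h X ε) (dataMeasurable A B X (quote h X ε)) What) :
    ∫⁻ ω, ENNReal.ofReal ((h (Xbar ω) - truncate M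
        (network (fun j => A j ω) (fun j => B j ω) (What ω) (Xbar ω))) ^ 2) ∂P
      ≤ ENNReal.ofReal (8 * (M ^ 2 + ∫ e, e ^ 2 ∂με) * N / n + 8 * ((2 * M * cl) ^ 2 / N)) := by
  have := isProbabilityMeasure_strikeLaw hM
  have hσ : 0 ≤ ∫ e, e ^ 2 ∂με := integral_nonneg fun _ => sq_nonneg _
  have hXbar : ∀ᵐ ω ∂P, Xbar ω ∈ Set.Icc 0 M := by
    have h1 : P.map Xbar = strikeLaw M := hs.law_Xbar
    refine ae_of_ae_map hs.measurable_Xbar.aemeasurable ?_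
    rw [h1]
    exact ae_strikeLaw_mem M
  have hbm := measurable_leaveOneOutBound (N := N) (n := n) (M := M) hrep.measurable_target
  have hmeas : Measurable fun ω => (hiddenPairs A B ω,
      ((fun k : Option (Fin n) => k.elim (Xbar ω) fun i => X i ω), fun i => ε i ω)) := by
    refine hs.measurable_hiddenPairs.prodMk (Measurable.prodMk (measurable_pi_lambda _ fun k => ?_)
      (measurable_pi_lambda _ hs.measurable_noise))
    cases k
    exacts [hs.measurable_Xbar, hs.measurable_X _]
  have hnet : Measurable fun p : (Fin N → ℝ × ℝ) × ℝ => ENNReal.ofReal ((h p.2 -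
      network (fun j => (p.1 j).1) (fun j => (p.1 j).2) (approxWeights g p.1) p.2) ^ 2) :=
    (((hrep.measurable_target.comp measurable_snd).sub
      (measurable_network_approxWeights hrep.measurable_weight)).pow_const 2).ennreal_ofReal
  calc ∫⁻ ω, ENNReal.ofReal ((h (Xbar ω) - truncate M
        (network (fun j => A j ω) (fun j => B j ω) (What ω) (Xbar ω))) ^ 2) ∂P
      ≤ ∫⁻ ω, ENNReal.ofReal (leaveOneOutBound M h (hiddenPairs A B ω)
          (fun k : Option (Fin n) => k.elim (Xbar ω) fun i => X i ω) (fun i => ε i ω)) ∂P := by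
        refine lintegral_mono_ae ?_
        filter_upwards [hXbar, hW.ae_forall_le] with ω h1 h2
        exact ENNReal.ofReal_le_ofReal (sq_sub_truncate_le_leaveOneOutBound (hiddenPairs A B ω)
          (fun k : Option (Fin n) => k.elim (Xbar ω) fun i => X i ω) (fun i => ε i ω) hn
          (hrep.target_mem _ h1) h2)
    _ = ∫⁻ u, ∫⁻ p, ENNReal.ofReal (leaveOneOutBound M h u p.1 p.2)
          ∂((Measure.pi fun _ : Option (Fin n) => strikeLaw M).prod (Measure.pi fun _ : Fin n => με))
          ∂(Measure.pi fun _ : Fin N => (studentT ν).prod (interceptLaw πb)) := by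
        rw [← lintegral_prod _ hbm.ennreal_ofReal.aemeasurable, ← hs.map_hidden_strikes_noise hM,
          lintegral_map hbm.ennreal_ofReal hmeas]
    _ ≤ ∫⁻ u, (ENNReal.ofReal (8 * (M ^ 2 + ∫ e, e ^ 2 ∂με) * N / n)
          + 8 * ∫⁻ z, ENNReal.ofReal
          ((h z - network (fun j => (u j).1) (fun j => (u j).2) (approxWeights g u) z) ^ 2)
            ∂(strikeLaw M))
          ∂(Measure.pi fun _ : Fin N => (studentT ν).prod (interceptLaw πb)) :=
        lintegral_mono fun u => lintegral_leaveOneOutBound_le hrep.measurable_target hn hε hε0 u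
          (approxWeights g u)
    _ = ENNReal.ofReal (8 * (M ^ 2 + ∫ e, e ^ 2 ∂με) * N / n)
          + 8 * ∫⁻ z, ∫⁻ u, ENNReal.ofReal
          ((h z - network (fun j => (u j).1) (fun j => (u j).2) (approxWeights g u) z) ^ 2)
          ∂(Measure.pi fun _ : Fin N => (studentT ν).prod (interceptLaw πb)) ∂(strikeLaw M) := by
        rw [lintegral_add_left measurable_const, lintegral_const, measure_univ, mul_one,
          lintegral_const_mul' _ _ (by simp), lintegral_lintegral_swap hnet.aemeasurable]
    _ ≤ ENNReal.ofReal (8 * (M ^ 2 + ∫ e, e ^ 2 ∂με) * N / n)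
          + 8 * ENNReal.ofReal ((2 * M * cl) ^ 2 / N) := by
        gcongr
        calc ∫⁻ z, ∫⁻ u, ENNReal.ofReal
              ((h z - network (fun j => (u j).1) (fun j => (u j).2) (approxWeights g u) z) ^ 2)
              ∂(Measure.pi fun _ : Fin N => (studentT ν).prod (interceptLaw πb)) ∂(strikeLaw M)
            ≤ ∫⁻ _z, ENNReal.ofReal ((2 * M * cl) ^ 2 / N) ∂(strikeLaw M) := by
              refine lintegral_mono_ae ?_
              filter_upwards [ae_strikeLaw_mem M] with z hz
              exact lintegral_sq_sub_network_approxWeights_le hN hM.le hrep.measurable_weight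
                hrep.weight_mem hrep.support hz (hrep.target_mem z hz).1 (hrep.representation z hz)
          _ = _ := by simp
    _ = _ := by
        rw [show (8 : ENNReal) = ENNReal.ofReal 8 by simp, ← ENNReal.ofReal_mul (by norm_num),
          ← ENNReal.ofReal_add (by positivity) (by positivity)]

end LeastSquares

section Remainder

variable {N n : ℕ} {ρ : Measure (ℝ × ℝ)} [IsProbabilityMeasure ρ] {με : Measure ℝ}
  [IsProbabilityMeasure με] {h : ℝ → ℝ} {g : ℝ × ℝ → ℝ} {cl M : ℝ}

/-- The expectation of the remainder in `integral_sq_network_sub_le`, for random `κ`. -/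
theorem lintegral_remainder_le (hM : 0 < M) (hN : 0 < N) (hn : 0 < n)
    (hrep : FeatureRepresentation ρ h g cl M)
    (hε : MemLp (fun e : ℝ => e) 2 με) (hε0 : ∫ e, e ∂με = 0)
    {κ : (Fin N → ℝ × ℝ) → (Fin n → ℝ × ℝ) → ℝ} (hκ : Measurable fun p : _ × _ => κ p.1 p.2)
    {r Cκ Ct : ℝ} (hCκ0 : 0 ≤ Cκ) (hCt0 : 0 ≤ Ct)
    (hCκ : ∫⁻ p, ENNReal.ofReal ((κ p.1 p.2 + 1 + r) ^ 2) ∂((Measure.pi fun _ : Fin N => ρ).prod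
      (Measure.pi fun _ : Fin n => (strikeLaw M).prod με)) ≤ ENNReal.ofReal Cκ)
    (hCt : ∫⁻ u, ENNReal.ofReal ((1 + M ^ 2 + M ^ 2 * meanSqSlope u) ^ 2)
      ∂(Measure.pi fun _ : Fin N => ρ) ≤ ENNReal.ofReal Ct) :
    ∫⁻ p, ENNReal.ofReal (approxError h g p.1 p.2 + 5 * (κ p.1 p.2 + 1 + r) ^ 2 / √n
        + √n * featureError (strikeLaw M) h p.1 p.2) ∂((Measure.pi fun _ : Fin N => ρ).prod
      (Measure.pi fun _ : Fin n => (strikeLaw M).prod με))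
      ≤ ENNReal.ofReal ((2 * M * cl) ^ 2 / N
        + (5 * Cκ + ((∫ e, e ^ 2 ∂με) + 1 / 2) * Ct) / √n) := by
  have := isProbabilityMeasure_strikeLaw hM
  have hσ : 0 ≤ ∫ e, e ^ 2 ∂με := integral_nonneg fun _ => sq_nonneg _
  have hn' : (0 : ℝ) < √n := Real.sqrt_pos.2 (by positivity)
  have h1 : ∀ p : (Fin N → ℝ × ℝ) × (Fin n → ℝ × ℝ),
      ENNReal.ofReal (approxError h g p.1 p.2 + 5 * (κ p.1 p.2 + 1 + r) ^ 2 / √n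
        + √n * featureError (strikeLaw M) h p.1 p.2)
      = ENNReal.ofReal (approxError h g p.1 p.2)
        + ENNReal.ofReal (5 / √n) * ENNReal.ofReal ((κ p.1 p.2 + 1 + r) ^ 2)
        + ENNReal.ofReal √n * ENNReal.ofReal (featureError (strikeLaw M) h p.1 p.2) := fun p => by
    have h2 := approxError_nonneg h g p.1 p.2
    have h3 := featureError_nonneg (strikeLaw M) h p.1 p.2
    rw [← ENNReal.ofReal_mul hn'.le, ← ENNReal.ofReal_mul (by positivity),
      ← ENNReal.ofReal_add h2 (by positivity), ← ENNReal.ofReal_add (by positivity) (by positivity)]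
    congr 2
    ring
  have hma := (measurable_approxError (N := N) (n := n) hrep.measurable_target
    hrep.measurable_weight).ennreal_ofReal
  have hmκ : Measurable fun p : (Fin N → ℝ × ℝ) × (Fin n → ℝ × ℝ) =>
      ENNReal.ofReal ((κ p.1 p.2 + 1 + r) ^ 2) :=
    (((hκ.add_const 1).add_const r).pow_const 2).ennreal_ofReal
  simp_rw [h1]
  have hsum : Measurable fun p : (Fin N → ℝ × ℝ) × (Fin n → ℝ × ℝ) =>
      ENNReal.ofReal (approxError h g p.1 p.2)
        + ENNReal.ofReal (5 / √n) * ENNReal.ofReal ((κ p.1 p.2 + 1 + r) ^ 2) :=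
    hma.add (hmκ.const_mul _)
  rw [lintegral_add_left hsum, lintegral_add_left hma,
    lintegral_const_mul' _ _ ENNReal.ofReal_ne_top, lintegral_const_mul' _ _ ENNReal.ofReal_ne_top]
  refine (add_le_add (add_le_add (lintegral_approxError_le hN hn hM.le (ae_strikeLaw_mem M)
    hrep.measurable_target (fun x hx => (hrep.target_mem x hx).1) hrep.measurable_weight
    hrep.weight_mem hrep.support hrep.representation) (mul_le_mul_right hCκ _))
    (mul_le_mul_right (lintegral_featureError_le hN hn (ae_strikeLaw_mem M) hrep.measurable_target
      hrep.target_mem hε hε0 hCt) _)).trans (le_of_eq ?_)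
  rw [← ENNReal.ofReal_mul (by positivity), ← ENNReal.ofReal_mul (by positivity),
    ← ENNReal.ofReal_add (by positivity) (by positivity),
    ← ENNReal.ofReal_add (by positivity) (by positivity)]
  congr 1
  have h4 : √(n : ℝ) * (((∫ e, e ^ 2 ∂με) + 1 / 2) * Ct / n)
      = ((∫ e, e ^ 2 ∂με) + 1 / 2) * Ct / √n := by
    have h5 : (n : ℝ) = √n * √n := (Real.mul_self_sqrt (Nat.cast_nonneg n)).symm
    rw [eq_div_iff hn'.ne', mul_div_assoc', div_mul_eq_mul_div, div_eq_iff (by positivity)]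
    conv_rhs => rw [h5]
    ring
  rw [h4]
  ring

end Remainder

/-! ### Moments of the hidden weights and the noise -/

section Moments

/-- An expectation is bounded through a pointwise bound by two functions with known expectations. -/
theorem lintegral_ofReal_le_of_le_add {E : Type*} [MeasurableSpace E] {μ : Measure E}
    [IsProbabilityMeasure μ] {F f₁ f₂ : E → ℝ} {c₀ c₁ c₂ α₁ α₂ : ℝ} (hf₁ : Measurable f₁)
    (hc₀ : 0 ≤ c₀) (hc₁ : 0 ≤ c₁) (hc₂ : 0 ≤ c₂) (hα₁ : 0 ≤ α₁) (hα₂ : 0 ≤ α₂)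
    (hF : ∀ᵐ x ∂μ, F x ≤ c₀ + c₁ * f₁ x + c₂ * f₂ x)
    (h₁ : ∫⁻ x, ENNReal.ofReal (f₁ x) ∂μ ≤ ENNReal.ofReal α₁)
    (h₂ : ∫⁻ x, ENNReal.ofReal (f₂ x) ∂μ ≤ ENNReal.ofReal α₂) :
    ∫⁻ x, ENNReal.ofReal (F x) ∂μ ≤ ENNReal.ofReal (c₀ + c₁ * α₁ + c₂ * α₂) := by
  calc ∫⁻ x, ENNReal.ofReal (F x) ∂μ
      ≤ ∫⁻ x, (ENNReal.ofReal c₀ + ENNReal.ofReal c₁ * ENNReal.ofReal (f₁ x)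
          + ENNReal.ofReal c₂ * ENNReal.ofReal (f₂ x)) ∂μ := by
        refine lintegral_mono_ae ?_
        filter_upwards [hF] with x hx
        rw [← ENNReal.ofReal_mul hc₁, ← ENNReal.ofReal_mul hc₂]
        exact (ENNReal.ofReal_le_ofReal hx).trans (ENNReal.ofReal_add_le.trans
          (add_le_add_left ENNReal.ofReal_add_le _))
    _ = ENNReal.ofReal c₀ + ENNReal.ofReal c₁ * ∫⁻ x, ENNReal.ofReal (f₁ x) ∂μ
          + ENNReal.ofReal c₂ * ∫⁻ x, ENNReal.ofReal (f₂ x) ∂μ := by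
        have hm : Measurable fun x => ENNReal.ofReal c₀ + ENNReal.ofReal c₁ * ENNReal.ofReal (f₁ x) :=
          (hf₁.ennreal_ofReal.const_mul _).const_add _
        rw [lintegral_add_left hm, lintegral_add_left measurable_const,
          lintegral_const_mul' _ _ ENNReal.ofReal_ne_top,
          lintegral_const_mul' _ _ ENNReal.ofReal_ne_top, lintegral_const, measure_univ, mul_one]
    _ ≤ ENNReal.ofReal c₀ + ENNReal.ofReal c₁ * ENNReal.ofReal α₁
          + ENNReal.ofReal c₂ * ENNReal.ofReal α₂ := by gcongr
    _ = _ := by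
        rw [← ENNReal.ofReal_mul hc₁, ← ENNReal.ofReal_mul hc₂,
          ← ENNReal.ofReal_add hc₀ (by positivity),
          ← ENNReal.ofReal_add (by positivity) (by positivity)]

theorem lintegral_sq_mean_le {E : Type*} [MeasurableSpace E] {N : ℕ} (hN : 0 < N) {ρ : Measure E}
    [IsProbabilityMeasure ρ] {q : E → ℝ} (hq : Measurable q) {α : ENNReal}
    (hα : ∫⁻ p, ENNReal.ofReal (q p ^ 2) ∂ρ ≤ α) :
    ∫⁻ u, ENNReal.ofReal (((1 / (N : ℝ)) * ∑ j, q (u j)) ^ 2) ∂(Measure.pi fun _ : Fin N => ρ)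
      ≤ α := by
  calc ∫⁻ u, ENNReal.ofReal (((1 / (N : ℝ)) * ∑ j, q (u j)) ^ 2) ∂(Measure.pi fun _ : Fin N => ρ)
      ≤ ∫⁻ u, ENNReal.ofReal ((1 / (N : ℝ)) * ∑ j, q (u j) ^ 2) ∂(Measure.pi fun _ : Fin N => ρ) :=
        lintegral_mono fun u => ENNReal.ofReal_le_ofReal (sq_mean_le_mean_sq hN fun j => q (u j))
    _ = ∫⁻ p, ENNReal.ofReal (q p ^ 2) ∂ρ :=
        lintegral_mean_eq hN (q := fun p => q p ^ 2) (hq.pow_const 2) fun _ => sq_nonneg _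
    _ ≤ α := hα

theorem measurable_meanSqSlope {N : ℕ} :
    Measurable fun u : Fin N → ℝ × ℝ => meanSqSlope u := by
  unfold meanSqSlope
  fun_prop

theorem measurable_meanSqIntercept {N : ℕ} :
    Measurable fun u : Fin N → ℝ × ℝ => meanSqIntercept u := by
  unfold meanSqIntercept
  fun_prop

theorem lintegral_sq_meanSqSlope_le {N : ℕ} (hN : 0 < N) {ρ : Measure (ℝ × ℝ)}
    [IsProbabilityMeasure ρ] {α : ENNReal} (hα : ∫⁻ p, ENNReal.ofReal (p.1 ^ 4) ∂ρ ≤ α) :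
    ∫⁻ u, ENNReal.ofReal (meanSqSlope u ^ 2) ∂(Measure.pi fun _ : Fin N => ρ) ≤ α :=
  lintegral_sq_mean_le hN (q := fun p : ℝ × ℝ => p.1 ^ 2) (by fun_prop) (by
    simpa only [← pow_mul] using hα)

theorem lintegral_sq_meanSqIntercept_le {N : ℕ} (hN : 0 < N) {ρ : Measure (ℝ × ℝ)}
    [IsProbabilityMeasure ρ] {α : ENNReal} (hα : ∫⁻ p, ENNReal.ofReal (p.2 ^ 4) ∂ρ ≤ α) :
    ∫⁻ u, ENNReal.ofReal (meanSqIntercept u ^ 2) ∂(Measure.pi fun _ : Fin N => ρ) ≤ α :=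
  lintegral_sq_mean_le hN (q := fun p : ℝ × ℝ => p.2 ^ 2) (by fun_prop) (by
    simpa only [← pow_mul] using hα)

/-- The second moment of the bound for the squared norm of `errorFeature` in
`sum_errorFeature_sq_le`; it needs the fourth moment of the slopes. -/
theorem lintegral_featureBound_sq_le {N : ℕ} (hN : 0 < N) {ρ : Measure (ℝ × ℝ)}
    [IsProbabilityMeasure ρ] {α : ℝ} (hα0 : 0 ≤ α)
    (hα : ∫⁻ p, ENNReal.ofReal (p.1 ^ 4) ∂ρ ≤ ENNReal.ofReal α) (M : ℝ) :
    ∫⁻ u, ENNReal.ofReal ((1 + M ^ 2 + M ^ 2 * meanSqSlope u) ^ 2)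
      ∂(Measure.pi fun _ : Fin N => ρ) ≤ ENNReal.ofReal (2 * (1 + M ^ 2) ^ 2 + 2 * M ^ 4 * α) := by
  have h := lintegral_ofReal_le_of_le_add (μ := Measure.pi fun _ : Fin N => ρ)
    (F := fun u => (1 + M ^ 2 + M ^ 2 * meanSqSlope u) ^ 2) (f₁ := fun u => meanSqSlope u ^ 2)
    (f₂ := fun _ => 0) (c₀ := 2 * (1 + M ^ 2) ^ 2) (c₁ := 2 * M ^ 4) (c₂ := 0) (α₂ := 0)
    (measurable_meanSqSlope.pow_const 2) (by positivity) (by positivity) le_rfl hα0 le_rfl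
    (.of_forall fun u => by nlinarith [sq_nonneg (1 + M ^ 2 - M ^ 2 * meanSqSlope u)])
    (lintegral_sq_meanSqSlope_le hN hα) (by simp)
  simpa using h

theorem lintegral_mean_quote_pow_four_le {n : ℕ} (hn : 0 < n) {μX με : Measure ℝ}
    [IsProbabilityMeasure μX] [IsProbabilityMeasure με] {h : ℝ → ℝ} {M : ℝ}
    (hX : ∀ᵐ x ∂μX, x ∈ Set.Icc 0 M) (hhm : Measurable h)
    (hh : ∀ x ∈ Set.Icc 0 M, 0 ≤ h x ∧ h x ≤ M) (hε : Integrable (fun e : ℝ => e ^ 4) με) :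
    ∫⁻ v, ENNReal.ofReal ((1 / (n : ℝ)) * ∑ i, (h (v i).1 + (v i).2) ^ 4)
      ∂(Measure.pi fun _ : Fin n => μX.prod με)
      ≤ ENNReal.ofReal (8 * M ^ 4 + 8 * ∫ e, e ^ 4 ∂με) := by
  rw [lintegral_mean_eq hn (q := fun p : ℝ × ℝ => (h p.1 + p.2) ^ 4)
    (((hhm.comp measurable_fst).add measurable_snd).pow_const 4) fun _ => by positivity]
  have h0 : 0 ≤ ∫ e, e ^ 4 ∂με := integral_nonneg fun _ => by positivity
  have h1 : ∫⁻ p, ENNReal.ofReal (p.2 ^ 4) ∂(μX.prod με) ≤ ENNReal.ofReal (∫ e, e ^ 4 ∂με) := by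
    rw [ofReal_integral_eq_lintegral_ofReal hε (.of_forall fun _ => by positivity)]
    exact ((measurePreserving_snd (μ := μX) (ν := με)).lintegral_comp
      (f := fun e : ℝ => ENNReal.ofReal (e ^ 4)) (by fun_prop)).le
  have hX' : ∀ᵐ p ∂(μX.prod με), p.1 ∈ Set.Icc 0 M := Measure.quasiMeasurePreserving_fst.ae hX
  have h2 := lintegral_ofReal_le_of_le_add (μ := μX.prod με)
    (F := fun p => (h p.1 + p.2) ^ 4) (f₁ := fun p => p.2 ^ 4)
    (f₂ := fun _ => 0) (c₀ := 8 * M ^ 4) (c₁ := 8) (c₂ := 0) (α₂ := 0)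
    (by fun_prop) (by positivity) (by positivity) le_rfl h0 le_rfl (by
      filter_upwards [hX'] with p hp
      have h3 : h p.1 ^ 4 ≤ M ^ 4 := pow_le_pow_left₀ (hh _ hp).1 (hh _ hp).2 4
      have h4 : (h p.1 + p.2) ^ 4 ≤ 8 * (h p.1 ^ 4 + p.2 ^ 4) := by
        have h5 : (h p.1 + p.2) ^ 2 ≤ 2 * (h p.1 ^ 2 + p.2 ^ 2) := by
          nlinarith [sq_nonneg (h p.1 - p.2)]
        have h6 := pow_le_pow_left₀ (sq_nonneg _) h5 2
        nlinarith [sq_nonneg (h p.1 ^ 2 - p.2 ^ 2)]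
      linarith) h1 (by simp)
  simpa using h2

end Moments

theorem measurable_remainder {N n : ℕ} {μX : Measure ℝ} [IsProbabilityMeasure μX] {h : ℝ → ℝ}
    {g : ℝ × ℝ → ℝ} (hh : Measurable h) (hg : Measurable g)
    {κ : (Fin N → ℝ × ℝ) → (Fin n → ℝ × ℝ) → ℝ} (hκ : Measurable fun p : _ × _ => κ p.1 p.2)
    (r : ℝ) :
    Measurable fun p : (Fin N → ℝ × ℝ) × (Fin n → ℝ × ℝ) =>
      approxError h g p.1 p.2 + 5 * (κ p.1 p.2 + 1 + r) ^ 2 / √n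
        + √n * featureError μX h p.1 p.2 :=
  ((measurable_approxError hh hg).add
    ((((hκ.add_const 1).add_const r).pow_const 2).const_mul 5 |>.div_const _)).add
    ((measurable_featureError hh).const_mul _)

section TestError

variable {Ω : Type*} [MeasurableSpace Ω] {P : Measure Ω} [IsProbabilityMeasure P] {ν M : ℝ}
  {πb : ℝ → ℝ} {με : Measure ℝ} [IsProbabilityMeasure με] {N n : ℕ} {A B : Fin N → Ω → ℝ}
  {X ε : Fin n → Ω → ℝ} {Xbar : Ω → ℝ} {h : ℝ → ℝ} {g : ℝ × ℝ → ℝ} {cl : ℝ}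

theorem integrable_sq_sub_network (hN : 0 < N) {μX : Measure ℝ} [IsProbabilityMeasure μX]
    (hX : ∀ᵐ x ∂μX, x ∈ Set.Icc 0 M) (hhm : Measurable h)
    (hh : ∀ x ∈ Set.Icc 0 M, 0 ≤ h x ∧ h x ≤ M) (u : Fin N → ℝ × ℝ)
    (W : EuclideanSpace ℝ (Fin N)) :
    Integrable (fun x => (h x - network (fun j => (u j).1) (fun j => (u j).2) W x) ^ 2) μX := by
  have h1 : ∀ x, (h x - network (fun j => (u j).1) (fun j => (u j).2) W x) ^ 2
      = ∑ j, ∑ k, errorCoef u W j * errorCoef u W k * (errorFeature h u x j * errorFeature h u x k) :=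
    fun x => by
      rw [show (h x - network (fun j => (u j).1) (fun j => (u j).2) W x) ^ 2
        = (∑ j, errorCoef u W j * errorFeature h u x j) ^ 2 by
          rw [sum_errorCoef_mul_errorFeature hN]; ring, sq, Finset.sum_mul_sum]
      exact Finset.sum_congr rfl fun j _ => Finset.sum_congr rfl fun k _ => by ring
  simp_rw [h1]
  exact integrable_finsetSum _ fun j _ => integrable_finsetSum _ fun k _ =>
    (integrable_errorFeature_mul hN hX hhm hh u j k).const_mul _

theorem measurable_sq_sub_network {E : Type*} [MeasurableSpace E] (hhm : Measurable h)
    {u : E → Fin N → ℝ × ℝ} (hu : Measurable u) {W : E → EuclideanSpace ℝ (Fin N)}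
    (hW : Measurable W) :
    Measurable fun p : E × ℝ =>
      (h p.2 - network (fun j => (u p.1 j).1) (fun j => (u p.1 j).2) (W p.1) p.2) ^ 2 := by
  have h1 : ∀ j, Measurable fun p : E × ℝ => u p.1 j := fun j =>
    (measurable_pi_apply j).comp (hu.comp measurable_fst)
  have h2 : ∀ j, Measurable fun p : E × ℝ => W p.1 j := fun j =>
    ((PiLp.continuous_apply 2 (fun _ : Fin N => ℝ) j).measurable.comp hW).comp measurable_fst
  unfold network
  exact ((hhm.comp measurable_snd).sub (Finset.measurable_fun_sum _ fun j _ =>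
    (h2 j).mul (measurable_relu.comp (((h1 j).fst.mul measurable_snd).add (h1 j).snd)))).pow_const 2

/-- Since the test strike is independent of the sample, the expected test error is the expected
`L²([0,M])` error of the trained network. -/
theorem IsSample.lintegral_sq_test_eq (hs : IsSample P ν M πb με A B X ε Xbar) (hM : 0 < M)
    (hN : 0 < N) [IsProbabilityMeasure (studentT ν)] [IsProbabilityMeasure (interceptLaw πb)]
    (hhm : Measurable h) (hh : ∀ x ∈ Set.Icc 0 M, 0 ≤ h x ∧ h x ≤ M)
    {W : (Fin N → ℝ × ℝ) × (Fin n → ℝ × ℝ) → EuclideanSpace ℝ (Fin N)} (hW : Measurable W) :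
    ∫⁻ ω, ENNReal.ofReal ((h (Xbar ω) - network (fun j => A j ω) (fun j => B j ω)
        (W (hiddenPairs A B ω, hiddenPairs X ε ω)) (Xbar ω)) ^ 2) ∂P
      = ∫⁻ ω, ENNReal.ofReal (∫ x, (h x - network (fun j => A j ω) (fun j => B j ω)
          (W (hiddenPairs A B ω, hiddenPairs X ε ω)) x) ^ 2 ∂(strikeLaw M)) ∂P := by
  have := isProbabilityMeasure_strikeLaw hM
  have hm := measurable_sq_sub_network hhm
    (measurable_fst (α := Fin N → ℝ × ℝ) (β := Fin n → ℝ × ℝ)) hW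
  have h1 := hs.lintegral_eq_lintegral_test hM hm.ennreal_ofReal
  have h2 : ∀ z : (Fin N → ℝ × ℝ) × (Fin n → ℝ × ℝ),
      ∫⁻ x, ENNReal.ofReal ((h x - network (fun j => (z.1 j).1) (fun j => (z.1 j).2) (W z) x) ^ 2)
        ∂(strikeLaw M)
      = ENNReal.ofReal (∫ x, (h x - network (fun j => (z.1 j).1) (fun j => (z.1 j).2) (W z) x) ^ 2
        ∂(strikeLaw M)) := fun z =>
    (ofReal_integral_eq_lintegral_ofReal (integrable_sq_sub_network hN (ae_strikeLaw_mem M) hhm hh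
      z.1 (W z)) (.of_forall fun _ => sq_nonneg _)).symm
  simp_rw [h2] at h1
  rw [← hs.map_hidden_sample hM, lintegral_map
    hm.stronglyMeasurable.integral_prod_right'.measurable.ennreal_ofReal
    (hs.measurable_hiddenPairs.prodMk hs.measurable_samplePairs)] at h1
  exact h1

end TestError

/-! ### Regression under a norm constraint -/

section Constrained

variable {N n : ℕ}

theorem empiricalRisk_zero (a b : Fin N → ℝ) (x y : Fin n → ℝ) :
    empiricalRisk a b x y 0 = (1 / (n : ℝ)) * ∑ i, y i ^ 2 := by
  simp [empiricalRisk, network]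

/-- Weights that are no worse than zero on the sample have a network with controlled value at `0`,
whatever the intercepts are. This replaces a moment condition on the law of the intercepts. -/
theorem network_zero_sq_le_of_empiricalRisk_le (hN : 0 < N) (hn : 0 < n) {M r : ℝ}
    (u : Fin N → ℝ × ℝ) {x y : Fin n → ℝ} (hx : ∀ i, x i ∈ Set.Icc 0 M)
    {W : EuclideanSpace ℝ (Fin N)} (hW : N * ‖W‖ ^ 2 ≤ r)
    (hR : empiricalRisk (fun j => (u j).1) (fun j => (u j).2) x y W
      ≤ empiricalRisk (fun j => (u j).1) (fun j => (u j).2) x y 0) :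
    network (fun j => (u j).1) (fun j => (u j).2) W 0 ^ 2
      ≤ 8 * ((1 / (n : ℝ)) * ∑ i, y i ^ 2) + 2 * r * (M ^ 2 * meanSqSlope u) := by
  have hn' : (0 : ℝ) < n := by positivity
  set F : ℝ → ℝ := network (fun j => (u j).1) (fun j => (u j).2) W with hF
  have h1 : ∀ i, F 0 ^ 2 ≤ 4 * (F (x i) - y i) ^ 2 + 4 * y i ^ 2
      + 2 * r * (M ^ 2 * meanSqSlope u) := fun i => by
    have h2 := network_sub_network_zero_sq_le hN (hx i) u W
    rw [← hF] at h2
    have h3 : N * ‖W‖ ^ 2 * (M ^ 2 * meanSqSlope u) ≤ r * (M ^ 2 * meanSqSlope u) :=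
      mul_le_mul_of_nonneg_right hW (mul_nonneg (sq_nonneg _) (meanSqSlope_nonneg u))
    nlinarith [sq_nonneg (F (x i) - F 0 + F (x i)), sq_nonneg (F (x i) - y i - y i)]
  have h2 : n * F 0 ^ 2 ≤ 4 * ∑ i, (F (x i) - y i) ^ 2 + 4 * ∑ i, y i ^ 2
      + n * (2 * r * (M ^ 2 * meanSqSlope u)) := by
    have := Finset.sum_le_sum fun i (_ : i ∈ Finset.univ) => h1 i
    simpa [Finset.sum_add_distrib, Finset.mul_sum] using this
  rw [empiricalRisk_zero, empiricalRisk] at hR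
  have h3 : ∑ i, (F (x i) - y i) ^ 2 ≤ ∑ i, y i ^ 2 := le_of_mul_le_mul_left hR (by positivity)
  have h4 : n * F 0 ^ 2 ≤ n * (8 * ((1 / (n : ℝ)) * ∑ i, y i ^ 2)
      + 2 * r * (M ^ 2 * meanSqSlope u)) := by
    have : n * (8 * ((1 / (n : ℝ)) * ∑ i, y i ^ 2)) = 8 * ∑ i, y i ^ 2 := by
      field_simp
    rw [mul_add, this]
    linarith
  exact le_of_mul_le_mul_left h4 hn'

variable {Ω : Type*} [MeasurableSpace Ω] {P : Measure Ω} {ν M : ℝ}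
  {πb : ℝ → ℝ} {με : Measure ℝ} {A B : Fin N → Ω → ℝ}
  {X ε : Fin n → Ω → ℝ} {Xbar : Ω → ℝ} {h : ℝ → ℝ} {g : ℝ × ℝ → ℝ} {cl : ℝ}

theorem IsSample.ae_strikes_mem (hs : IsSample P ν M πb με A B X ε Xbar) :
    ∀ᵐ ω ∂P, ∀ i, X i ω ∈ Set.Icc 0 M := by
  refine ae_all_iff.2 fun i => ae_of_ae_map (hs.measurable_X i).aemeasurable ?_
  have h1 : P.map (X i) = strikeLaw M := hs.law_X i
  rw [h1]
  exact ae_strikeLaw_mem M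

variable [IsProbabilityMeasure με]

/-- The second moment of the bound for the squared coefficients in `errorCoef` that results from
`network_zero_sq_le_of_empiricalRisk_le`. -/
theorem lintegral_interceptBound_sq_le (hN : 0 < N) (hn : 0 < n) {ρ : Measure (ℝ × ℝ)}
    [IsProbabilityMeasure ρ] {μX : Measure ℝ} [IsProbabilityMeasure μX]
    (hX : ∀ᵐ x ∂μX, x ∈ Set.Icc 0 M) (hhm : Measurable h)
    (hh : ∀ x ∈ Set.Icc 0 M, 0 ≤ h x ∧ h x ≤ M) (hε : Integrable (fun e : ℝ => e ^ 4) με)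
    {α : ℝ} (hα0 : 0 ≤ α) (hα : ∫⁻ p, ENNReal.ofReal (p.1 ^ 4) ∂ρ ≤ ENNReal.ofReal α) (r : ℝ) :
    ∫⁻ p, ENNReal.ofReal ((8 * ((1 / (n : ℝ)) * ∑ i, (h (p.2 i).1 + (p.2 i).2) ^ 2)
        + 2 * r * (M ^ 2 * meanSqSlope p.1) + 1 + r) ^ 2)
      ∂((Measure.pi fun _ : Fin N => ρ).prod (Measure.pi fun _ : Fin n => μX.prod με))
      ≤ ENNReal.ofReal (3 * (1 + r) ^ 2 + 192 * (8 * M ^ 4 + 8 * ∫ e, e ^ 4 ∂με)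
        + 12 * r ^ 2 * M ^ 4 * α) := by
  have h0 : 0 ≤ ∫ e, e ^ 4 ∂με := integral_nonneg fun _ => by positivity
  have hy : ∀ i, Measurable fun v : Fin n → ℝ × ℝ => h (v i).1 + (v i).2 := fun i =>
    (hhm.comp (measurable_pi_apply i).fst).add (measurable_pi_apply i).snd
  have hf : Measurable fun v : Fin n → ℝ × ℝ =>
      (1 / (n : ℝ)) * ∑ i, (h (v i).1 + (v i).2) ^ 4 :=
    (Finset.measurable_fun_sum _ fun i _ => (hy i).pow_const 4).const_mul _
  refine lintegral_ofReal_le_of_le_add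
    (f₁ := fun p => (1 / (n : ℝ)) * ∑ i, (h (p.2 i).1 + (p.2 i).2) ^ 4)
    (f₂ := fun p => meanSqSlope p.1 ^ 2) (hf.comp measurable_snd) (by positivity) (by norm_num)
    (by positivity) (by positivity) hα0 (.of_forall fun p => ?_) ?_ ?_
  · have h1 := sq_mean_le_mean_sq hn fun i => (h (p.2 i).1 + (p.2 i).2) ^ 2
    simp only [← pow_mul] at h1
    set m := (1 / (n : ℝ)) * ∑ i, (h (p.2 i).1 + (p.2 i).2) ^ 2
    set S := meanSqSlope p.1
    nlinarith [sq_nonneg (8 * m - 2 * r * (M ^ 2 * S)), sq_nonneg (8 * m - (1 + r)),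
      sq_nonneg (2 * r * (M ^ 2 * S) - (1 + r))]
  · exact (measurePreserving_snd.lintegral_comp hf.ennreal_ofReal).trans_le
      (lintegral_mean_quote_pow_four_le hn hX hhm hh hε)
  · exact (measurePreserving_fst.lintegral_comp
      (measurable_meanSqSlope.pow_const 2).ennreal_ofReal).trans_le
      (lintegral_sq_meanSqSlope_le hN hα)

theorem approxWeights_norm_sq_mul_le (hN : 0 < N) (hg : ∀ p, 0 ≤ g p ∧ g p ≤ cl)
    (u : Fin N → ℝ × ℝ) : N * ‖approxWeights g u‖ ^ 2 ≤ cl ^ 2 := by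
  have hN' : (0 : ℝ) < N := by positivity
  have h1 := mul_le_mul_of_nonneg_left (norm_sq_approxWeights_le hN hg u) hN'.le
  rwa [mul_div_cancel₀ _ hN'.ne'] at h1

theorem measurable_approxWeights (hg : Measurable g) :
    Measurable fun u : Fin N → ℝ × ℝ => approxWeights g u :=
  (WithLp.measurable_toLp 2 _).comp
    (measurable_pi_lambda _ fun j => (hg.comp (measurable_pi_apply j)).div_const _)

theorem sq_mul_le_of_mem_Icc (hN : 0 < N) {cu lam : ℝ} (hcl : 0 ≤ cl)
    (hlam : lam ∈ Set.Icc (cl / √N) (cu / √N)) :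
    0 ≤ lam ∧ cl ^ 2 ≤ N * lam ^ 2 ∧ N * lam ^ 2 ≤ cu ^ 2 := by
  have hN' : (0 : ℝ) < √N := Real.sqrt_pos.2 (by positivity)
  have hlam0 : 0 ≤ lam := (by positivity : (0 : ℝ) ≤ cl / √N).trans hlam.1
  have h1 := hlam.1
  have h2 := hlam.2
  rw [div_le_iff₀ hN', mul_comm] at h1
  rw [le_div_iff₀ hN', mul_comm] at h2
  have h3 : (N : ℝ) * lam ^ 2 = (√N * lam) ^ 2 := by
    rw [mul_pow, Real.sq_sqrt (Nat.cast_nonneg N)]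
  rw [h3]
  exact ⟨hlam0, pow_le_pow_left₀ hcl h1 2, pow_le_pow_left₀ (by positivity) h2 2⟩

/-- The test error of regression with a norm constraint. -/
theorem IsSample.lintegral_constrained_le [IsProbabilityMeasure P]
    (hs : IsSample P ν M πb με A B X ε Xbar) (hM : 0 < M) (hN : 0 < N) (hn : 0 < n)
    [IsProbabilityMeasure (studentT ν)] [IsProbabilityMeasure (interceptLaw πb)]
    (hrep : FeatureRepresentation ((studentT ν).prod (interceptLaw πb)) h g cl M)
    (hε : MemLp (fun e : ℝ => e) 2 με) (hε4 : Integrable (fun e : ℝ => e ^ 4) με)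
    (hε0 : ∫ e, e ∂με = 0) {α : ℝ} (hα0 : 0 ≤ α)
    (hα : ∫⁻ p, ENNReal.ofReal (p.1 ^ 4) ∂((studentT ν).prod (interceptLaw πb))
      ≤ ENNReal.ofReal α) {cu lam : ℝ} (hlam : lam ∈ Set.Icc (cl / √N) (cu / √N)) (hcl : 0 ≤ cl)
    {What : Ω → EuclideanSpace ℝ (Fin N)}
    (hW : IsERM P A B X (quote h X ε) (constrainedWeights P A B X (quote h X ε) lam) What) :
    ∫⁻ ω, ENNReal.ofReal ((h (Xbar ω) -
        network (fun j => A j ω) (fun j => B j ω) (What ω) (Xbar ω)) ^ 2) ∂P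
      ≤ ENNReal.ofReal ((2 * M * cl) ^ 2 / N
        + (5 * (3 * (1 + cu ^ 2) ^ 2 + 192 * (8 * M ^ 4 + 8 * ∫ e, e ^ 4 ∂με)
            + 12 * (cu ^ 2) ^ 2 * M ^ 4 * α)
          + ((∫ e, e ^ 2 ∂με) + 1 / 2) * (2 * (1 + M ^ 2) ^ 2 + 2 * M ^ 4 * α)) / √n) := by
  have := isProbabilityMeasure_strikeLaw hM
  have h40 : 0 ≤ ∫ e, e ^ 4 ∂με := integral_nonneg fun _ => by positivity
  have hN' : (0 : ℝ) < N := by positivity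
  obtain ⟨hlam0, hlam1, hlam2⟩ := sq_mul_le_of_mem_Icc hN hcl hlam
  have hnorm : ∀ W : EuclideanSpace ℝ (Fin N), ‖W‖ ≤ lam → N * ‖W‖ ^ 2 ≤ cu ^ 2 := fun W hWn =>
    (mul_le_mul_of_nonneg_left (pow_le_pow_left₀ (norm_nonneg _) hWn 2) hN'.le).trans hlam2
  have happ : ∀ u : Fin N → ℝ × ℝ, ‖approxWeights g u‖ ≤ lam := fun u =>
    (abs_le_of_sq_le_sq' (le_of_mul_le_mul_left
      ((approxWeights_norm_sq_mul_le hN hrep.weight_mem u).trans hlam1) hN') hlam0).2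
  -- the estimator is a measurable function of the hidden weights and the noisy sample
  obtain ⟨G, hG, hGW⟩ := Measurable.exists_eq_measurable_comp hW.1.1
  set W : (Fin N → ℝ × ℝ) × (Fin n → ℝ × ℝ) → EuclideanSpace ℝ (Fin N) := fun z =>
    G ((fun j => (z.1 j).1, fun j => (z.1 j).2), fun i => ((z.2 i).1, h (z.2 i).1 + (z.2 i).2))
    with hWdef
  have hWm : Measurable W := by
    have h1 : ∀ i, Measurable fun z : (Fin N → ℝ × ℝ) × (Fin n → ℝ × ℝ) => z.2 i := fun i =>
      (measurable_pi_apply i).comp measurable_snd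
    refine hG.comp (Measurable.prodMk (by fun_prop) (measurable_pi_lambda _ fun i => ?_))
    exact (h1 i).fst.prodMk ((hrep.measurable_target.comp (h1 i).fst).add (h1 i).snd)
  have hWW : ∀ ω, What ω = W (hiddenPairs A B ω, hiddenPairs X ε ω) := fun ω => by
    rw [hGW]; rfl
  have hzero := hW.2 (fun _ => 0) ⟨by unfold dataMeasurable; exact measurable_const,
    .of_forall fun _ => by simpa using hlam0⟩
  have hbest := hW.2 (fun ω => approxWeights g (hiddenPairs A B ω)) ⟨by
    have h1 : Measurable fun z : ((Fin N → ℝ) × (Fin N → ℝ)) × (Fin n → ℝ × ℝ) =>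
        approxWeights g fun j => (z.1.1 j, z.1.2 j) :=
      (measurable_approxWeights hrep.measurable_weight).comp
        (measurable_pi_lambda _ fun j => by fun_prop)
    exact h1.comp (comap_measurable _), .of_forall fun _ => happ _⟩
  set κ : (Fin N → ℝ × ℝ) → (Fin n → ℝ × ℝ) → ℝ := fun u v =>
    8 * ((1 / (n : ℝ)) * ∑ i, (h (v i).1 + (v i).2) ^ 2) + 2 * cu ^ 2 * (M ^ 2 * meanSqSlope u)
    with hκ
  have hκm : Measurable fun p : (Fin N → ℝ × ℝ) × (Fin n → ℝ × ℝ) => κ p.1 p.2 := by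
    have h1 : ∀ i, Measurable fun z : (Fin N → ℝ × ℝ) × (Fin n → ℝ × ℝ) => z.2 i := fun i =>
      (measurable_pi_apply i).comp measurable_snd
    exact ((Finset.measurable_fun_sum _ fun i _ => ((hrep.measurable_target.comp (h1 i).fst).add
      (h1 i).snd).pow_const 2).const_mul _ |>.const_mul _).add
      (((measurable_meanSqSlope.comp measurable_fst).const_mul _).const_mul _)
  have hremm := measurable_remainder (μX := strikeLaw M) hrep.measurable_target
    hrep.measurable_weight hκm (cu ^ 2)
  simp_rw [hWW]
  rw [hs.lintegral_sq_test_eq hM hN hrep.measurable_target hrep.target_mem hWm]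
  calc ∫⁻ ω, ENNReal.ofReal (∫ x, (h x - network (fun j => A j ω) (fun j => B j ω)
          (W (hiddenPairs A B ω, hiddenPairs X ε ω)) x) ^ 2 ∂(strikeLaw M)) ∂P
      ≤ ∫⁻ ω, ENNReal.ofReal (approxError h g (hiddenPairs A B ω) (hiddenPairs X ε ω)
          + 5 * (κ (hiddenPairs A B ω) (hiddenPairs X ε ω) + 1 + cu ^ 2) ^ 2 / √n
          + √n * featureError (strikeLaw M) h (hiddenPairs A B ω) (hiddenPairs X ε ω)) ∂P := by
        refine lintegral_mono_ae ?_
        filter_upwards [hs.ae_strikes_mem, hW.1.2, hzero, hbest] with ω h1 h2 h3 h4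
        refine ENNReal.ofReal_le_ofReal ?_
        rw [← hWW]
        have hc := network_zero_sq_le_of_empiricalRisk_le hN hn (hiddenPairs A B ω)
          (x := fun i => X i ω) (y := fun i => quote h X ε i ω) h1 (hnorm _ h2) h3
        have h5 := integral_sq_network_sub_le hN hn (ae_strikeLaw_mem M) hrep.measurable_target
          hrep.target_mem (fun p hp => (hrep.support p hp).2.2) (hiddenPairs A B ω)
          (hiddenPairs X ε ω) (What ω) (sq_nonneg cu)
          (κ := κ (hiddenPairs A B ω) (hiddenPairs X ε ω)) ((sq_nonneg _).trans hc) (hnorm _ h2)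
          (hnorm _ (happ _)) hc
        have h6 : empiricalRisk (fun j => (hiddenPairs A B ω j).1)
            (fun j => (hiddenPairs A B ω j).2) (fun i => (hiddenPairs X ε ω i).1)
            (fun i => h (hiddenPairs X ε ω i).1 + (hiddenPairs X ε ω i).2) (What ω)
          ≤ empiricalRisk (fun j => (hiddenPairs A B ω j).1)
            (fun j => (hiddenPairs A B ω j).2) (fun i => (hiddenPairs X ε ω i).1)
            (fun i => h (hiddenPairs X ε ω i).1 + (hiddenPairs X ε ω i).2)
            (approxWeights g (hiddenPairs A B ω)) := h4
        refine h5.trans ?_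
        linarith
    _ = ∫⁻ p, ENNReal.ofReal (approxError h g p.1 p.2 + 5 * (κ p.1 p.2 + 1 + cu ^ 2) ^ 2 / √n
          + √n * featureError (strikeLaw M) h p.1 p.2)
          ∂((Measure.pi fun _ : Fin N => (studentT ν).prod (interceptLaw πb)).prod
          (Measure.pi fun _ : Fin n => (strikeLaw M).prod με)) := by
        rw [← hs.map_hidden_sample hM, lintegral_map hremm.ennreal_ofReal
          (hs.measurable_hiddenPairs.prodMk hs.measurable_samplePairs)]
    _ ≤ _ := lintegral_remainder_le hM hN hn hrep hε hε0 hκm (by positivity) (by positivity)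
        (lintegral_interceptBound_sq_le hN hn (ae_strikeLaw_mem M) hrep.measurable_target
          hrep.target_mem hε4 hα0 hα (cu ^ 2)) (lintegral_featureBound_sq_le hN hα0 hα M)

end Constrained

/-! ### Batch indices, measurability of the iterates, and gradient bounds -/

section StochasticGradient

variable {N n 𝔅 : ℕ}

theorem norm_sq_features_le (hN : 0 < N) {M x : ℝ} (hx : x ∈ Set.Icc 0 M) (u : Fin N → ℝ × ℝ) :
    ‖features (fun j => (u j).1) (fun j => (u j).2) x‖ ^ 2
      ≤ N * (2 * (M ^ 2 * meanSqSlope u + meanSqIntercept u)) := by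
  have h1 : N * (2 * (M ^ 2 * meanSqSlope u + meanSqIntercept u))
      = ∑ j, 2 * (M ^ 2 * (u j).1 ^ 2 + (u j).2 ^ 2) := by
    rw [← Finset.mul_sum, Finset.sum_add_distrib, ← Finset.mul_sum, sum_slope_sq hN,
      sum_intercept_sq hN]
    ring
  rw [h1, EuclideanSpace.real_norm_sq_eq]
  refine Finset.sum_le_sum fun j _ => ?_
  have h2 : |relu ((u j).1 * x + (u j).2)| ≤ |(u j).1 * x + (u j).2| := by
    simpa [relu] using abs_relu_sub_relu_le ((u j).1 * x + (u j).2) 0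
  have h3 := sq_le_sq.2 h2
  have h4 : ((u j).1 * x) ^ 2 ≤ M ^ 2 * (u j).1 ^ 2 := by
    rw [mul_pow, mul_comm]
    exact mul_le_mul_of_nonneg_right (pow_le_pow_left₀ hx.1 hx.2 2) (sq_nonneg _)
  simp only [features]
  nlinarith [sq_nonneg ((u j).1 * x - (u j).2)]

/-- The bound for the squared gradients of the sample losses on a ball of radius of order `1/√N` is
of order `N`. -/
theorem gradBound_le (hN : 0 < N) {M r lam : ℝ} (u : Fin N → ℝ × ℝ) {x y : Fin n → ℝ} {k : Fin n}
    (hx : x k ∈ Set.Icc 0 M) (hr : N * lam ^ 2 ≤ r) :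
    gradBound (fun j => (u j).1) (fun j => (u j).2) x y lam k
      ≤ 64 * N * (r + 1) * (M ^ 4 * meanSqSlope u ^ 2 + meanSqIntercept u ^ 2)
        + 8 * N * y k ^ 4 := by
  have hN' : (0 : ℝ) < N := by positivity
  have hf := norm_sq_features_le hN hx u
  rw [gradBound]
  set f := ‖features (fun j => (u j).1) (fun j => (u j).2) (x k)‖ ^ 2
  set q := 2 * (M ^ 2 * meanSqSlope u + meanSqIntercept u) with hq
  have hf0 : 0 ≤ f := sq_nonneg _
  have hq0 : 0 ≤ q := nonneg_of_mul_nonneg_right (hf0.trans hf) hN'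
  have hr0 : 0 ≤ r := (by positivity : 0 ≤ N * lam ^ 2).trans hr
  have h1 : lam ^ 2 * f ≤ r * q := by
    calc lam ^ 2 * f ≤ lam ^ 2 * (N * q) := mul_le_mul_of_nonneg_left hf (sq_nonneg _)
      _ = N * lam ^ 2 * q := by ring
      _ ≤ r * q := mul_le_mul_of_nonneg_right hr hq0
  have h2 : q ^ 2 ≤ 8 * (M ^ 4 * meanSqSlope u ^ 2 + meanSqIntercept u ^ 2) := by
    rw [hq]
    nlinarith [sq_nonneg (M ^ 2 * meanSqSlope u - meanSqIntercept u)]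
  calc 8 * f * (lam ^ 2 * f + y k ^ 2)
      ≤ 8 * (N * q) * (r * q + y k ^ 2) := by gcongr
    _ = 8 * N * (r * q ^ 2 + q * y k ^ 2) := by ring
    _ ≤ 8 * N * ((r + 1) * q ^ 2 + y k ^ 4) := by
        refine mul_le_mul_of_nonneg_left ?_ (by positivity)
        nlinarith [sq_nonneg (q - y k ^ 2), sq_nonneg q, sq_nonneg (y k ^ 2)]
    _ ≤ 8 * N * ((r + 1) * (8 * (M ^ 4 * meanSqSlope u ^ 2 + meanSqIntercept u ^ 2)) + y k ^ 4) := by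
        gcongr
    _ = _ := by ring

theorem uniformMean_gradBound_le (hN : 0 < N) (hn : 0 < n) {M r lam : ℝ} (u : Fin N → ℝ × ℝ)
    {x y : Fin n → ℝ} (hx : ∀ k, x k ∈ Set.Icc 0 M) (hr : N * lam ^ 2 ≤ r) :
    uniformMean (gradBound (fun j => (u j).1) (fun j => (u j).2) x y lam)
      ≤ 64 * N * (r + 1) * (M ^ 4 * meanSqSlope u ^ 2 + meanSqIntercept u ^ 2)
        + 8 * N * ((1 / (n : ℝ)) * ∑ k, y k ^ 4) := by
  have : Nonempty (Fin n) := ⟨⟨0, hn⟩⟩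
  refine (uniformMean_mono fun k => gradBound_le hN u (hx k) hr).trans (le_of_eq ?_)
  rw [uniformMean_add, uniformMean_const, uniformMean_const_mul]
  simp [uniformMean]

theorem measurable_ballProj (lam : ℝ) :
    Measurable (ballProj lam : EuclideanSpace ℝ (Fin N) → EuclideanSpace ℝ (Fin N)) := by
  unfold ballProj
  exact Measurable.ite (measurableSet_le measurable_norm measurable_const) measurable_id
    ((measurable_const.div measurable_norm).smul measurable_id)

theorem measurable_sgd {E : Type*} [MeasurableSpace E] {u : E → Fin N → ℝ × ℝ}
    {x y : E → Fin n → ℝ} (hu : Measurable u) (hx : Measurable x) (hy : Measurable y)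
    (lam η₀ : ℝ) (J : Fin 𝔅 → ℕ → Fin n) (t : ℕ) :
    Measurable fun z => sgd (fun j => (u z j).1) (fun j => (u z j).2) (x z) (y z) lam η₀ J t := by
  match t with
  | 0 => exact measurable_const
  | 1 => exact measurable_const
  | t + 2 =>
    have h1 := measurable_sgd hu hx hy lam η₀ J (t + 1)
    have hf : ∀ k, Measurable fun z =>
        features (fun j => (u z j).1) (fun j => (u z j).2) (x z k) := fun k => by
      refine (WithLp.measurable_toLp 2 _).comp (measurable_pi_lambda _ fun j => ?_)
      have h2 : Measurable fun z => u z j := (measurable_pi_apply j).comp hu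
      exact measurable_relu.comp ((h2.fst.mul ((measurable_pi_apply k).comp hx)).add h2.snd)
    have hy' : ∀ k, Measurable fun z => y z k := fun k => (measurable_pi_apply k).comp hy
    simp_rw [sgd_succ _ _ _ _ lam η₀ J (show 1 ≤ t + 1 by omega), batchGradient]
    refine (measurable_ballProj lam).comp (h1.sub
      (((Finset.measurable_fun_sum _ fun i _ => ?_).const_smul (2 / (𝔅 : ℝ))).const_smul
        (η₀ / √((t + 1 : ℕ) : ℝ))))
    exact ((h1.inner (hf _)).sub (hy' _)).smul (hf _)

variable {Ω : Type*} [MeasurableSpace Ω] {P : Measure Ω} [IsProbabilityMeasure P] {ν M : ℝ}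
  {πb : ℝ → ℝ} {με : Measure ℝ} {A B : Fin N → Ω → ℝ}
  {X ε : Fin n → Ω → ℝ} {Xbar : Ω → ℝ} {h : ℝ → ℝ} {g : ℝ × ℝ → ℝ} {cl : ℝ} {T : ℕ}
  {J : Fin 𝔅 → ℕ → Ω → Fin n}

/-- The batch indices may be integrated out first, as a uniform average over all index arrays. -/
theorem IsBatchSample.lintegral_eq (hJ : IsBatchSample P T A B X ε Xbar J)
    (hs : IsSample P ν M πb με A B X ε Xbar)
    {Φ : (Fin 𝔅 × Finset.Icc 1 T → Fin n) →
      ((Fin N → ℝ × ℝ) × (Fin n → ℝ × ℝ)) × ℝ → ENNReal} (hΦ : ∀ j, Measurable (Φ j)) :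
    ∫⁻ ω, Φ (fun k => J k.1 k.2 ω) ((hiddenPairs A B ω, hiddenPairs X ε ω), Xbar ω) ∂P
      = ∑ j, ENNReal.ofReal (Fintype.card (Fin 𝔅 × Finset.Icc 1 T → Fin n) : ℝ)⁻¹
        * ∫⁻ ω, Φ j ((hiddenPairs A B ω, hiddenPairs X ε ω), Xbar ω) ∂P := by
  have hJm : ∀ k : Fin 𝔅 × Finset.Icc 1 T, Measurable (J k.1 k.2) := fun k =>
    hJ.measurable_J k.1 k.2 k.2.2
  have hJm' : Measurable fun ω => fun k : Fin 𝔅 × Finset.Icc 1 T => J k.1 k.2 ω :=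
    measurable_pi_lambda _ hJm
  have hZm : Measurable fun ω => ((hiddenPairs A B ω, hiddenPairs X ε ω), Xbar ω) :=
    (hs.measurable_hiddenPairs.prodMk hs.measurable_samplePairs).prodMk hs.measurable_Xbar
  have hind : IndepFun (fun ω => fun k : Fin 𝔅 × Finset.Icc 1 T => J k.1 k.2 ω)
      (fun ω => ((hiddenPairs A B ω, hiddenPairs X ε ω), Xbar ω)) P :=
    hJ.indep.comp (φ := id)
      (ψ := fun z : ((Fin N → ℝ) × (Fin N → ℝ)) × ((Fin n → ℝ) × (Fin n → ℝ)) × ℝ =>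
        ((fun j => (z.1.1 j, z.1.2 j), fun i => (z.2.1.1 i, z.2.1.2 i)), z.2.2))
      measurable_id (by fun_prop)
  have hprod := (indepFun_iff_map_prod_eq_prod_map_map hJm'.aemeasurable hZm.aemeasurable).1 hind
  have hpi := (iIndepFun_iff_map_fun_eq_pi_map fun k => (hJm k).aemeasurable).1 hJ.indep_J
  have hΦ' : Measurable fun p : (Fin 𝔅 × Finset.Icc 1 T → Fin n)
      × (((Fin N → ℝ × ℝ) × (Fin n → ℝ × ℝ)) × ℝ) => Φ p.1 p.2 :=
    measurable_from_prod_countable_right hΦ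
  have hsingle : ∀ j : Fin 𝔅 × Finset.Icc 1 T → Fin n,
      P.map (fun ω => fun k : Fin 𝔅 × Finset.Icc 1 T => J k.1 k.2 ω) {j}
      = ENNReal.ofReal (Fintype.card (Fin 𝔅 × Finset.Icc 1 T → Fin n) : ℝ)⁻¹ := fun j => by
    have : ∀ k : Fin 𝔅 × Finset.Icc 1 T, IsProbabilityMeasure (P.map (J k.1 k.2)) := fun k =>
      Measure.isProbabilityMeasure_map (hJm k).aemeasurable
    rw [hpi, Measure.pi_singleton]
    have h1 : ∀ k : Fin 𝔅 × Finset.Icc 1 T, P.map (J k.1 k.2) {j k}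
        = ENNReal.ofReal (1 / (n : ℝ)) := fun k => by
      have hn : 0 < n := (j k).pos
      rw [hJ.law_J k.1 k.2 k.2.2, uniformOn_univ, Measure.count_singleton, Fintype.card_fin,
        ENNReal.ofReal_div_of_pos (by positivity), ENNReal.ofReal_one, ENNReal.ofReal_natCast]
    rw [Finset.prod_congr rfl fun k _ => h1 k, Finset.prod_const, ← ENNReal.ofReal_pow (by positivity)]
    congr 1
    rw [one_div, inv_pow, Fintype.card_fun, Fintype.card_fin, Finset.card_univ]
    push_cast
    rfl
  have h1 : ∫⁻ ω, Φ (fun k => J k.1 k.2 ω) ((hiddenPairs A B ω, hiddenPairs X ε ω), Xbar ω) ∂P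
      = ∫⁻ p, Φ p.1 p.2 ∂(P.map fun ω => ((fun k : Fin 𝔅 × Finset.Icc 1 T => J k.1 k.2 ω),
        ((hiddenPairs A B ω, hiddenPairs X ε ω), Xbar ω))) :=
    (lintegral_map hΦ' (hJm'.prodMk hZm)).symm
  have : IsProbabilityMeasure (P.map fun ω => ((hiddenPairs A B ω, hiddenPairs X ε ω), Xbar ω)) :=
    Measure.isProbabilityMeasure_map hZm.aemeasurable
  have : IsProbabilityMeasure (P.map fun ω => fun k : Fin 𝔅 × Finset.Icc 1 T => J k.1 k.2 ω) :=
    Measure.isProbabilityMeasure_map hJm'.aemeasurable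
  rw [h1, hprod, lintegral_prod _ hΦ'.aemeasurable, lintegral_fintype]
  refine Finset.sum_congr rfl fun j _ => ?_
  rw [hsingle, mul_comm, lintegral_map (hΦ j) hZm]

end StochasticGradient

/-! ### Test error of stochastic gradient descent -/

section StochasticGradientTest

variable {N n 𝔅 : ℕ} {Ω : Type*} [MeasurableSpace Ω] {P : Measure Ω} [IsProbabilityMeasure P]
  {ν M : ℝ} {πb : ℝ → ℝ} {με : Measure ℝ} [IsProbabilityMeasure με] {A B : Fin N → Ω → ℝ}
  {X ε : Fin n → Ω → ℝ} {Xbar : Ω → ℝ} {h : ℝ → ℝ} {g : ℝ × ℝ → ℝ} {cl : ℝ} {T : ℕ}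
  {J : Fin 𝔅 → ℕ → Ω → Fin n}

/-- The analogue of `lintegral_interceptBound_sq_le` for arbitrary weights in the ball, where a
fourth moment of the intercepts is needed. -/
theorem lintegral_meanSqIntercept_sq_le (hN : 0 < N) {ρ : Measure (ℝ × ℝ)}
    [IsProbabilityMeasure ρ] {α : ℝ} (hα0 : 0 ≤ α)
    (hα : ∫⁻ p, ENNReal.ofReal (p.2 ^ 4) ∂ρ ≤ ENNReal.ofReal α) {μV : Measure (Fin n → ℝ × ℝ)}
    [IsProbabilityMeasure μV] (r : ℝ) :
    ∫⁻ p, ENNReal.ofReal ((r * meanSqIntercept p.1 + 1 + r) ^ 2)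
      ∂((Measure.pi fun _ : Fin N => ρ).prod μV)
      ≤ ENNReal.ofReal (2 * (1 + r) ^ 2 + 2 * r ^ 2 * α) := by
  have h := lintegral_ofReal_le_of_le_add (μ := (Measure.pi fun _ : Fin N => ρ).prod μV)
    (F := fun p => (r * meanSqIntercept p.1 + 1 + r) ^ 2) (f₁ := fun p => meanSqIntercept p.1 ^ 2)
    (f₂ := fun _ => 0) (c₀ := 2 * (1 + r) ^ 2) (c₁ := 2 * r ^ 2) (c₂ := 0) (α₂ := 0)
    ((measurable_meanSqIntercept.comp measurable_fst).pow_const 2) (by positivity) (by positivity)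
    le_rfl hα0 le_rfl
    (.of_forall fun p => by nlinarith [sq_nonneg (1 + r - r * meanSqIntercept p.1)])
    ((measurePreserving_fst.lintegral_comp
      (measurable_meanSqIntercept.pow_const 2).ennreal_ofReal).trans_le
      (lintegral_sq_meanSqIntercept_le hN hα)) (by simp)
  simpa using h

/-- The expected optimization error of stochastic gradient descent. -/
theorem lintegral_optimizationError_le (hN : 0 < N) (hn : 0 < n) {ρ : Measure (ℝ × ℝ)}
    [IsProbabilityMeasure ρ] {μX : Measure ℝ} [IsProbabilityMeasure μX]
    (hX : ∀ᵐ x ∂μX, x ∈ Set.Icc 0 M) (hhm : Measurable h)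
    (hh : ∀ x ∈ Set.Icc 0 M, 0 ≤ h x ∧ h x ≤ M) (hε : Integrable (fun e : ℝ => e ^ 4) με)
    {αA αB : ℝ} (hαA0 : 0 ≤ αA) (hαB0 : 0 ≤ αB)
    (hαA : ∫⁻ p, ENNReal.ofReal (p.1 ^ 4) ∂ρ ≤ ENNReal.ofReal αA)
    (hαB : ∫⁻ p, ENNReal.ofReal (p.2 ^ 4) ∂ρ ≤ ENNReal.ofReal αB) {c₀ c₁ c₂ : ℝ} (hc₀ : 0 ≤ c₀)
    (hc₁ : 0 ≤ c₁) (hc₂ : 0 ≤ c₂) :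
    ∫⁻ p, ENNReal.ofReal (c₀ + c₁ * (M ^ 4 * meanSqSlope p.1 ^ 2 + meanSqIntercept p.1 ^ 2)
        + c₂ * ((1 / (n : ℝ)) * ∑ i, (h (p.2 i).1 + (p.2 i).2) ^ 4))
      ∂((Measure.pi fun _ : Fin N => ρ).prod (Measure.pi fun _ : Fin n => μX.prod με))
      ≤ ENNReal.ofReal (c₀ + c₁ * (M ^ 4 * αA + αB)
        + c₂ * (8 * M ^ 4 + 8 * ∫ e, e ^ 4 ∂με)) := by
  have h0 : 0 ≤ ∫ e, e ^ 4 ∂με := integral_nonneg fun _ => by positivity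
  have hf : Measurable fun v : Fin n → ℝ × ℝ =>
      (1 / (n : ℝ)) * ∑ i, (h (v i).1 + (v i).2) ^ 4 :=
    (Finset.measurable_fun_sum _ fun i _ => ((hhm.comp (measurable_pi_apply i).fst).add
      (measurable_pi_apply i).snd).pow_const 4).const_mul _
  have hS := (measurable_meanSqSlope (N := N)).pow_const 2
  have hB := (measurable_meanSqIntercept (N := N)).pow_const 2
  have hu : ∫⁻ u, ENNReal.ofReal (M ^ 4 * meanSqSlope u ^ 2 + meanSqIntercept u ^ 2)
      ∂(Measure.pi fun _ : Fin N => ρ) ≤ ENNReal.ofReal (M ^ 4 * αA + αB) := by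
    have h1 := lintegral_ofReal_le_of_le_add (μ := Measure.pi fun _ : Fin N => ρ)
      (F := fun u => M ^ 4 * meanSqSlope u ^ 2 + meanSqIntercept u ^ 2)
      (f₁ := fun u => meanSqSlope u ^ 2) (f₂ := fun u => meanSqIntercept u ^ 2)
      (c₀ := 0) (c₁ := M ^ 4) (c₂ := 1) hS le_rfl (by positivity) zero_le_one hαA0 hαB0
      (.of_forall fun u => by linarith) (lintegral_sq_meanSqSlope_le hN hαA)
      (lintegral_sq_meanSqIntercept_le hN hαB)
    simpa using h1
  have hm : Measurable fun u : Fin N → ℝ × ℝ =>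
      M ^ 4 * meanSqSlope u ^ 2 + meanSqIntercept u ^ 2 := (hS.const_mul _).add hB
  have hfst : ∫⁻ p, ENNReal.ofReal (M ^ 4 * meanSqSlope p.1 ^ 2 + meanSqIntercept p.1 ^ 2)
      ∂((Measure.pi fun _ : Fin N => ρ).prod (Measure.pi fun _ : Fin n => μX.prod με))
      ≤ ENNReal.ofReal (M ^ 4 * αA + αB) :=
    (measurePreserving_fst.lintegral_comp hm.ennreal_ofReal).trans_le hu
  have hsnd : ∫⁻ p, ENNReal.ofReal ((1 / (n : ℝ)) * ∑ i, (h (p.2 i).1 + (p.2 i).2) ^ 4)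
      ∂((Measure.pi fun _ : Fin N => ρ).prod (Measure.pi fun _ : Fin n => μX.prod με))
      ≤ ENNReal.ofReal (8 * M ^ 4 + 8 * ∫ e, e ^ 4 ∂με) :=
    (measurePreserving_snd.lintegral_comp hf.ennreal_ofReal).trans_le
      (lintegral_mean_quote_pow_four_le hn hX hhm hh hε)
  exact lintegral_ofReal_le_of_le_add (hm.comp measurable_fst) hc₀ hc₁ hc₂ (by positivity)
    (by positivity) (.of_forall fun p => le_rfl) hfst hsnd

/-- For fixed data, the error of stochastic gradient descent averaged over the batch indices. -/
theorem uniformMean_integral_sq_sgd_le (hN : 0 < N) (hn : 0 < n) (h𝔅 : 0 < 𝔅) (hT : 1 ≤ T)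
    {μX : Measure ℝ} [IsProbabilityMeasure μX] (hX : ∀ᵐ x ∂μX, x ∈ Set.Icc 0 M)
    (hhm : Measurable h) (hh : ∀ x ∈ Set.Icc 0 M, 0 ≤ h x ∧ h x ≤ M)
    (hg0 : ∀ p, 0 ≤ g p ∧ g p ≤ cl) (hg : ∀ p, g p ≠ 0 → p.2 ≤ 0) (u : Fin N → ℝ × ℝ)
    {v : Fin n → ℝ × ℝ} (hv : ∀ i, (v i).1 ∈ Set.Icc 0 M) {lam η₀ r : ℝ} (hlam0 : 0 ≤ lam)
    (hcl : cl ^ 2 ≤ N * lam ^ 2) (hr : N * lam ^ 2 ≤ r) (hη : 0 < η₀) :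
    uniformMean (fun j : Fin 𝔅 × Finset.Icc 1 T → Fin n => ∫ x, (h x -
        network (fun j => (u j).1) (fun j => (u j).2) (sgd (fun j => (u j).1) (fun j => (u j).2)
          (fun i => (v i).1) (fun i => h (v i).1 + (v i).2) lam η₀ (extendBatch hn j) T) x) ^ 2 ∂μX)
      ≤ ((2 * r / η₀) * ((2 + Real.log T) / √T)
          + (η₀ * (64 * N * (r + 1)) * ((2 + Real.log T) / √T))
            * (M ^ 4 * meanSqSlope u ^ 2 + meanSqIntercept u ^ 2)
          + (η₀ * (8 * N) * ((2 + Real.log T) / √T))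
            * ((1 / (n : ℝ)) * ∑ i, (h (v i).1 + (v i).2) ^ 4))
        + (approxError h g u v + 5 * (r * meanSqIntercept u + 1 + r) ^ 2 / √n
          + √n * featureError μX h u v) := by
  have hne : Nonempty (Fin 𝔅 × Finset.Icc 1 T → Fin n) := ⟨fun _ => ⟨0, hn⟩⟩
  have hN' : (0 : ℝ) < N := by positivity
  have hr0 : 0 ≤ r := (by positivity : 0 ≤ N * lam ^ 2).trans hr
  have hlog : 0 ≤ (2 + Real.log T) / √T := by
    have := Real.log_nonneg (by exact_mod_cast hT : (1 : ℝ) ≤ T)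
    positivity
  have hlamr : lam ^ 2 ≤ r := by
    have h1 : (1 : ℝ) ≤ N := by exact_mod_cast hN
    nlinarith [sq_nonneg lam]
  have hnorm : ∀ W : EuclideanSpace ℝ (Fin N), ‖W‖ ≤ lam → N * ‖W‖ ^ 2 ≤ r := fun W hWn =>
    (mul_le_mul_of_nonneg_left (pow_le_pow_left₀ (norm_nonneg _) hWn 2) hN'.le).trans hr
  have happ : ‖approxWeights g u‖ ≤ lam :=
    (abs_le_of_sq_le_sq' (le_of_mul_le_mul_left
      ((approxWeights_norm_sq_mul_le hN hg0 u).trans hcl) hN') hlam0).2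
  have h2 : ∀ j : Fin 𝔅 × Finset.Icc 1 T → Fin n, ‖sgd (fun j => (u j).1) (fun j => (u j).2)
      (fun i => (v i).1) (fun i => h (v i).1 + (v i).2) lam η₀ (extendBatch hn j) T‖ ≤ lam :=
    fun j => norm_sgd_le _ _ _ _ _ _ hlam0 _ _
  have h3 := uniformMean_mono fun j => integral_sq_network_sub_le hN hn hX hhm hh hg u v
    (sgd (fun j => (u j).1) (fun j => (u j).2)
      (fun i => (v i).1) (fun i => h (v i).1 + (v i).2) lam η₀ (extendBatch hn j) T) hr0
    (κ := r * meanSqIntercept u)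
    (mul_nonneg hr0 (meanSqIntercept_nonneg u)) (hnorm _ (h2 j)) (hnorm _ happ)
    ((network_zero_sq_le hN u _).trans (mul_le_mul_of_nonneg_right (hnorm _ (h2 j))
      (meanSqIntercept_nonneg u)))
  rw [uniformMean_add, uniformMean_const] at h3
  refine h3.trans (add_le_add_left ?_ _)
  have h5 := uniformMean_gradBound_le hN hn (y := fun i => h (v i).1 + (v i).2) u
    (x := fun i => (v i).1) hv hr
  have h7 : 4 * lam ^ 2 / (2 * η₀) ≤ 2 * r / η₀ := by
    rw [div_le_div_iff₀ (by positivity) hη]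
    nlinarith
  refine (uniformMean_empiricalRisk_sgd_le (𝔅 := 𝔅) (fun j => (u j).1) (fun j => (u j).2)
    (fun i => (v i).1) (fun i => h (v i).1 + (v i).2) lam η₀ hn h𝔅 hlam0 hη hT happ).trans ?_
  refine (le_of_eq (by ring)).trans ((mul_le_mul_of_nonneg_right
    (add_le_add h7 (mul_le_mul_of_nonneg_left h5 hη.le)) hlog).trans (le_of_eq (by ring)))

/-- The test error of projected stochastic gradient descent. -/
theorem IsSample.lintegral_sgd_le (hs : IsSample P ν M πb με A B X ε Xbar)
    (hJ : IsBatchSample P T A B X ε Xbar J) (hM : 0 < M)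
    (hN : 0 < N) (hn : 0 < n) (hT : 1 ≤ T) (h𝔅 : 0 < 𝔅) [IsProbabilityMeasure (studentT ν)]
    [IsProbabilityMeasure (interceptLaw πb)]
    (hrep : FeatureRepresentation ((studentT ν).prod (interceptLaw πb)) h g cl M)
    (hε : MemLp (fun e : ℝ => e) 2 με) (hε4 : Integrable (fun e : ℝ => e ^ 4) με)
    (hε0 : ∫ e, e ∂με = 0) {αA αB : ℝ} (hαA0 : 0 ≤ αA) (hαB0 : 0 ≤ αB)
    (hαA : ∫⁻ p, ENNReal.ofReal (p.1 ^ 4) ∂((studentT ν).prod (interceptLaw πb))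
      ≤ ENNReal.ofReal αA)
    (hαB : ∫⁻ p, ENNReal.ofReal (p.2 ^ 4) ∂((studentT ν).prod (interceptLaw πb))
      ≤ ENNReal.ofReal αB) {cu lam η₀ : ℝ} (hlam : lam ∈ Set.Icc (cl / √N) (cu / √N))
    (hcl : 0 ≤ cl) (hη : 0 < η₀) :
    ∫⁻ ω, ENNReal.ofReal ((h (Xbar ω) -
        network (fun j => A j ω) (fun j => B j ω) (sgd (fun j => A j ω) (fun j => B j ω)
          (fun i => X i ω) (fun i => quote h X ε i ω) lam η₀ (fun i t => J i t ω) T)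
          (Xbar ω)) ^ 2) ∂P
      ≤ ENNReal.ofReal (((2 * cu ^ 2 / η₀
            + η₀ * (64 * N * (cu ^ 2 + 1)) * (M ^ 4 * αA + αB)
            + η₀ * (8 * N) * (8 * M ^ 4 + 8 * ∫ e, e ^ 4 ∂με)) * ((2 + Real.log T) / √T))
        + ((2 * M * cl) ^ 2 / N
        + (5 * (2 * (1 + cu ^ 2) ^ 2 + 2 * (cu ^ 2) ^ 2 * αB)
          + ((∫ e, e ^ 2 ∂με) + 1 / 2) * (2 * (1 + M ^ 2) ^ 2 + 2 * M ^ 4 * αA)) / √n)) := by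
  have := isProbabilityMeasure_strikeLaw hM
  have h20 : 0 ≤ ∫ e, e ^ 2 ∂με := integral_nonneg fun _ => by positivity
  have h40 : 0 ≤ ∫ e, e ^ 4 ∂με := integral_nonneg fun _ => by positivity
  have hlog : 0 ≤ (2 + Real.log T) / √T := by
    have := Real.log_nonneg (by exact_mod_cast hT : (1 : ℝ) ≤ T)
    positivity
  obtain ⟨hlam0, hlam1, hlam2⟩ := sq_mul_le_of_mem_Icc hN hcl hlam
  set W : (Fin 𝔅 × Finset.Icc 1 T → Fin n) → (Fin N → ℝ × ℝ) × (Fin n → ℝ × ℝ) →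
      EuclideanSpace ℝ (Fin N) := fun j z =>
    sgd (fun j => (z.1 j).1) (fun j => (z.1 j).2) (fun i => (z.2 i).1)
      (fun i => h (z.2 i).1 + (z.2 i).2) lam η₀ (extendBatch hn j) T with hWdef
  have hWm : ∀ j, Measurable (W j) := fun j => by
    have h1 : ∀ i, Measurable fun z : (Fin N → ℝ × ℝ) × (Fin n → ℝ × ℝ) => z.2 i := fun i =>
      (measurable_pi_apply i).comp measurable_snd
    exact measurable_sgd measurable_fst (measurable_pi_lambda _ fun i => (h1 i).fst)
      (measurable_pi_lambda _ fun i => (hrep.measurable_target.comp (h1 i).fst).add (h1 i).snd)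
      lam η₀ (extendBatch hn j) T
  have hWW : ∀ ω, sgd (fun j => A j ω) (fun j => B j ω) (fun i => X i ω)
      (fun i => quote h X ε i ω) lam η₀ (fun i t => J i t ω) T
      = W (fun k => J k.1 k.2 ω) (hiddenPairs A B ω, hiddenPairs X ε ω) := fun ω =>
    sgd_congr _ _ _ _ _ _ fun i s h1 h2 => by
      rw [extendBatch, dif_pos (Finset.mem_Icc.2 ⟨h1, h2.le⟩)]
  set δ : (Fin N → ℝ × ℝ) × (Fin n → ℝ × ℝ) → ℝ := fun p =>
    (2 * cu ^ 2 / η₀) * ((2 + Real.log T) / √T)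
      + (η₀ * (64 * N * (cu ^ 2 + 1)) * ((2 + Real.log T) / √T))
        * (M ^ 4 * meanSqSlope p.1 ^ 2 + meanSqIntercept p.1 ^ 2)
      + (η₀ * (8 * N) * ((2 + Real.log T) / √T))
        * ((1 / (n : ℝ)) * ∑ i, (h (p.2 i).1 + (p.2 i).2) ^ 4) with hδ
  have hκm : Measurable fun p : (Fin N → ℝ × ℝ) × (Fin n → ℝ × ℝ) =>
      cu ^ 2 * meanSqIntercept p.1 := (measurable_meanSqIntercept.comp measurable_fst).const_mul _
  have hremm := measurable_remainder (μX := strikeLaw M)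
    (κ := fun u (_ : Fin n → ℝ × ℝ) => cu ^ 2 * meanSqIntercept u) hrep.measurable_target
    hrep.measurable_weight hκm (cu ^ 2)
  have hδm : Measurable δ := by
    have h1 : ∀ i, Measurable fun z : (Fin N → ℝ × ℝ) × (Fin n → ℝ × ℝ) => z.2 i := fun i =>
      (measurable_pi_apply i).comp measurable_snd
    refine Measurable.add (Measurable.add measurable_const (Measurable.const_mul (Measurable.add
      (((measurable_meanSqSlope.comp measurable_fst).pow_const 2).const_mul _)
      ((measurable_meanSqIntercept.comp measurable_fst).pow_const 2)) _)) ?_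
    exact ((Finset.measurable_fun_sum _ fun i _ => ((hrep.measurable_target.comp (h1 i).fst).add
      (h1 i).snd).pow_const 4).const_mul _).const_mul _
  have hcard : (0 : ℝ) ≤ (Fintype.card (Fin 𝔅 × Finset.Icc 1 T → Fin n) : ℝ)⁻¹ := by positivity
  have hIm : ∀ j, Measurable fun ω => ENNReal.ofReal (∫ x, (h x -
      network (fun j => A j ω) (fun j => B j ω)
        (W j (hiddenPairs A B ω, hiddenPairs X ε ω)) x) ^ 2 ∂(strikeLaw M)) := fun j =>
    ((measurable_sq_sub_network hrep.measurable_target hs.measurable_hiddenPairs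
      ((hWm j).comp (hs.measurable_hiddenPairs.prodMk
        hs.measurable_samplePairs))).stronglyMeasurable.integral_prod_right').measurable.ennreal_ofReal
  simp_rw [hWW]
  have hbatch := hJ.lintegral_eq hs (Φ := fun j z => ENNReal.ofReal ((h z.2 -
    network (fun j => (z.1.1 j).1) (fun j => (z.1.1 j).2) (W j z.1) z.2) ^ 2)) fun j =>
      (measurable_sq_sub_network hrep.measurable_target
        (measurable_fst (α := Fin N → ℝ × ℝ) (β := Fin n → ℝ × ℝ)) (hWm j)).ennreal_ofReal
  refine hbatch.trans_le ?_
  calc ∑ j, ENNReal.ofReal (Fintype.card (Fin 𝔅 × Finset.Icc 1 T → Fin n) : ℝ)⁻¹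
        * ∫⁻ ω, ENNReal.ofReal ((h (Xbar ω) - network (fun j => A j ω) (fun j => B j ω)
          (W j (hiddenPairs A B ω, hiddenPairs X ε ω)) (Xbar ω)) ^ 2) ∂P
      = ∫⁻ ω, ∑ j, ENNReal.ofReal (Fintype.card (Fin 𝔅 × Finset.Icc 1 T → Fin n) : ℝ)⁻¹
        * ENNReal.ofReal (∫ x, (h x - network (fun j => A j ω) (fun j => B j ω)
          (W j (hiddenPairs A B ω, hiddenPairs X ε ω)) x) ^ 2 ∂(strikeLaw M)) ∂P := by
        rw [lintegral_finsetSum _ fun j _ => (hIm j).const_mul _]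
        refine Finset.sum_congr rfl fun j _ => ?_
        rw [lintegral_const_mul' _ _ ENNReal.ofReal_ne_top,
          hs.lintegral_sq_test_eq hM hN hrep.measurable_target hrep.target_mem (hWm j)]
    _ = ∫⁻ ω, ENNReal.ofReal (uniformMean fun j => ∫ x, (h x -
          network (fun j => A j ω) (fun j => B j ω)
          (W j (hiddenPairs A B ω, hiddenPairs X ε ω)) x) ^ 2 ∂(strikeLaw M)) ∂P := by
        refine lintegral_congr fun ω => ?_
        rw [uniformMean, ENNReal.ofReal_mul hcard, ENNReal.ofReal_sum_of_nonneg fun j _ =>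
          integral_nonneg fun x => sq_nonneg _, Finset.mul_sum]
    _ ≤ ∫⁻ ω, (ENNReal.ofReal (δ (hiddenPairs A B ω, hiddenPairs X ε ω))
          + ENNReal.ofReal (approxError h g (hiddenPairs A B ω) (hiddenPairs X ε ω)
          + 5 * (cu ^ 2 * meanSqIntercept (hiddenPairs A B ω) + 1 + cu ^ 2) ^ 2 / √n
          + √n * featureError (strikeLaw M) h (hiddenPairs A B ω) (hiddenPairs X ε ω))) ∂P := by
        refine lintegral_mono_ae ?_
        filter_upwards [hs.ae_strikes_mem] with ω h1
        refine (ENNReal.ofReal_le_ofReal ?_).trans ENNReal.ofReal_add_le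
        exact uniformMean_integral_sq_sgd_le hN hn h𝔅 hT (ae_strikeLaw_mem M)
          hrep.measurable_target hrep.target_mem hrep.weight_mem
          (fun p hp => (hrep.support p hp).2.2) (hiddenPairs A B ω) h1 hlam0 hlam1 hlam2 hη
    _ = ∫⁻ p, ENNReal.ofReal (δ p)
          ∂((Measure.pi fun _ : Fin N => (studentT ν).prod (interceptLaw πb)).prod
          (Measure.pi fun _ : Fin n => (strikeLaw M).prod με))
        + ∫⁻ p, ENNReal.ofReal (approxError h g p.1 p.2
          + 5 * (cu ^ 2 * meanSqIntercept p.1 + 1 + cu ^ 2) ^ 2 / √n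
          + √n * featureError (strikeLaw M) h p.1 p.2)
          ∂((Measure.pi fun _ : Fin N => (studentT ν).prod (interceptLaw πb)).prod
          (Measure.pi fun _ : Fin n => (strikeLaw M).prod με)) := by
        have hδω : Measurable fun ω => ENNReal.ofReal (δ (hiddenPairs A B ω, hiddenPairs X ε ω)) :=
          hδm.ennreal_ofReal.comp (hs.measurable_hiddenPairs.prodMk hs.measurable_samplePairs)
        rw [lintegral_add_left hδω, ← hs.map_hidden_sample hM, lintegral_map hδm.ennreal_ofReal
          (hs.measurable_hiddenPairs.prodMk hs.measurable_samplePairs),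
          lintegral_map hremm.ennreal_ofReal
          (hs.measurable_hiddenPairs.prodMk hs.measurable_samplePairs)]
    _ ≤ ENNReal.ofReal ((2 * cu ^ 2 / η₀) * ((2 + Real.log T) / √T)
          + (η₀ * (64 * N * (cu ^ 2 + 1)) * ((2 + Real.log T) / √T)) * (M ^ 4 * αA + αB)
          + (η₀ * (8 * N) * ((2 + Real.log T) / √T)) * (8 * M ^ 4 + 8 * ∫ e, e ^ 4 ∂με))
        + ENNReal.ofReal ((2 * M * cl) ^ 2 / N
        + (5 * (2 * (1 + cu ^ 2) ^ 2 + 2 * (cu ^ 2) ^ 2 * αB)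
          + ((∫ e, e ^ 2 ∂με) + 1 / 2) * (2 * (1 + M ^ 2) ^ 2 + 2 * M ^ 4 * αA)) / √n) := by
        refine add_le_add ?_ ?_
        · exact lintegral_optimizationError_le hN hn (ae_strikeLaw_mem M)
            hrep.measurable_target hrep.target_mem hε4 hαA0 hαB0 hαA hαB (by positivity)
            (by positivity) (by positivity)
        · exact lintegral_remainder_le (κ := fun u _ => cu ^ 2 * meanSqIntercept u) hM hN hn hrep hε
            hε0 hκm (by positivity) (by positivity)
            (lintegral_meanSqIntercept_sq_le hN hαB0 hαB (cu ^ 2))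
            (lintegral_featureBound_sq_le hN hαA0 hαA M)
    _ = _ := by
        rw [← ENNReal.ofReal_add (by positivity) (by positivity)]
        congr 1
        ring

end StochasticGradientTest

/-! ### Put prices, rates and the conclusion -/

section PutPrice

variable {Ω₀ : Type*} [MeasurableSpace Ω₀] {P₀ : Measure Ω₀} {m : ℕ}
  {w : Fin m → ℝ} {S : Ω₀ → Fin m → ℝ}

theorem measurable_basket (hS : Measurable S) (w : Fin m → ℝ) :
    Measurable fun ω => basket w (S ω) := by
  unfold basket
  exact Finset.measurable_fun_sum _ fun i _ => ((measurable_pi_apply i).comp hS).const_mul _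

theorem ae_basket_nonneg (hw : ∀ i, 0 ≤ w i) (hS0 : ∀ᵐ ω ∂P₀, ∀ i, 0 ≤ S ω i) :
    ∀ᵐ ω ∂P₀, 0 ≤ basket w (S ω) := by
  filter_upwards [hS0] with ω hω
  exact Finset.sum_nonneg fun i _ => mul_nonneg (hw i) (hω i)

theorem charFun_map_basket (hS : Measurable S) (w : Fin m → ℝ) (ξ : ℝ) :
    charFun (P₀.map fun ω => basket w (S ω)) ξ
      = ∫ ω, Complex.exp (-(Complex.I * ((-ξ : ℝ) : ℂ) * (basket w (S ω) : ℂ))) ∂P₀ := by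
  rw [charFun_apply_real, integral_map (measurable_basket hS w).aemeasurable (by fun_prop)]
  congr 1
  ext ω
  congr 1
  push_cast
  ring

theorem ae_norm_payoff_le (hw : ∀ i, 0 ≤ w i) (hS0 : ∀ᵐ ω ∂P₀, ∀ i, 0 ≤ S ω i) {K : ℝ}
    (hK : 0 ≤ K) : ∀ᵐ ω ∂P₀, ‖max (K - basket w (S ω)) 0‖ ≤ K := by
  filter_upwards [ae_basket_nonneg hw hS0] with ω hω
  rw [Real.norm_of_nonneg (le_max_right _ _)]
  exact max_le (by linarith) hK

variable [IsProbabilityMeasure P₀]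

theorem measurable_putPrice (hS : Measurable S) (w : Fin m → ℝ) :
    Measurable (putPrice P₀ w S) := by
  have h1 : Measurable fun p : ℝ × Ω₀ => max (p.1 - basket w (S p.2)) 0 :=
    (measurable_fst.sub ((measurable_basket hS w).comp measurable_snd)).max measurable_const
  exact h1.stronglyMeasurable.integral_prod_right'.measurable

theorem putPrice_mem_Icc (hw : ∀ i, 0 ≤ w i) (hS0 : ∀ᵐ ω ∂P₀, ∀ i, 0 ≤ S ω i) {M K : ℝ}
    (hK : K ∈ Set.Icc 0 M) : 0 ≤ putPrice P₀ w S K ∧ putPrice P₀ w S K ≤ M := by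
  refine ⟨integral_nonneg fun ω => le_max_right _ _, ?_⟩
  have h1 := norm_integral_le_of_norm_le_const (ae_norm_payoff_le hw hS0 hK.1)
  rw [probReal_univ, mul_one] at h1
  exact ((le_abs_self _).trans h1).trans hK.2

theorem ofReal_putPrice (hS : Measurable S) (hw : ∀ i, 0 ≤ w i)
    (hS0 : ∀ᵐ ω ∂P₀, ∀ i, 0 ≤ S ω i) {K : ℝ} (hK : 0 ≤ K) :
    ENNReal.ofReal (putPrice P₀ w S K)
      = ∫⁻ t, ENNReal.ofReal (max (K - t) 0) ∂(P₀.map fun ω => basket w (S ω)) := by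
  have hm := measurable_basket hS w
  have hpay : Measurable fun ω => max (K - basket w (S ω)) 0 :=
    (measurable_const.sub hm).max measurable_const
  rw [lintegral_map (by fun_prop) hm, putPrice, ofReal_integral_eq_lintegral_ofReal
    (Integrable.of_bound hpay.aestronglyMeasurable K (ae_norm_payoff_le hw hS0 hK))
    (.of_forall fun ω => le_max_right _ _)]

/-- If the characteristic function of the basket decays quadratically, the basket has a bounded
density, and the put price is represented by random features with a bounded weight. -/
theorem exists_featureRepresentation {ν : ℝ} (hν : 0 < ν) {πb : ℝ → ℝ} (hπb_meas : Measurable πb)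
    (hπb : AtMostPolynomialDecay πb) {β C M : ℝ} (hβ : 2 ≤ β) (hM : 0 < M) (hw : ∀ i, 0 ≤ w i)
    (hS : Measurable S) (hS0 : ∀ᵐ ω ∂P₀, ∀ i, 0 ≤ S ω i)
    (hdecay : ∀ ξ : ℝ,
      ‖∫ ω, Complex.exp (-(Complex.I * (ξ : ℂ) * (basket w (S ω) : ℂ))) ∂P₀‖ ≤
        C * (1 + |ξ|) ^ (-β)) :
    ∃ g : ℝ × ℝ → ℝ, ∃ cl > (0 : ℝ),
      FeatureRepresentation ((studentT ν).prod (interceptLaw πb)) (putPrice P₀ w S) g cl M := by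
  have hm := measurable_basket hS w
  have : IsProbabilityMeasure (P₀.map fun ω => basket w (S ω)) :=
    Measure.isProbabilityMeasure_map hm.aemeasurable
  obtain ⟨K, hK, f, hf, hfK, hfμ⟩ := exists_bounded_density_of_integrable_charFun
    (integrable_charFun_of_decay (μ := P₀.map fun ω => basket w (S ω)) (C := C) hβ fun ξ => by
      rw [charFun_map_basket hS w ξ, ← abs_neg ξ]
      exact hdecay (-ξ))
  obtain ⟨δA, hδA, hA⟩ := exists_pos_le_studentDensity_on_Icc hν (a := 1) (b := 2) (by norm_num)
  obtain ⟨δB, hδB, hB⟩ := hπb.exists_pos_le_on_Icc (-(2 * M)) 0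
  have hsupp : (volume.withDensity fun t => ENNReal.ofReal (f t)) (Set.Iio 0) = 0 := by
    rw [← hfμ, Measure.map_apply hm measurableSet_Iio]
    exact measure_eq_zero_iff_ae_notMem.2 ((ae_basket_nonneg hw hS0).mono fun ω hω => not_lt.2 hω)
  obtain ⟨g, hg, hgK, hgs, hrep⟩ := exists_bounded_feature_weight hM hK
    (continuous_studentDensity hν).measurable hπb_meas hf hδA hδB hA hB hfK hsupp
  refine ⟨g, K / (δA * δB) + 1, by positivity, measurable_putPrice hS w,
    fun x hx => putPrice_mem_Icc hw hS0 hx, hg, fun p => ⟨(hgK p).1, (hgK p).2.trans (by linarith)⟩,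
    hgs, fun x hx => ?_⟩
  rw [ofReal_putPrice hS hw hS0 hx.1, hfμ]
  exact hrep x hx

end PutPrice

theorem isProbabilityMeasure_interceptLaw {πb : ℝ → ℝ}
    (h : ∫⁻ z, ENNReal.ofReal (πb z) = 1) : IsProbabilityMeasure (interceptLaw πb) :=
  ⟨by rw [interceptLaw, withDensity_apply _ MeasurableSet.univ, Measure.restrict_univ, h]⟩

theorem lintegral_pow_four_interceptLaw_lt_top {πb : ℝ → ℝ} (hπb : Measurable πb)
    (h : Integrable fun z => z ^ 4 * πb z) :
    ∫⁻ z, ENNReal.ofReal (z ^ 4) ∂(interceptLaw πb) < ⊤ := by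
  rw [interceptLaw, lintegral_withDensity_eq_lintegral_mul _ hπb.ennreal_ofReal (by fun_prop)]
  refine lt_of_eq_of_lt (lintegral_congr fun z => ?_) h.lintegral_lt_top
  rw [Pi.mul_apply, mul_comm, ENNReal.ofReal_mul (by positivity)]

theorem sq_rpow_one_div_four {x : ℝ} (hx : 0 ≤ x) : (x ^ (1 / 4 : ℝ)) ^ 2 = √x := by
  rw [← Real.rpow_natCast, ← Real.rpow_mul hx, Real.sqrt_eq_rpow]
  norm_num

/-- The logarithmic factor of the rate is at least `1`; the bound without it is stronger. -/
theorem leastSquares_rate_le {N n : ℕ} (hN : 0 < N) (hn : 0 < n) {a b : ℝ} (ha : 0 ≤ a)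
    (hb : 0 ≤ b) :
    a * N / n + b / N ≤ (√(a + b) * (√(Real.log n + 1) * √N / √n + 1 / √N)) ^ 2 := by
  have hN' : (0 : ℝ) < N := by positivity
  have hn' : (0 : ℝ) < n := by positivity
  have hlog : 0 ≤ Real.log n := Real.log_natCast_nonneg n
  set s := √(Real.log n + 1) * √N / √n with hs
  have hs2 : (N : ℝ) / n ≤ s ^ 2 := by
    rw [hs, div_pow, mul_pow, Real.sq_sqrt (by linarith), Real.sq_sqrt hN'.le, Real.sq_sqrt hn'.le]
    exact div_le_div_of_nonneg_right (by nlinarith) hn'.le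
  have ht2 : (1 / √(N : ℝ)) ^ 2 = 1 / N := by rw [div_pow, Real.sq_sqrt hN'.le, one_pow]
  have hs0 : 0 ≤ s := by positivity
  have ht0 : 0 ≤ 1 / √(N : ℝ) := by positivity
  have h3 : (N : ℝ) / n + 1 / N ≤ (s + 1 / √N) ^ 2 := by
    nlinarith [mul_nonneg hs0 ht0]
  rw [mul_pow, Real.sq_sqrt (by positivity)]
  calc a * N / n + b / N = a * (N / n) + b * (1 / N) := by ring
    _ ≤ (a + b) * (N / n) + (a + b) * (1 / N) := by gcongr <;> linarith
    _ = (a + b) * (N / n + 1 / N) := by ring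
    _ ≤ _ := by gcongr

theorem constrained_rate_le {N n : ℕ} (hN : 0 < N) (hn : 0 < n) {a b : ℝ} (ha : 0 ≤ a)
    (hb : 0 ≤ b) :
    a / N + b / √n ≤ (√(a + b) * (1 / √N + 1 / (n : ℝ) ^ (1 / 4 : ℝ))) ^ 2 := by
  have hN' : (0 : ℝ) < N := by positivity
  have hn' : (0 : ℝ) < √n := Real.sqrt_pos.2 (by positivity)
  have h1 : (1 / √(N : ℝ)) ^ 2 = 1 / N := by rw [div_pow, Real.sq_sqrt hN'.le, one_pow]
  have h2 : (1 / (n : ℝ) ^ (1 / 4 : ℝ)) ^ 2 = 1 / √n := by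
    rw [div_pow, sq_rpow_one_div_four (Nat.cast_nonneg n), one_pow]
  have h10 : 0 ≤ 1 / √(N : ℝ) := by positivity
  have h20 : 0 ≤ 1 / (n : ℝ) ^ (1 / 4 : ℝ) := by positivity
  have h3 : 1 / (N : ℝ) + 1 / √n ≤ (1 / √N + 1 / (n : ℝ) ^ (1 / 4 : ℝ)) ^ 2 := by
    nlinarith [mul_nonneg h10 h20]
  rw [mul_pow, Real.sq_sqrt (by positivity)]
  calc a / N + b / √n = a * (1 / N) + b * (1 / √n) := by ring
    _ ≤ (a + b) * (1 / N) + (a + b) * (1 / √n) := by gcongr <;> linarith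
    _ = (a + b) * (1 / N + 1 / √n) := by ring
    _ ≤ _ := by gcongr

theorem sgd_rate_le {N n T : ℕ} (hN : 0 < N) (hn : 0 < n) {a b c₀ c₁ : ℝ}
    (ha : 0 ≤ a) (hb : 0 ≤ b) (hc₀ : 0 ≤ c₀) (hc₁ : 0 ≤ c₁) :
    (c₀ + c₁ * N) * ((2 + Real.log T) / √T) + (a / N + b / √n)
      ≤ (√(a + b + c₀ + c₁) * (1 / √N + 1 / (n : ℝ) ^ (1 / 4 : ℝ)
        + N * √(2 + Real.log T) / (T : ℝ) ^ (1 / 4 : ℝ))) ^ 2 := by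
  have hN1 : (1 : ℝ) ≤ N := by exact_mod_cast hN
  have hlog : 0 ≤ Real.log T := Real.log_natCast_nonneg T
  have hab := constrained_rate_le hN hn ha hb
  rw [mul_pow, Real.sq_sqrt (by positivity)] at hab
  set s := 1 / √(N : ℝ) + 1 / (n : ℝ) ^ (1 / 4 : ℝ) with hs
  set t := N * √(2 + Real.log T) / (T : ℝ) ^ (1 / 4 : ℝ) with ht
  have hs0 : 0 ≤ s := by positivity
  have ht0 : 0 ≤ t := by positivity
  have ht2 : t ^ 2 = N ^ 2 * ((2 + Real.log T) / √T) := by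
    rw [ht, div_pow, mul_pow, Real.sq_sqrt (by linarith), sq_rpow_one_div_four (Nat.cast_nonneg T)]
    ring
  have h1 : (c₀ + c₁ * N) * ((2 + Real.log T) / √T) ≤ (c₀ + c₁) * t ^ 2 := by
    rw [ht2, ← mul_assoc]
    refine mul_le_mul_of_nonneg_right ?_ (by positivity)
    have h2 : (1 : ℝ) ≤ N ^ 2 := one_le_pow₀ hN1
    have h3 : (N : ℝ) ≤ N ^ 2 := by nlinarith
    nlinarith [mul_le_mul_of_nonneg_left h2 hc₀, mul_le_mul_of_nonneg_left h3 hc₁]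
  rw [mul_pow, Real.sq_sqrt (by positivity)]
  have h4 : s ^ 2 + t ^ 2 ≤ (s + t) ^ 2 := by nlinarith [mul_nonneg hs0 ht0]
  calc (c₀ + c₁ * N) * ((2 + Real.log T) / √T) + (a / N + b / √n)
      ≤ (c₀ + c₁) * t ^ 2 + (a + b) * s ^ 2 := add_le_add h1 hab
    _ ≤ (a + b + c₀ + c₁) * t ^ 2 + (a + b + c₀ + c₁) * s ^ 2 :=
        add_le_add (mul_le_mul_of_nonneg_right (by linarith) (sq_nonneg t))
          (mul_le_mul_of_nonneg_right (by linarith) (sq_nonneg s))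
    _ = (a + b + c₀ + c₁) * (s ^ 2 + t ^ 2) := by ring
    _ ≤ _ := by gcongr

theorem mainTheorem9
    -- the degree of freedom of the law of `A` and the density of the law of `B`
    (ν : ℝ) (hν : 4 < ν)
    (πb : ℝ → ℝ) (hπb_meas : Measurable πb) (hπb_one : ∫⁻ z, ENNReal.ofReal (πb z) = 1)
    (hπb : AtMostPolynomialDecay πb) :
    -- the decay exponent of the characteristic function has to be large, depending on `ν`, `πb`
    ∃ β₀ : ℝ, ∀ β C M : ℝ, β₀ ≤ β → 0 < C → 0 < M →
    -- the basket
    ∀ (m : ℕ) (w : Fin m → ℝ), (∀ i, 0 ≤ w i) →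
    ∀ (Ω₀ : Type u) [MeasurableSpace Ω₀] (P₀ : Measure Ω₀) [IsProbabilityMeasure P₀]
      (S : Ω₀ → Fin m → ℝ), Measurable S → (∀ᵐ ω ∂P₀, ∀ i, 0 ≤ S ω i) →
      (∀ ξ : ℝ, ‖∫ ω, Complex.exp (-(Complex.I * (ξ : ℂ) * (basket w (S ω) : ℂ))) ∂P₀‖ ≤
        C * (1 + |ξ|) ^ (-β)) →
    -- the law of the noise
    ∀ (με : Measure ℝ) [IsProbabilityMeasure με],
      Integrable (fun e : ℝ => e ^ 4) με → ∫ e, e ∂με = 0 →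
    ∃ C₀ > (0 : ℝ), ∃ cl > (0 : ℝ),
      -- least squares
      (∀ (N n : ℕ), 0 < N → 0 < n →
        ∀ (Ω : Type v) [MeasurableSpace Ω] (P : Measure Ω) [IsProbabilityMeasure P]
          (A B : Fin N → Ω → ℝ) (X ε : Fin n → Ω → ℝ) (Xbar : Ω → ℝ),
          IsSample P ν M πb με A B X ε Xbar →
        ∀ What : Ω → EuclideanSpace ℝ (Fin N),
          IsERM P A B X (quote (putPrice P₀ w S) X ε)
            (dataMeasurable A B X (quote (putPrice P₀ w S) X ε)) What →
          eLpNorm (fun ω => putPrice P₀ w S (Xbar ω) -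
              truncate M (network (fun j => A j ω) (fun j => B j ω) (What ω) (Xbar ω))) 2 P ≤
            ENNReal.ofReal (C₀ * (√(Real.log n + 1) * √N / √n + 1 / √N))) ∧
      ∀ cu > (0 : ℝ), ∀ η₀ > (0 : ℝ), ∃ C₁ > (0 : ℝ), ∃ C₂ > (0 : ℝ),
        -- constrained regression
        (∀ (N n : ℕ), 0 < N → 0 < n →
          ∀ (Ω : Type v) [MeasurableSpace Ω] (P : Measure Ω) [IsProbabilityMeasure P]
            (A B : Fin N → Ω → ℝ) (X ε : Fin n → Ω → ℝ) (Xbar : Ω → ℝ),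
            IsSample P ν M πb με A B X ε Xbar →
          ∀ lam ∈ Set.Icc (cl / √N) (cu / √N),
          ∀ What : Ω → EuclideanSpace ℝ (Fin N),
            IsERM P A B X (quote (putPrice P₀ w S) X ε)
              (constrainedWeights P A B X (quote (putPrice P₀ w S) X ε) lam) What →
            eLpNorm (fun ω => putPrice P₀ w S (Xbar ω) -
                network (fun j => A j ω) (fun j => B j ω) (What ω) (Xbar ω)) 2 P ≤
              ENNReal.ofReal (C₁ * (1 / √N + 1 / (n : ℝ) ^ (1 / 4 : ℝ)))) ∧
        -- stochastic gradient descent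
        (Integrable (fun z => z ^ 4 * πb z) →
          ∀ (N n T 𝔅 : ℕ), 0 < N → 0 < n → 2 ≤ T → 0 < 𝔅 → 𝔅 ≤ n →
          ∀ (Ω : Type v) [MeasurableSpace Ω] (P : Measure Ω) [IsProbabilityMeasure P]
            (A B : Fin N → Ω → ℝ) (X ε : Fin n → Ω → ℝ) (Xbar : Ω → ℝ)
            (J : Fin 𝔅 → ℕ → Ω → Fin n),
            IsSample P ν M πb με A B X ε Xbar →
            IsBatchSample P T A B X ε Xbar J →
          ∀ lam ∈ Set.Icc (cl / √N) (cu / √N),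
            eLpNorm (fun ω => putPrice P₀ w S (Xbar ω) -
                network (fun j => A j ω) (fun j => B j ω)
                  (sgd (fun j => A j ω) (fun j => B j ω) (fun i => X i ω)
                    (fun i => quote (putPrice P₀ w S) X ε i ω) lam η₀
                    (fun i t => J i t ω) T) (Xbar ω)) 2 P ≤
              ENNReal.ofReal (C₂ * (1 / √N + 1 / (n : ℝ) ^ (1 / 4 : ℝ) +
                N * √(2 + Real.log T) / (T : ℝ) ^ (1 / 4 : ℝ)))) := by
  refine ⟨2, fun β C M hβ _ hM m w hw Ω₀ _ P₀ _ S hS hS0 hdecay με _ hε4 hε0 => ?_⟩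
  obtain ⟨g, cl, hcl, hrep⟩ := exists_featureRepresentation (by linarith : 0 < ν) hπb_meas hπb hβ hM
    hw hS hS0 hdecay
  have hπ := isProbabilityMeasure_interceptLaw hπb_one
  have hε : MemLp (fun e : ℝ => e) 2 με := by
    refine (memLp_two_iff_integrable_sq (by fun_prop)).2 (((integrable_const 1).add hε4).mono'
      (by fun_prop) (.of_forall fun e => ?_))
    rw [Real.norm_of_nonneg (sq_nonneg e), Pi.add_apply]
    nlinarith [sq_nonneg (e ^ 2 - 1)]
  have h20 : 0 ≤ ∫ e, e ^ 2 ∂με := integral_nonneg fun _ => by positivity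
  have h40 : 0 ≤ ∫ e, e ^ 4 ∂με := integral_nonneg fun _ => by positivity
  set αA : ℝ := (∫⁻ a, ENNReal.ofReal (a ^ 4) ∂(studentT ν)).toReal with hαA
  set αB : ℝ := (∫⁻ z, ENNReal.ofReal (z ^ 4) ∂(interceptLaw πb)).toReal with hαB
  have hαA0 : 0 ≤ αA := ENNReal.toReal_nonneg
  have hαB0 : 0 ≤ αB := ENNReal.toReal_nonneg
  have hA4 : ∀ [IsProbabilityMeasure (studentT ν)],
      ∫⁻ p, ENNReal.ofReal (p.1 ^ 4) ∂((studentT ν).prod (interceptLaw πb))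
        ≤ ENNReal.ofReal αA := fun {_} => by
    rw [hαA, ENNReal.ofReal_toReal (lintegral_pow_four_studentT_lt_top hν).ne]
    exact (measurePreserving_fst.lintegral_comp (f := fun a : ℝ => ENNReal.ofReal (a ^ 4))
      (by fun_prop)).le
  refine ⟨√(8 * (M ^ 2 + ∫ e, e ^ 2 ∂με) + 8 * (2 * M * cl) ^ 2), Real.sqrt_pos.2 (by positivity),
    cl, hcl, fun N n hN hn Ω _ P _ A B X ε Xbar hs What hW => ?_, fun cu hcu η₀ hη =>
    ⟨√((2 * M * cl) ^ 2 + (5 * (3 * (1 + cu ^ 2) ^ 2 + 192 * (8 * M ^ 4 + 8 * ∫ e, e ^ 4 ∂με)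
        + 12 * (cu ^ 2) ^ 2 * M ^ 4 * αA)
        + ((∫ e, e ^ 2 ∂με) + 1 / 2) * (2 * (1 + M ^ 2) ^ 2 + 2 * M ^ 4 * αA))),
      Real.sqrt_pos.2 (by positivity),
      √((2 * M * cl) ^ 2 + (5 * (2 * (1 + cu ^ 2) ^ 2 + 2 * (cu ^ 2) ^ 2 * αB)
        + ((∫ e, e ^ 2 ∂με) + 1 / 2) * (2 * (1 + M ^ 2) ^ 2 + 2 * M ^ 4 * αA))
        + 2 * cu ^ 2 / η₀ + η₀ * (64 * (cu ^ 2 + 1) * (M ^ 4 * αA + αB)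
          + 8 * (8 * M ^ 4 + 8 * ∫ e, e ^ 4 ∂με))), Real.sqrt_pos.2 (by positivity),
      fun N n hN hn Ω _ P _ A B X ε Xbar hs lam hlam What hW => ?_,
      fun hB4 N n T 𝔅 hN hn hT h𝔅 _ Ω _ P _ A B X ε Xbar J hs hJ lam hlam => ?_⟩⟩
  · have := hs.isProbabilityMeasure_studentT hN
    refine eLpNorm_two_le_ofReal (hs.lintegral_truncated_leastSquares_le hM hN hn hrep hε hε0 hW)
      (by positivity) ((le_of_eq ?_).trans
        (leastSquares_rate_le hN hn (by positivity) (by positivity)))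
    ring
  · have := hs.isProbabilityMeasure_studentT hN
    exact eLpNorm_two_le_ofReal (hs.lintegral_constrained_le hM hN hn hrep hε hε4 hε0 hαA0 hA4 hlam
      hcl.le hW) (by positivity) (constrained_rate_le hN hn (by positivity) (by positivity))
  · have := hs.isProbabilityMeasure_studentT hN
    have hB4' : ∫⁻ p, ENNReal.ofReal (p.2 ^ 4) ∂((studentT ν).prod (interceptLaw πb))
        ≤ ENNReal.ofReal αB := by
      rw [hαB, ENNReal.ofReal_toReal (lintegral_pow_four_interceptLaw_lt_top hπb_meas hB4).ne]
      exact (measurePreserving_snd.lintegral_comp (f := fun z : ℝ => ENNReal.ofReal (z ^ 4))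
        (by fun_prop)).le
    refine eLpNorm_two_le_ofReal (hs.lintegral_sgd_le hJ hM hN hn (by omega) h𝔅 hrep hε hε4 hε0 hαA0
      hαB0 hA4 hB4' hlam hcl.le hη) ?_ ((le_of_eq ?_).trans
        (sgd_rate_le (T := T) hN hn (by positivity) (by positivity) (by positivity)
          (by positivity)))
    · have := Real.log_natCast_nonneg T
      positivity
    · ring
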